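/- Let $n\ge 2$ and let $\theta=(\theta_{jk})$ be a real antisymmetric $n\times n$ matrix with columns $\theta_1,\dots,\theta_n$. Let $U_1,\dots,U_n$ be the unitaries $(U_j f)(x)=e^{ix_j}f(x+\pi\theta_j)$ on $L^2(\mathbb{T}^n)$, $\mathbb{T}^n=\mathbb{R}^n/2\pi\mathbb{Z}^n$, and put $U^k=U_1^{k_1}\cdots U_n^{k_n}$ for $k\in\mathbb{Z}^n$. Let $A_\theta$ be the $C^*$-algebra generated by $U_1,\dots,U_n$, with trace $\tau(u)=\langle u1\,|\,1\rangle$ and with the translation action $\alpha_s$ of $\mathbb{R}^n$, $\alpha_s(U^k)=e^{is\cdot k}U^k$. Let $\mathcal{A}_\theta=C^\infty(\mathbb{T}^n_\theta)$ be the algebra of those $u\in A_\theta$ for which $s\mapsto\alpha_s(u)$ is $C^\infty$, let $\delta_j(u)=\frac1i\partial_{s_j}\alpha_s(u)|_{s=0}$, and give $\mathcal{A}_\theta$ the locally convex topology of the seminorms $u\mapsto\|\delta^\alpha u\|$, $\alpha\in\mathbb{N}_0^n$. For $q\in\mathbb{C}$ let $S^q(\mathbb{R}^n;\mathcal{A}_\theta)$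 be the set of $C^\infty$ maps $\rho:\mathbb{R}^n\to\mathcal{A}_\theta$ for which there are $C^\infty$ maps $\rho_{q-j}:\mathbb{R}^n\setminus 0\to\mathcal{A}_\theta$, $j\ge 0$, with $\rho_{q-j}(t\xi)=t^{q-j}\rho_{q-j}(\xi)$ for $t>0$, such that for all $N\ge0$ and all multi-orders $\alpha,\beta$ there is $C>0$ with $$\Big\|\delta^\alpha\partial_\xi^\beta\Big(\rho-\sum_{j<N}\rho_{q-j}\Big)(\xi)\Big\|\le C|\xi|^{\Re q-N-|\beta|}\qquad(|\xi|\ge1).$$ Let $\Psi^q(\mathbb{T}^n_\theta)$ be the set of the linear operators $P_\rho:\mathcal{A}_\theta\to\mathcal{A}_\theta$, $P_\rho u=\sum_{k\in\mathbb{Z}^n}u_k\,\rho(k)U^k$ with $u_k=\tau(u(U^k)^*)$, for $\rho\in S^q(\mathbb{R}^n;\mathcal{A}_\theta)$; put $\Psi^{\mathbb{Z}}(\mathbb{T}^n_\theta)=\bigcup_{m\in\mathbb{Z}}\Psi^m(\mathbb{T}^n_\theta)$, and let $[\Psi^{\mathbb{Z}}(\mathbb{T}^n_\theta),\Psi^{\mathbb{Z}}(\mathbb{T}^n_\theta)]$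 be the linear span of the commutators of its elements. Let $\Psi^{-\infty}(\mathbb{T}^n_\theta)$ be the set of smoothing operators: the linear operators $R:\mathcal{A}_\theta\to\mathcal{A}_\theta$ that extend to a continuous linear map $\mathcal{A}_\theta'\to\mathcal{A}_\theta$, where the dual $\mathcal{A}_\theta'$ carries its strong topology and $u\in\mathcal{A}_\theta$ is identified with the functional $v\mapsto\tau(uv)$. Then for every $R\in\Psi^{-\infty}(\mathbb{T}^n_\theta)$ there are $P_1,\dots,P_n\in\Psi^{-n+1}(\mathbb{T}^n_\theta)$ and $R_1,\dots,R_4\in\Psi^{-\infty}(\mathbb{T}^n_\theta)$ such that $$R=[P_1,U_1]+\cdots+[P_n,U_n]+[R_1,R_2]+[R_3,R_4],$$ where $U_j$ acts on $\mathcal{A}_\theta$ by left multiplication. In particular, every smoothing operator is contained in $[\Psi^{\mathbb{Z}}(\mathbb{T}^n_\theta),\Psi^{\mathbb{Z}}(\mathbb{T}^n_\theta)]$. -/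

import Mathlib

noncomputable section

namespace NCTorus

open MeasureTheory Topology Filter
open scoped ContDiff ENNReal

/-- The normalised Haar measure `(2π)⁻ⁿ dx` on the `n`-torus. The torus `ℝⁿ / 2πℤⁿ` is written as
`(ℝ / ℤ)ⁿ` through the coordinates `y = x / 2π`. -/
def haarT (n : ℕ) : Measure (UnitAddTorus (Fin n)) :=
  Measure.pi fun _ => AddCircle.haarAddCircle

instance (n : ℕ) : IsProbabilityMeasure (haarT n) :=
  inferInstanceAs (IsProbabilityMeasure (Measure.pi fun _ : Fin n => AddCircle.haarAddCircle))

instance (n : ℕ) : (haarT n).IsAddHaarMeasure :=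
  inferInstanceAs (Measure.IsAddHaarMeasure (Measure.pi fun _ : Fin n => AddCircle.haarAddCircle))

/-- The Hilbert space `L²(𝕋ⁿ)`. -/
abbrev L2T (n : ℕ) : Type := Lp ℂ 2 (haarT n)

/-- The bounded operators on `L²(𝕋ⁿ)`. -/
abbrev OpL2T (n : ℕ) : Type := L2T n →L[ℂ] L2T n

variable {n : ℕ}

theorem memLp_weightedShift (g : C(UnitAddTorus (Fin n), Circle)) (a : UnitAddTorus (Fin n))
    (f : L2T n) : MemLp (fun x => (g x : ℂ) * f (x + a)) 2 (haarT n) := by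
  have h1 : MemLp (fun x => f (x + a)) 2 (haarT n) :=
    (Lp.memLp f).comp_measurePreserving (measurePreserving_add_right (haarT n) a)
  have hg : Continuous fun x => (g x : ℂ) := by fun_prop
  refine h1.of_le (hg.aestronglyMeasurable.mul h1.1) (Eventually.of_forall fun x => ?_)
  rw [norm_mul, Circle.norm_coe, one_mul]

theorem weightedShift_aux {f f' : UnitAddTorus (Fin n) → ℂ} (h : f =ᵐ[haarT n] f')
    (g : UnitAddTorus (Fin n) → ℂ) (a : UnitAddTorus (Fin n)) :
    (fun x => g x * f (x + a)) =ᵐ[haarT n] fun x => g x * f' (x + a) := by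
  have := (measurePreserving_add_right (haarT n) a).quasiMeasurePreserving.ae_eq_comp h
  filter_upwards [this] with x hx
  simp only [Function.comp] at hx
  rw [hx]

/-- The linear isometry `f ↦ (x ↦ g(x) f(x + a))` of `L²(𝕋ⁿ)`. -/
def weightedShiftLM (g : C(UnitAddTorus (Fin n), Circle)) (a : UnitAddTorus (Fin n)) :
    L2T n →ₗᵢ[ℂ] L2T n where
  toFun f := (memLp_weightedShift g a f).toLp
  map_add' f f' := by
    rw [← MemLp.toLp_add, MemLp.toLp_eq_toLp_iff]
    refine (weightedShift_aux (Lp.coeFn_add f f') _ a).trans (Eventually.of_forall fun x => ?_)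
    simp [mul_add]
  map_smul' c f := by
    rw [RingHom.id_apply, ← MemLp.toLp_const_smul, MemLp.toLp_eq_toLp_iff]
    refine (weightedShift_aux (Lp.coeFn_smul c f) _ a).trans (Eventually.of_forall fun x => ?_)
    simp [mul_left_comm]
  norm_map' f := by
    simp only [LinearMap.coe_mk, AddHom.coe_mk]
    rw [Lp.norm_toLp, Lp.norm_def]
    congr 1
    rw [← eLpNorm_comp_measurePreserving (Lp.aestronglyMeasurable f)
      (measurePreserving_add_right (haarT n) a)]
    exact eLpNorm_congr_norm_ae (Eventually.of_forall fun x => by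
      rw [norm_mul, Circle.norm_coe, one_mul, Function.comp])

theorem weightedShiftLM_comp (g h : C(UnitAddTorus (Fin n), Circle))
    (a b : UnitAddTorus (Fin n)) (f : L2T n) :
    weightedShiftLM g a (weightedShiftLM h b f)
      = weightedShiftLM (g * h.comp (ContinuousMap.mk fun x => x + a)) (a + b) f := by
  refine MemLp.toLp_congr (memLp_weightedShift _ _ _) (memLp_weightedShift _ _ _) ?_
  refine (weightedShift_aux (MemLp.coeFn_toLp (memLp_weightedShift h b f)) _ a).trans (Eventually.of_forall fun x => ?_)
  simp [mul_assoc, add_assoc]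

theorem weightedShiftLM_one (f : L2T n) : weightedShiftLM (n := n) 1 0 f = f := by
  refine Eq.trans (MemLp.toLp_congr (memLp_weightedShift _ _ _) (Lp.memLp f) (Eventually.of_forall fun x => ?_))
    (Lp.toLp_coeFn f _)
  simp

/-- The unitary operator `f ↦ (x ↦ g(x) f(x + a))` on `L²(𝕋ⁿ)`, for `g` of modulus one. -/
def weightedShift (g : C(UnitAddTorus (Fin n), Circle)) (a : UnitAddTorus (Fin n)) :
    unitary (OpL2T n) :=
  Unitary.linearIsometryEquiv.symm
    { (weightedShiftLM g a).toLinearMap with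
      invFun := weightedShiftLM (g⁻¹.comp (ContinuousMap.mk fun x => x - a)) (-a)
      left_inv := fun f => by
        refine (weightedShiftLM_comp _ _ _ _ f).trans ?_
        convert weightedShiftLM_one f using 2
        · congr 1
          · ext x
            simp [sub_eq_add_neg]
          · simp
      right_inv := fun f => by
        refine (weightedShiftLM_comp _ _ _ _ f).trans ?_
        convert weightedShiftLM_one f using 2
        · congr 1
          · ext x
            simp [sub_eq_add_neg]
          · simp
      norm_map' := (weightedShiftLM g a).norm_map }

theorem weightedShift_apply (g : C(UnitAddTorus (Fin n), Circle)) (a : UnitAddTorus (Fin n))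
    (f : L2T n) : (weightedShift g a : OpL2T n) f = weightedShiftLM g a f := rfl

theorem weightedShift_mul (g h : C(UnitAddTorus (Fin n), Circle))
    (a b : UnitAddTorus (Fin n)) :
    weightedShift g a * weightedShift h b
      = weightedShift (g * h.comp (ContinuousMap.mk fun x => x + a)) (a + b) := by
  ext1
  ext1 f
  exact weightedShiftLM_comp g h a b f

/-- The function `e^{i x_j} = e^{2 π i y_j}` on the torus. -/
def expCoord (j : Fin n) : C(UnitAddTorus (Fin n), Circle) where
  toFun y := AddCircle.toCircle (y j)
  continuous_toFun := AddCircle.continuous_toCircle.comp (continuous_apply j)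

/-- The projection `ℝⁿ → (ℝ / ℤ)ⁿ`. -/
def toTorus (v : Fin n → ℝ) : UnitAddTorus (Fin n) := fun i => ((v i : ℝ) : UnitAddCircle)

/-- The unitary `(U_j f)(x) = e^{i x_j} f(x + π θ_j)`, with `θ_j` the `j`-th column of `θ`;
a translation of `x` by `π θ_j` is a translation of `y = x / 2π` by `θ_j / 2`. -/
def U (θ : Matrix (Fin n) (Fin n) ℝ) (j : Fin n) : unitary (OpL2T n) :=
  weightedShift (expCoord j) (toTorus fun i => θ i j / 2)

/-- The translation `f ↦ f(· + s)`, in the coordinate `x = 2π y`. -/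
def V (s : EuclideanSpace ℝ (Fin n)) : unitary (OpL2T n) :=
  weightedShift 1 (toTorus fun i => s i / (2 * Real.pi))

/-- The action `α_s(T) = V_s T V_s⁻¹` of `ℝⁿ` on the bounded operators by translations. -/
def alpha (s : EuclideanSpace ℝ (Fin n)) : OpL2T n ≃⋆ₐ[ℂ] OpL2T n :=
  Unitary.conjStarAlgAut ℂ (OpL2T n) (V s)

theorem V_add (s t : EuclideanSpace ℝ (Fin n)) : V (s + t) = V s * V t := by
  rw [V, V, V, weightedShift_mul]
  congr 1
  · ext x
    simp
  · funext i
    simp [toTorus, add_div]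

theorem alpha_add (s t : EuclideanSpace ℝ (Fin n)) (T : OpL2T n) :
    alpha (s + t) T = alpha s (alpha t T) := by
  simp [alpha, V_add, map_mul]

theorem alpha_U (θ : Matrix (Fin n) (Fin n) ℝ) (s : EuclideanSpace ℝ (Fin n)) (j : Fin n) :
    alpha s (U θ j : OpL2T n) = Complex.exp ((s j : ℂ) * Complex.I) • (U θ j : OpL2T n) := by
  have key : ((V s * U θ j : unitary (OpL2T n)) : OpL2T n)
      = Complex.exp ((s j : ℂ) * Complex.I) • ((U θ j * V s : unitary (OpL2T n)) : OpL2T n) := by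
    rw [V, U, weightedShift_mul, weightedShift_mul, add_comm]
    ext1 f
    rw [smul_apply, weightedShift_apply, weightedShift_apply]
    change MemLp.toLp _ (memLp_weightedShift _ _ _) = _ • MemLp.toLp _ (memLp_weightedShift _ _ _)
    rw [← MemLp.toLp_const_smul, MemLp.toLp_eq_toLp_iff]
    refine Eventually.of_forall fun x => ?_
    have h : (2 * (Real.pi : ℂ) * (s j / (2 * Real.pi))) = s j := by
      have : (Real.pi : ℂ) ≠ 0 := by exact_mod_cast Real.pi_ne_zero
      field_simp
    simp only [expCoord, toTorus, ContinuousMap.mul_apply, ContinuousMap.one_apply,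
      ContinuousMap.comp_apply, ContinuousMap.coe_mk, Pi.add_apply, Pi.smul_apply,
      AddCircle.toCircle_add, AddCircle.toCircle_apply_mk, Circle.coe_exp, Circle.coe_mul, one_mul,
      mul_one, smul_eq_mul, div_one, Complex.ofReal_mul, Complex.ofReal_div, Complex.ofReal_ofNat, h]
    ring
  rw [alpha, Unitary.conjStarAlgAut_apply]
  have h2 := congrArg (fun T => T * (star (V s) : OpL2T n)) key
  simp only [Submonoid.coe_mul, smul_mul_assoc, mul_assoc] at h2
  rw [mul_assoc, h2]
  congr 1
  rw [Unitary.mul_star_self_of_mem (V s).2, mul_one]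


/-- The noncommutative torus `A_θ`: the `C*`-algebra generated by `U_1, …, U_n`. -/
def ncTorus (θ : Matrix (Fin n) (Fin n) ℝ) : StarSubalgebra ℂ (OpL2T n) :=
  (StarAlgebra.adjoin ℂ (Set.range fun j => (U θ j : OpL2T n))).topologicalClosure

theorem U_mem_ncTorus (θ : Matrix (Fin n) (Fin n) ℝ) (j : Fin n) :
    (U θ j : OpL2T n) ∈ ncTorus θ :=
  StarSubalgebra.le_topologicalClosure _ (StarAlgebra.subset_adjoin _ _ ⟨j, rfl⟩)

theorem isClosed_ncTorus (θ : Matrix (Fin n) (Fin n) ℝ) :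
    IsClosed (ncTorus θ : Set (OpL2T n)) :=
  StarSubalgebra.isClosed_topologicalClosure _

theorem real_smul_op (c : ℝ) (T : OpL2T n) : c • T = (c : ℂ) • T := by
  ext1 f
  rw [smul_apply, smul_apply]
  exact (algebraMap_smul ℂ c (T f)).symm

/-- The adjoint as a continuous real-linear map. -/
def adjL : OpL2T n →L[ℝ] OpL2T n where
  toFun T := star T
  map_add' := star_add
  map_smul' c T := by
    rw [real_smul_op, star_smul, RingHom.id_apply, real_smul_op]
    simp
  cont := continuous_star

/-- `α_s` as a continuous real-linear map. -/
def alphaL (s : EuclideanSpace ℝ (Fin n)) : OpL2T n →L[ℝ] OpL2T n where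
  toFun := alpha s
  map_add' := map_add _
  map_smul' c T := by
    rw [real_smul_op, map_smul, RingHom.id_apply, real_smul_op]
  cont := by
    change Continuous fun T : OpL2T n => (V s : OpL2T n) * T * (star (V s) : OpL2T n)
    fun_prop

theorem alpha_mem (θ : Matrix (Fin n) (Fin n) ℝ) (s : EuclideanSpace ℝ (Fin n)) {T : OpL2T n}
    (hT : T ∈ ncTorus θ) : alpha s T ∈ ncTorus θ := by
  have hcl : IsClosed {T : OpL2T n | alpha s T ∈ ncTorus θ} :=
    (isClosed_ncTorus θ).preimage (alphaL s).continuous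
  refine closure_minimal (fun T hT => ?_) hcl hT
  have hle : StarAlgebra.adjoin ℂ (Set.range fun j => (U θ j : OpL2T n))
      ≤ (ncTorus θ).comap (alpha s : OpL2T n →⋆ₐ[ℂ] OpL2T n) := by
    rw [StarAlgebra.adjoin_le_iff]
    rintro _ ⟨j, rfl⟩
    change alpha s (U θ j : OpL2T n) ∈ ncTorus θ
    rw [alpha_U]
    exact (ncTorus θ).smul_mem (U_mem_ncTorus θ j) _
  exact hle hT

/-- The elements `u` of `A_θ` for which `s ↦ α_s(u)` is a smooth map. -/
def smoothSubalgebra (θ : Matrix (Fin n) (Fin n) ℝ) : StarSubalgebra ℂ (OpL2T n) where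
  carrier := {u | u ∈ ncTorus θ ∧
    ContDiff ℝ ∞ fun s : EuclideanSpace ℝ (Fin n) => alpha s u}
  mul_mem' := by
    rintro a b ⟨ha, ha'⟩ ⟨hb, hb'⟩
    refine ⟨mul_mem ha hb, ?_⟩
    simp only [map_mul]
    exact ha'.mul hb'
  add_mem' := by
    rintro a b ⟨ha, ha'⟩ ⟨hb, hb'⟩
    refine ⟨add_mem ha hb, ?_⟩
    simp only [map_add]
    exact ha'.add hb'
  algebraMap_mem' c := by
    refine ⟨algebraMap_mem _ c, ?_⟩
    simp only [AlgHomClass.commutes]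
    exact contDiff_const
  star_mem' := by
    rintro a ⟨ha, ha'⟩
    refine ⟨star_mem ha, ?_⟩
    simp only [map_star]
    exact adjL.contDiff.comp ha'

/-- The smooth noncommutative torus `𝒜_θ = C^∞(𝕋ⁿ_θ)`; a type of its own, since it carries its
Fréchet topology (below) and not the norm topology. -/
def SmoothTorus (θ : Matrix (Fin n) (Fin n) ℝ) : Type := smoothSubalgebra θ

variable {θ : Matrix (Fin n) (Fin n) ℝ}

namespace SmoothTorus

instance : Ring (SmoothTorus θ) := inferInstanceAs (Ring (smoothSubalgebra θ))
instance : StarRing (SmoothTorus θ) := inferInstanceAs (StarRing (smoothSubalgebra θ))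
instance : Algebra ℂ (SmoothTorus θ) := inferInstanceAs (Algebra ℂ (smoothSubalgebra θ))

/-- The inclusion of `𝒜_θ` into the bounded operators on `L²(𝕋ⁿ)`. -/
def toOp : SmoothTorus θ →ₗ[ℂ] OpL2T n := (smoothSubalgebra θ).subtype.toLinearMap

theorem toOp_mul (u v : SmoothTorus θ) : toOp (u * v) = toOp u * toOp v := rfl

theorem hasFDerivAt_alpha (u : SmoothTorus θ) (s : EuclideanSpace ℝ (Fin n)) :
    HasFDerivAt (fun t => alpha t (toOp u)) (fderiv ℝ (fun t => alpha t (toOp u)) s) s :=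
  (u.2.2.differentiable (by simp)).differentiableAt.hasFDerivAt

theorem alpha_fderiv (u : SmoothTorus θ) (s v : EuclideanSpace ℝ (Fin n)) :
    alpha s (fderiv ℝ (fun t => alpha t (toOp u)) 0 v)
      = fderiv ℝ (fun t => alpha t (toOp u)) s v := by
  have h1 := (alphaL s).hasFDerivAt.comp (0 : EuclideanSpace ℝ (Fin n)) (hasFDerivAt_alpha u 0)
  have h2 : HasFDerivAt (fun t => alpha (s + t) (toOp u))
      (fderiv ℝ (fun t => alpha t (toOp u)) s) 0 := by
    refine (hasFDerivAt_comp_add_left (f := fun t => alpha t (toOp u)) s).2 ?_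
    rw [add_zero]
    exact hasFDerivAt_alpha u s
  simp only [alpha_add] at h2
  exact DFunLike.congr_fun (h1.unique h2) v

theorem fderiv_mem (u : SmoothTorus θ) (v : EuclideanSpace ℝ (Fin n)) :
    fderiv ℝ (fun t => alpha t (toOp u)) 0 v ∈ smoothSubalgebra θ := by
  constructor
  · have h := ((hasFDerivAt_alpha u 0).hasLineDerivAt v).tendsto_slope_zero
    refine (isClosed_ncTorus θ).mem_of_tendsto h (Eventually.of_forall fun t => ?_)
    rw [real_smul_op]
    exact (ncTorus θ).smul_mem (sub_mem (alpha_mem θ _ u.2.1) (alpha_mem θ _ u.2.1)) _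
  · simp only [alpha_fderiv]
    exact (u.2.2.fderiv_right (m := ∞) (by simp)).clm_apply contDiff_const

/-- `δ_j u = (1/i) ∂_{s_j} α_s(u)` at `s = 0`. -/
def delta (j : Fin n) : Module.End ℂ (SmoothTorus θ) where
  toFun u := (⟨(1 / Complex.I) • fderiv ℝ (fun s => alpha s (toOp u)) 0 (EuclideanSpace.single j 1),
    (smoothSubalgebra θ).smul_mem (fderiv_mem u _) _⟩ : smoothSubalgebra θ)
  map_add' u v := by
    apply Subtype.ext
    have := ((hasFDerivAt_alpha u 0).add (hasFDerivAt_alpha v 0)).fderiv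
    change (1 / Complex.I) • fderiv ℝ (fun s => alpha s (toOp u + toOp v)) 0 _
      = (1 / Complex.I) • _ + (1 / Complex.I) • _
    simp only [map_add]
    rw [← smul_add]
    congr 1
    exact DFunLike.congr_fun this _
  map_smul' c u := by
    apply Subtype.ext
    have := ((hasFDerivAt_alpha u 0).const_smul c).fderiv
    change (1 / Complex.I) • fderiv ℝ (fun s => alpha s (c • toOp u)) 0 _
      = c • ((1 / Complex.I) • _)
    simp only [map_smul]
    rw [smul_comm]
    congr 1
    exact DFunLike.congr_fun this _

/-- The iterated derivation `δ_{j_1} ⋯ δ_{j_m}` for a word `j_1 … j_m`. As the `δ_j` commute, these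
are the `δ^α` for `α` a multi-order, with `|α|` the length of the word. -/
def deltas (a : List (Fin n)) : Module.End ℂ (SmoothTorus θ) := (a.map delta).prod

/-- The seminorms `u ↦ ‖δ^α u‖` on `𝒜_θ`. -/
def seminorms (θ : Matrix (Fin n) (Fin n) ℝ) : SeminormFamily ℂ (SmoothTorus θ) (List (Fin n)) :=
  fun a => (normSeminorm ℂ (OpL2T n)).comp (toOp ∘ₗ deltas a)

/-- The locally convex topology of `𝒜_θ`, defined by the seminorms `u ↦ ‖δ^α u‖`. -/
instance : TopologicalSpace (SmoothTorus θ) := (seminorms θ).moduleFilterBasis.topology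

theorem withSeminorms_seminorms : WithSeminorms (seminorms θ) := ⟨rfl⟩

instance : IsTopologicalAddGroup (SmoothTorus θ) := withSeminorms_seminorms.topologicalAddGroup
instance : ContinuousSMul ℂ (SmoothTorus θ) := withSeminorms_seminorms.continuousSMul

theorem alpha_U_contDiff (j : Fin n) :
    ContDiff ℝ ∞ fun s : EuclideanSpace ℝ (Fin n) => alpha s (U θ j : OpL2T n) := by
  simp only [alpha_U]
  refine ContDiff.smul (ContDiff.cexp (ContDiff.mul ?_ contDiff_const)) contDiff_const
  exact Complex.ofRealCLM.contDiff.comp (EuclideanSpace.proj (𝕜 := ℝ) j).contDiff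

/-- The unitary `U_j` as an element of `𝒜_θ`. -/
def gen (θ : Matrix (Fin n) (Fin n) ℝ) (j : Fin n) : unitary (SmoothTorus θ) :=
  ⟨(⟨(U θ j : OpL2T n), U_mem_ncTorus θ j, alpha_U_contDiff j⟩ : smoothSubalgebra θ),
    Subtype.ext (Unitary.star_mul_self_of_mem (U θ j).2),
    Subtype.ext (Unitary.mul_star_self_of_mem (U θ j).2)⟩

/-- `U^k = U_1^{k_1} ⋯ U_n^{k_n}` for `k ∈ ℤⁿ`. -/
def monomial (θ : Matrix (Fin n) (Fin n) ℝ) (k : Fin n → ℤ) : unitary (SmoothTorus θ) :=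
  (List.ofFn fun j => gen θ j ^ k j).prod

/-- The trace `τ(u) = ⟨u 1 | 1⟩`. -/
def tau (u : SmoothTorus θ) : ℂ :=
  inner ℂ (Lp.const 2 (haarT n) (1 : ℂ)) (toOp u (Lp.const 2 (haarT n) (1 : ℂ)))

/-- The Fourier coefficient `u_k = ⟨u | U^k⟩ = τ(u (U^k)^*)`. -/
def coeff (u : SmoothTorus θ) (k : Fin n → ℤ) : ℂ :=
  tau (u * star (monomial θ k : SmoothTorus θ))

theorem continuous_toOp : Continuous (toOp (θ := θ)) :=
  withSeminorms_seminorms.continuous_normedSpace_rng (OpL2T n) toOp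
    ⟨{[]}, 1, fun u => by simp [seminorms, deltas]⟩

/-- The embedding of `𝒜_θ` into its topological dual: `u` acts as `v ↦ τ(u v)`. -/
def toDual (u : SmoothTorus θ) : StrongDual ℂ (SmoothTorus θ) where
  toFun v := tau (u * v)
  map_add' v w := by simp [tau, mul_add, inner_add_right]
  map_smul' c v := by simp [tau, inner_smul_right]
  cont := by
    simp only [tau, toOp_mul]
    have := continuous_toOp (θ := θ)
    change Continuous fun v => inner ℂ _ (toOp u (toOp v (Lp.const 2 (haarT n) (1 : ℂ))))
    fun_prop

end SmoothTorus

section Smooth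

variable {F : Type*} [AddCommGroup F] [Module ℝ F] [TopologicalSpace F]

/-- The difference quotient `(f(ξ + t e_j) - f(ξ)) / t`. -/
def diffQuot (f : EuclideanSpace ℝ (Fin n) → F) (j : Fin n) (ξ : EuclideanSpace ℝ (Fin n))
    (t : ℝ) : F := t⁻¹ • (f (ξ + t • EuclideanSpace.single j 1) - f ξ)

/-- The partial derivative `∂_j f`, for maps into a topological vector space. -/
def pderiv (j : Fin n) (f : EuclideanSpace ℝ (Fin n) → F) : EuclideanSpace ℝ (Fin n) → F :=
  fun ξ => limUnder (𝓝[≠] (0 : ℝ)) (diffQuot f j ξ)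

/-- The iterated partial derivative `∂_{j_1} ⋯ ∂_{j_m} f` for a word `j_1 … j_m`. For smooth `f` the
order of the letters is immaterial, so these are the `∂^β f`, with `|β|` the length of the word. -/
def pderivs (b : List (Fin n)) (f : EuclideanSpace ℝ (Fin n) → F) :
    EuclideanSpace ℝ (Fin n) → F :=
  b.foldr pderiv f

/-- `f` is `C^∞` on the open set `Ω`: all iterated partial derivatives exist and are continuous. -/
def IsSmoothOn (Ω : Set (EuclideanSpace ℝ (Fin n))) (f : EuclideanSpace ℝ (Fin n) → F) : Prop :=
  ∀ b : List (Fin n), ContinuousOn (pderivs b f) Ω ∧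
    ∀ j : Fin n, ∀ ξ ∈ Ω,
      ∃ v, Tendsto (diffQuot (pderivs b f) j ξ) (𝓝[≠] 0) (𝓝 v)

end Smooth

open SmoothTorus

/-- Homogeneous symbols of degree `q`: the class `S_q(ℝⁿ; 𝒜_θ)`. -/
structure IsHomogeneousSymbol (q : ℂ) (ρ : EuclideanSpace ℝ (Fin n) → SmoothTorus θ) : Prop where
  smooth : IsSmoothOn {0}ᶜ ρ
  homogeneous : ∀ ξ, ξ ≠ 0 → ∀ t : ℝ, 0 < t → ρ (t • ξ) = ((t : ℂ) ^ q) • ρ ξ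

/-- Classical symbols of order `q`: the class `S^q(ℝⁿ; 𝒜_θ)` of the smooth maps `ρ` that have an
asymptotic expansion `ρ ∼ ∑ ρ_{q-j}` with `ρ_{q-j}` homogeneous of degree `q - j`. -/
structure IsClassicalSymbol (q : ℂ) (ρ : EuclideanSpace ℝ (Fin n) → SmoothTorus θ) : Prop where
  smooth : IsSmoothOn Set.univ ρ
  expansion : ∃ ρh : ℕ → EuclideanSpace ℝ (Fin n) → SmoothTorus θ,
    (∀ j : ℕ, IsHomogeneousSymbol (q - j) (ρh j)) ∧
    ∀ (N : ℕ) (a b : List (Fin n)), ∃ C : ℝ, ∀ ξ, 1 ≤ ‖ξ‖ →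
      ‖toOp (deltas a (pderivs b (ρ - ∑ j ∈ Finset.range N, ρh j) ξ))‖
        ≤ C * ‖ξ‖ ^ (q.re - N - b.length)

/-- The lattice `ℤⁿ` in `ℝⁿ`. -/
def latticePt (k : Fin n → ℤ) : EuclideanSpace ℝ (Fin n) := WithLp.toLp 2 fun i => (k i : ℝ)

/-- `P` is the operator `P_ρ`: `P u = ∑_k u_k ρ(k) U^k` for all `u = ∑_k u_k U^k`, with convergence
in `𝒜_θ`. -/
def IsQuantization (ρ : EuclideanSpace ℝ (Fin n) → SmoothTorus θ)
    (P : Module.End ℂ (SmoothTorus θ)) : Prop :=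
  ∀ u, HasSum (fun k => coeff u k • (ρ (latticePt k) * (monomial θ k : SmoothTorus θ))) (P u)

/-- The class `Ψ^q(𝕋ⁿ_θ)` of classical pseudodifferential operators of order `q`. -/
def PsiDO (θ : Matrix (Fin n) (Fin n) ℝ) (q : ℂ) : Set (Module.End ℂ (SmoothTorus θ)) :=
  {P | ∃ ρ, IsClassicalSymbol q ρ ∧ IsQuantization ρ P}

/-- The class `Ψ^ℤ(𝕋ⁿ_θ)` of classical pseudodifferential operators of integer order. -/
def PsiDOInt (θ : Matrix (Fin n) (Fin n) ℝ) : Set (Module.End ℂ (SmoothTorus θ)) :=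
  ⋃ m : ℤ, PsiDO θ m

/-- The linear span `[X, X]` of the commutators of elements of `X`. -/
def commutatorSpace (X : Set (Module.End ℂ (SmoothTorus θ))) :
    Submodule ℂ (Module.End ℂ (SmoothTorus θ)) :=
  Submodule.span ℂ {T | ∃ P ∈ X, ∃ Q ∈ X, T = ⁅P, Q⁆}

/-- Smoothing operators: the operators on `𝒜_θ` that extend to a continuous linear map from the
strong dual of `𝒜_θ` to `𝒜_θ`. -/
def Smoothing (θ : Matrix (Fin n) (Fin n) ℝ) : Set (Module.End ℂ (SmoothTorus θ)) :=
  {R | ∃ S : StrongDual ℂ (SmoothTorus θ) →L[ℂ] SmoothTorus θ, ∀ u, S (toDual u) = R u}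

end NCTorus

end

/-! In the basis `U^k` an operator on `𝒜_θ` becomes a matrix over `ℤⁿ`, and the smoothing operators
are exactly those whose matrix decays rapidly in both indices (`rapidFamily_of_smoothing`,
`smoothing_of_matrix`). Such a matrix has a trace, the sum of its diagonal, and the trace is the
only obstruction to being a sum of commutators of smoothing operators.

Trace zero suffices (`exists_smoothing_commutators`). Enumerate `ℤⁿ` by `ℕ` with polynomial control
of the weights. The off-diagonal part is `[D, X]`, with `D` diagonal and rapidly decaying and `X i j
= A i j / (d i - d j)`; the gaps of `d` are chosen so large, relative to `A`, that `X` still decays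
rapidly. The diagonal part has sum zero, hence rapidly decaying partial sums; writing these as `a i
* b i` makes it the commutator of two weighted shifts.

It remains to produce a smoothing operator of nonzero trace of the form `∑ [P_j, U_j]`. If `T_j`
multiplies `U^k` by `f_j(k)`, then `[U_j^* T_j, U_j]` multiplies `U^k` by `f_j(k + e_j) - f_j(k)`,
so the sum over `j` multiplies by a discrete divergence. Let `f_j` be the flux, through the face
orthogonal to `e_j` of the unit cube with corner `ξ`, of the field `ξ |ξ|^{-n}` cut off near the
origin. By the divergence theorem the discrete divergence at `k` is the integral of the divergence
over the cube at `k`. It is nonnegative, positive at `k = 0`, and zero once the cube misses the unit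
ball (`exists_isScalarSymbol_divergence`). The order `-n + 1` is what lets a flux survive at
infinity and keeps the trace from vanishing.

That `f_j` is a classical symbol follows by homogenising: shrinking the face by a factor `ε` gives a
function jointly homogeneous in `(ε, ξ)`, and its Taylor expansion in `ε`, taken at `ε = 1`, is the
asymptotic expansion (`isScalarSymbol_of_isHomogeneousOn`). -/

noncomputable section
namespace NCTorus
open MeasureTheory Topology Filter
open scoped ContDiff ENNReal
variable {n : ℕ}

/-! ### Weyl operators and Fourier coefficients -/

/-- The character `e^{i k·x}` of the torus. -/
def expChar (k : Fin n → ℤ) : C(UnitAddTorus (Fin n), Circle) := ∏ j, expCoord j ^ k j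

theorem expChar_apply (k : Fin n → ℤ) (x : UnitAddTorus (Fin n)) :
    expChar k x = ∏ j, AddCircle.toCircle (x j) ^ k j := by
  simp [expChar, expCoord, ContinuousMap.prod_apply]

theorem expChar_add (k l : Fin n → ℤ) : expChar (k + l) = expChar k * expChar l := by
  simp [expChar, zpow_add, Finset.prod_mul_distrib]

theorem expChar_zero : expChar (0 : Fin n → ℤ) = 1 := by simp [expChar]

theorem expChar_single (j : Fin n) : expChar (Pi.single j 1) = expCoord j := by
  rw [expChar, Finset.prod_eq_single j]
  · simp
  · intro i _ hi
    simp [Pi.single_eq_of_ne hi]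
  · simp

theorem expChar_apply_add (k : Fin n → ℤ) (x y : UnitAddTorus (Fin n)) :
    expChar k (x + y) = expChar k x * expChar k y := by
  simp [expChar_apply, AddCircle.toCircle_add, mul_zpow, Finset.prod_mul_distrib]

/-- The real pairing `k · v`. -/
def pair (k : Fin n → ℤ) (v : Fin n → ℝ) : ℝ := ∑ j, k j * v j

theorem expChar_toTorus (k : Fin n → ℤ) (v : Fin n → ℝ) :
    expChar k (toTorus v) = Circle.exp (2 * Real.pi * pair k v) := by
  have h (s : Finset (Fin n)) : ∏ j ∈ s, AddCircle.toCircle (toTorus v j) ^ k j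
      = Circle.exp (2 * Real.pi * ∑ j ∈ s, k j * v j) := by
    induction s using Finset.induction_on with
    | empty => simp
    | insert a s ha ih =>
      rw [Finset.prod_insert ha, ih, Finset.sum_insert ha, mul_add, Circle.exp_add]
      congr 1
      rw [toTorus, AddCircle.toCircle_apply_mk, ← Circle.exp_zsmul, zsmul_eq_mul]
      congr 1
      ring
  rw [expChar_apply, h, pair]

theorem coe_expChar (k : Fin n → ℤ) (x : UnitAddTorus (Fin n)) :
    (expChar k x : ℂ) = UnitAddTorus.mFourier k x := by
  have h (s : Finset (Fin n)) : ((∏ j ∈ s, AddCircle.toCircle (x j) ^ k j : Circle) : ℂ)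
      = ∏ j ∈ s, (fourier (k j) (x j) : ℂ) := by
    induction s using Finset.induction_on with
    | empty => simp
    | insert a s ha ih =>
      rw [Finset.prod_insert ha, Finset.prod_insert ha, Circle.coe_mul, ih, fourier_apply,
        AddCircle.toCircle_zsmul]
  rw [expChar_apply, h]
  rfl

/-- The operator `f ↦ e^{i k·x} f(x + 2πv)`. -/
def weyl (k : Fin n → ℤ) (v : Fin n → ℝ) : OpL2T n :=
  (weightedShift (expChar k) (toTorus v) : unitary (OpL2T n))

theorem toTorus_add (v w : Fin n → ℝ) : toTorus (v + w) = toTorus v + toTorus w := by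
  funext i
  simp [toTorus]

theorem weightedShift_const_mul (c : Circle) (g : C(UnitAddTorus (Fin n), Circle))
    (a : UnitAddTorus (Fin n)) :
    (weightedShift (ContinuousMap.const _ c * g) a : OpL2T n)
      = (c : ℂ) • (weightedShift g a : OpL2T n) := by
  ext1 f
  rw [smul_apply, weightedShift_apply, weightedShift_apply]
  change MemLp.toLp _ (memLp_weightedShift _ _ _) = _ • MemLp.toLp _ (memLp_weightedShift _ _ _)
  rw [← MemLp.toLp_const_smul, MemLp.toLp_eq_toLp_iff]
  refine Eventually.of_forall fun x => ?_
  simp [mul_assoc]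

/-- A translation changes a character only by a phase. All products, adjoints and commutations below
are read off from this relation. -/
theorem weyl_mul (k l : Fin n → ℤ) (v w : Fin n → ℝ) :
    weyl k v * weyl l w = (Circle.exp (2 * Real.pi * pair l v) : ℂ) • weyl (k + l) (v + w) := by
  have h : expChar k * (expChar l).comp (ContinuousMap.mk fun x => x + toTorus v)
      = ContinuousMap.const _ (Circle.exp (2 * Real.pi * pair l v)) * expChar (k + l) := by
    ext x
    rw [expChar_add]
    simp only [ContinuousMap.mul_apply, ContinuousMap.comp_apply, ContinuousMap.coe_mk,
      expChar_apply_add, expChar_toTorus, ContinuousMap.const_apply, Circle.coe_mul]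
    ring
  rw [weyl, weyl, weyl, ← Submonoid.coe_mul, weightedShift_mul, h, weightedShift_const_mul,
    toTorus_add]

theorem weightedShift_one_zero : (weightedShift (1 : C(UnitAddTorus (Fin n), Circle)) 0 : OpL2T n) = 1 := by
  ext1 f
  exact weightedShiftLM_one f

theorem toTorus_zero : toTorus (0 : Fin n → ℝ) = 0 := by
  funext i
  simp [toTorus]

theorem weyl_zero : weyl (0 : Fin n → ℤ) 0 = 1 := by
  rw [weyl, expChar_zero, toTorus_zero, weightedShift_one_zero]

theorem star_weyl_mul (k : Fin n → ℤ) (v : Fin n → ℝ) : star (weyl k v) * weyl k v = 1 :=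
  Unitary.star_mul_self_of_mem (weightedShift (expChar k) (toTorus v)).2

theorem weyl_mul_star (k : Fin n → ℤ) (v : Fin n → ℝ) : weyl k v * star (weyl k v) = 1 :=
  Unitary.mul_star_self_of_mem (weightedShift (expChar k) (toTorus v)).2

theorem star_weyl (k : Fin n → ℤ) (v : Fin n → ℝ) :
    star (weyl k v) = (Circle.exp (2 * Real.pi * pair k v) : ℂ) • weyl (-k) (-v) := by
  have h1 : weyl k v * ((Circle.exp (2 * Real.pi * pair k v) : ℂ) • weyl (-k) (-v)) = 1 := by
    rw [mul_smul_comm, weyl_mul, smul_smul, ← Circle.coe_mul, ← Circle.exp_add]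
    have : 2 * Real.pi * pair k v + 2 * Real.pi * pair (-k) v = 0 := by
      simp [pair, Finset.sum_neg_distrib]
    rw [this, add_neg_cancel, add_neg_cancel, weyl_zero]
    simp
  calc star (weyl k v) = star (weyl k v) * (weyl k v * _) := by rw [h1, mul_one]
    _ = _ := by rw [← mul_assoc, star_weyl_mul, one_mul]

/-- The constant function `1` in `L²(𝕋ⁿ)`. -/
def vac : L2T n := Lp.const 2 (haarT n) (1 : ℂ)

/-- The Fourier basis of `L²(𝕋ⁿ)`. -/
def fb : HilbertBasis (Fin n → ℤ) ℂ (L2T n) := UnitAddTorus.mFourierBasis (d := Fin n)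

theorem fb_ae (k : Fin n → ℤ) : (fb k : L2T n) =ᵐ[haarT n] UnitAddTorus.mFourier k := by
  have h : (fb (n := n) : (Fin n → ℤ) → L2T n) = UnitAddTorus.mFourierLp 2 :=
    UnitAddTorus.coe_mFourierBasis
  rw [h]
  exact UnitAddTorus.coeFn_mFourierLp 2 k

theorem fb_zero : fb (0 : Fin n → ℤ) = vac := by
  apply Lp.ext
  refine (fb_ae 0).trans ?_
  refine EventuallyEq.trans ?_ (Lp.coeFn_const (p := 2) (μ := haarT n) (c := (1 : ℂ))).symm
  simp [UnitAddTorus.mFourier_zero]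

/-- Translations fix constants, so the shift `v` is invisible on the vacuum. Hence `U^k` and the
operator of the commutant with the opposite shift both send it to a multiple of `fb k`. -/
theorem weyl_vac (k : Fin n → ℤ) (v : Fin n → ℝ) : weyl k v vac = fb k := by
  apply Lp.ext
  refine (MemLp.coeFn_toLp (memLp_weightedShift _ _ _)).trans ?_
  refine EventuallyEq.trans ?_ (fb_ae k).symm
  have h := (measurePreserving_add_right (haarT n) (toTorus v)).quasiMeasurePreserving.ae_eq_comp
    (Lp.coeFn_const (p := 2) (μ := haarT n) (c := (1 : ℂ)))
  filter_upwards [h] with x hx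
  simp only [Function.comp] at hx
  change (expChar k x : ℂ) * (Lp.const 2 (haarT n) (1 : ℂ)) (x + toTorus v) = _
  rw [hx, coe_expChar]
  simp

variable (θ : Matrix (Fin n) (Fin n) ℝ)

/-- The vector `θ k / 2`. -/
def halfShift (k : Fin n → ℤ) : Fin n → ℝ := fun i => (∑ j, θ i j * k j) / 2

theorem halfShift_add (k l : Fin n → ℤ) : halfShift θ (k + l) = halfShift θ k + halfShift θ l := by
  funext i
  simp [halfShift, mul_add, Finset.sum_add_distrib, add_div]

theorem halfShift_neg (k : Fin n → ℤ) : halfShift θ (-k) = -halfShift θ k := by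
  funext i
  simp [halfShift, neg_div]

theorem halfShift_zero : halfShift θ 0 = 0 := by
  funext i
  simp [halfShift]

theorem halfShift_single (j : Fin n) : halfShift θ (Pi.single j 1) = fun i => θ i j / 2 := by
  funext i
  rw [halfShift, Finset.sum_eq_single j]
  · simp
  · intro b _ hb
    simp [Pi.single_eq_of_ne hb]
  · simp

theorem U_eq_weyl (j : Fin n) :
    (U θ j : OpL2T n) = weyl (Pi.single j 1) (halfShift θ (Pi.single j 1)) := by
  rw [weyl, expChar_single, halfShift_single, U]

/-- `T` is a phase times the Weyl operator of index `k` attached to `θ`. -/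
def IsWeyl (k : Fin n → ℤ) (T : OpL2T n) : Prop :=
  ∃ c : Circle, T = (c : ℂ) • weyl k (halfShift θ k)

variable {θ}

/-- Phases are left unspecified on purpose: only their modulus is ever used, so the cocycle attached
to `θ` need not be computed. -/
theorem IsWeyl.mul {k l : Fin n → ℤ} {T S : OpL2T n} (hT : IsWeyl θ k T) (hS : IsWeyl θ l S) :
    IsWeyl θ (k + l) (T * S) := by
  obtain ⟨c, rfl⟩ := hT
  obtain ⟨d, rfl⟩ := hS
  refine ⟨c * d * Circle.exp (2 * Real.pi * pair l (halfShift θ k)), ?_⟩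
  rw [smul_mul_smul_comm, weyl_mul, halfShift_add, smul_smul]
  simp

theorem isWeyl_one : IsWeyl θ 0 1 := ⟨1, by simp [halfShift_zero, weyl_zero]⟩

theorem IsWeyl.star {k : Fin n → ℤ} {T : OpL2T n} (hT : IsWeyl θ k T) : IsWeyl θ (-k) (star T) := by
  obtain ⟨c, rfl⟩ := hT
  refine ⟨c⁻¹ * Circle.exp (2 * Real.pi * pair k (halfShift θ k)), ?_⟩
  rw [star_smul, star_weyl, halfShift_neg, smul_smul, Circle.coe_mul, Circle.coe_inv_eq_conj]
  rfl

theorem IsWeyl.eq_smul {k : Fin n → ℤ} {T S : OpL2T n} (hT : IsWeyl θ k T) (hS : IsWeyl θ k S) :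
    ∃ c : Circle, T = (c : ℂ) • S := by
  obtain ⟨c, rfl⟩ := hT
  obtain ⟨d, rfl⟩ := hS
  refine ⟨c * d⁻¹, ?_⟩
  rw [smul_smul, ← Circle.coe_mul]
  simp

theorem IsWeyl.vac {k : Fin n → ℤ} {T : OpL2T n} (hT : IsWeyl θ k T) :
    ∃ c : Circle, T vac = (c : ℂ) • fb k := by
  obtain ⟨c, rfl⟩ := hT
  exact ⟨c, by rw [smul_apply, weyl_vac]⟩

namespace SmoothTorus

theorem toOp_injective : Function.Injective (toOp (θ := θ)) := Subtype.val_injective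
theorem toOp_star (u : SmoothTorus θ) : toOp (star u) = star (toOp u) := rfl
theorem toOp_gen (j : Fin n) : toOp (gen θ j : SmoothTorus θ) = (U θ j : OpL2T n) := rfl

theorem isWeyl_gen (j : Fin n) : IsWeyl θ (Pi.single j 1) (toOp (gen θ j : SmoothTorus θ)) :=
  ⟨1, by rw [toOp_gen, U_eq_weyl]; simp⟩

theorem isWeyl_inv {k : Fin n → ℤ} {u : unitary (SmoothTorus θ)}
    (hu : IsWeyl θ k (toOp (u : SmoothTorus θ))) :
    IsWeyl θ (-k) (toOp ((u⁻¹ : unitary (SmoothTorus θ)) : SmoothTorus θ)) := hu.star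

theorem isWeyl_zpow {k : Fin n → ℤ} {u : unitary (SmoothTorus θ)}
    (hu : IsWeyl θ k (toOp (u : SmoothTorus θ))) (m : ℤ) :
    IsWeyl θ (m • k) (toOp ((u ^ m : unitary (SmoothTorus θ)) : SmoothTorus θ)) := by
  induction m using Int.induction_on with
  | zero => rw [zero_smul, zpow_zero]; exact isWeyl_one
  | succ i ih => rw [zpow_add_one, add_smul, one_smul]; exact ih.mul hu
  | pred i ih => rw [zpow_sub_one, sub_smul, one_smul, sub_eq_add_neg]; exact ih.mul (isWeyl_inv hu)

theorem isWeyl_monomial (k : Fin n → ℤ) : IsWeyl θ k (toOp (monomial θ k : SmoothTorus θ)) := by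
  -- The factors of `U^k` do not commute, so the induction runs along an arbitrary ordered list of
  -- indices.
  have h : ∀ L : List (Fin n), IsWeyl θ (L.map fun j => k j • (Pi.single j 1 : Fin n → ℤ)).sum
      (toOp (((L.map fun j => gen θ j ^ k j).prod : unitary (SmoothTorus θ)) : SmoothTorus θ)) := by
    intro L
    induction L with
    | nil => exact isWeyl_one
    | cons a L ih =>
      rw [List.map_cons, List.map_cons, List.sum_cons, List.prod_cons]
      exact (isWeyl_zpow (isWeyl_gen a) _).mul ih
  have h2 := h (List.finRange n)
  rw [← List.ofFn_eq_map, ← List.ofFn_eq_map, List.sum_ofFn] at h2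
  have hk : k = ∑ i, k i • (Pi.single i 1 : Fin n → ℤ) := by
    funext i
    simp [Finset.sum_apply, Pi.single_apply]
  rw [← hk] at h2
  exact h2

theorem exists_smul_monomial {k : Fin n → ℤ} {u : SmoothTorus θ} (hu : IsWeyl θ k (toOp u)) :
    ∃ c : Circle, u = (c : ℂ) • (monomial θ k : SmoothTorus θ) := by
  obtain ⟨c, hc⟩ := hu.eq_smul (isWeyl_monomial k)
  exact ⟨c, toOp_injective (by rw [hc, map_smul])⟩

theorem monomial_star_mul (k : Fin n → ℤ) :
    star (monomial θ k : SmoothTorus θ) * (monomial θ k : SmoothTorus θ) = 1 :=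
  Unitary.star_mul_self_of_mem (monomial θ k).2

theorem monomial_mul_star (k : Fin n → ℤ) :
    (monomial θ k : SmoothTorus θ) * star (monomial θ k : SmoothTorus θ) = 1 :=
  Unitary.mul_star_self_of_mem (monomial θ k).2

theorem norm_toOp_le_one_of_isWeyl {k : Fin n → ℤ} {T : OpL2T n} (hT : IsWeyl θ k T) : ‖T‖ ≤ 1 := by
  obtain ⟨c, rfl⟩ := hT
  refine ContinuousLinearMap.opNorm_le_bound _ zero_le_one fun f => ?_
  rw [smul_apply, norm_smul, Circle.norm_coe, one_mul, one_mul]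
  exact ((weightedShiftLM _ _).norm_map f).le

theorem norm_monomial_le (k : Fin n → ℤ) : ‖toOp (monomial θ k : SmoothTorus θ)‖ ≤ 1 :=
  norm_toOp_le_one_of_isWeyl (isWeyl_monomial k)

/-- The Fourier coefficient functional on bounded operators. -/
def opCoeff (θ : Matrix (Fin n) (Fin n) ℝ) (k : Fin n → ℤ) : OpL2T n →L[ℂ] ℂ :=
  (innerSL ℂ (vac : L2T n)) ∘L
    (ContinuousLinearMap.apply ℂ (L2T n) (toOp (star (monomial θ k : SmoothTorus θ)) vac))

theorem opCoeff_apply (k : Fin n → ℤ) (T : OpL2T n) :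
    opCoeff θ k T = inner ℂ vac (T (toOp (star (monomial θ k : SmoothTorus θ)) vac)) := rfl

theorem coeff_eq_opCoeff (u : SmoothTorus θ) (k : Fin n → ℤ) : coeff u k = opCoeff θ k (toOp u) := rfl

theorem norm_vac : ‖(vac : L2T n)‖ = 1 := by
  rw [← fb_zero]; exact fb.orthonormal.1 0

theorem norm_opCoeff_le (k : Fin n → ℤ) (T : OpL2T n) : ‖opCoeff θ k T‖ ≤ ‖T‖ := by
  rw [opCoeff_apply]
  refine (norm_inner_le_norm _ _).trans ?_
  rw [norm_vac, one_mul]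
  refine (T.le_opNorm _).trans ?_
  have h1 : ‖toOp (star (monomial θ k : SmoothTorus θ)) vac‖ ≤ 1 := by
    refine (ContinuousLinearMap.le_opNorm _ _).trans ?_
    rw [norm_vac, mul_one]
    exact norm_toOp_le_one_of_isWeyl (isWeyl_monomial k).star
  exact (mul_le_mul_of_nonneg_left h1 (norm_nonneg _)).trans (mul_one _).le

theorem norm_coeff_le (u : SmoothTorus θ) (k : Fin n → ℤ) : ‖coeff u k‖ ≤ ‖toOp u‖ :=
  norm_opCoeff_le k _

theorem coeff_add (u v : SmoothTorus θ) (k : Fin n → ℤ) :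
    coeff (u + v) k = coeff u k + coeff v k := by simp [coeff_eq_opCoeff]
theorem coeff_sub (u v : SmoothTorus θ) (k : Fin n → ℤ) :
    coeff (u - v) k = coeff u k - coeff v k := by simp [coeff_eq_opCoeff]
theorem coeff_smul (c : ℂ) (u : SmoothTorus θ) (k : Fin n → ℤ) :
    coeff (c • u) k = c * coeff u k := by simp [coeff_eq_opCoeff]
theorem coeff_sum {ι : Type*} (s : Finset ι) (u : ι → SmoothTorus θ) (k : Fin n → ℤ) :
    coeff (∑ i ∈ s, u i) k = ∑ i ∈ s, coeff (u i) k := by simp [coeff_eq_opCoeff]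

theorem tau_of_isWeyl {k : Fin n → ℤ} (hk : k ≠ 0) {u : SmoothTorus θ} (hu : IsWeyl θ k (toOp u)) :
    tau u = 0 := by
  obtain ⟨c, hc⟩ := hu.vac
  change inner ℂ vac (toOp u vac) = 0
  rw [hc, inner_smul_right, ← fb_zero, fb.orthonormal.2 hk.symm, mul_zero]

theorem tau_one : tau (1 : SmoothTorus θ) = 1 := by
  change inner ℂ (vac : L2T n) ((1 : OpL2T n) vac) = 1
  simp [norm_vac]

theorem coeff_monomial (k l : Fin n → ℤ) :
    coeff (monomial θ k : SmoothTorus θ) l = if k = l then 1 else 0 := by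
  rw [coeff]
  split_ifs with h
  · rw [h, monomial_mul_star, tau_one]
  · refine tau_of_isWeyl (k := k + -l) ?_ ((isWeyl_monomial k).mul (isWeyl_monomial l).star)
    rwa [← sub_eq_add_neg, sub_ne_zero]

theorem coeff_opCoeff_monomial (k l : Fin n → ℤ) :
    opCoeff θ l (toOp (monomial θ k : SmoothTorus θ)) = if k = l then 1 else 0 := coeff_monomial k l

theorem V_eq_weyl (s : EuclideanSpace ℝ (Fin n)) :
    (V s : OpL2T n) = weyl 0 fun i => s i / (2 * Real.pi) := by
  rw [weyl, expChar_zero, V]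

theorem pair_zero_left (v : Fin n → ℝ) : pair 0 v = 0 := by simp [pair]

theorem alpha_isWeyl (s : EuclideanSpace ℝ (Fin n)) {k : Fin n → ℤ} {T : OpL2T n}
    (hT : IsWeyl θ k T) : alpha s T = Complex.exp ((pair k s : ℂ) * Complex.I) • T := by
  obtain ⟨c, rfl⟩ := hT
  have h : (V s : OpL2T n) * weyl k (halfShift θ k)
      = Complex.exp ((pair k s : ℂ) * Complex.I) • (weyl k (halfShift θ k) * (V s : OpL2T n)) := by
    rw [V_eq_weyl, weyl_mul, weyl_mul, pair_zero_left, smul_smul, zero_add, add_zero,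
      add_comm (halfShift θ k)]
    congr 1
    have : 2 * Real.pi * (pair k fun i => s i / (2 * Real.pi)) = pair k s := by
      have := Real.pi_ne_zero
      simp only [pair, Finset.mul_sum]
      refine Finset.sum_congr rfl fun i _ => ?_
      field_simp
    rw [this, Circle.coe_exp]
    simp
  rw [alpha, Unitary.conjStarAlgAut_apply, mul_smul_comm, h, smul_mul_assoc, smul_mul_assoc,
    mul_assoc, smul_comm]
  congr 2
  rw [Unitary.mul_star_self_of_mem (V s).2, mul_one]

theorem V_vac (s : EuclideanSpace ℝ (Fin n)) : (V s : OpL2T n) vac = vac := by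
  rw [V_eq_weyl, weyl_vac, fb_zero]

theorem star_V_vac (s : EuclideanSpace ℝ (Fin n)) : (star (V s : OpL2T n)) vac = vac := by
  have h := congrArg (fun T : OpL2T n => T vac) (Unitary.star_mul_self_of_mem (V s).2)
  change (star (V s : OpL2T n)) ((V s : OpL2T n) vac) = vac at h
  rwa [V_vac] at h

/-- The vacuum is fixed by `V s`, so conjugating `T (U^k)^*` does not change its vacuum expectation;
the phase comes from moving `α_s` past `(U^k)^*`. -/
theorem opCoeff_alpha (s : EuclideanSpace ℝ (Fin n)) (k : Fin n → ℤ) (T : OpL2T n) :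
    opCoeff θ k (alpha s T) = Complex.exp ((pair k s : ℂ) * Complex.I) * opCoeff θ k T := by
  set W := toOp (star (monomial θ k : SmoothTorus θ)) with hW
  have hWW : IsWeyl θ (-k) W := (isWeyl_monomial k).star
  have h1 : alpha s T * W = Complex.exp ((pair k s : ℂ) * Complex.I) • alpha s (T * W) := by
    rw [map_mul, alpha_isWeyl s hWW, mul_smul_comm, smul_smul, ← Complex.exp_add]
    have : (pair k s : ℂ) * Complex.I + (pair (-k) s : ℂ) * Complex.I = 0 := by
      simp [pair, Finset.sum_neg_distrib]
    rw [this]; simp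
  have h2 : opCoeff θ k (alpha s T) = inner ℂ vac ((alpha s T * W) vac) := rfl
  have h3 : opCoeff θ k T = inner ℂ vac ((T * W) vac) := rfl
  rw [h2, h1, h3, smul_apply, inner_smul_right, alpha, Unitary.conjStarAlgAut_apply]
  congr 1
  change inner ℂ vac ((V s : OpL2T n) ((T * W) ((star (V s : OpL2T n)) vac))) = _
  rw [star_V_vac, ← ContinuousLinearMap.adjoint_inner_left]
  change inner ℂ ((star (V s : OpL2T n)) vac) _ = _
  rw [star_V_vac]

theorem hasFDerivAt_exp_pair (k : Fin n → ℤ) (c : ℂ) (j : Fin n) :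
    HasLineDerivAt ℝ (fun s : EuclideanSpace ℝ (Fin n) =>
      Complex.exp ((pair k s : ℂ) * Complex.I) * c) (k j * Complex.I * c) 0
      (EuclideanSpace.single j 1) := by
  rw [HasLineDerivAt]
  have h (t : ℝ) : pair k ((0 : EuclideanSpace ℝ (Fin n)) + t • EuclideanSpace.single j (1 : ℝ))
      = t * k j := by
    simp [pair, Pi.single_apply, mul_comm]
  have h' : (fun t : ℝ => Complex.exp ((pair k ((0 : EuclideanSpace ℝ (Fin n))
      + t • EuclideanSpace.single j (1 : ℝ)) : ℂ) * Complex.I) * c)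
      = fun t : ℝ => Complex.exp (((t * k j : ℝ) : ℂ) * Complex.I) * c := funext fun t => by rw [h]
  refine HasDerivAt.congr_deriv (f' := Complex.exp (((0 * k j : ℝ) : ℂ) * Complex.I)
    * (k j * Complex.I) * c) ?_ (by simp)
  have h1 : HasDerivAt (fun t : ℝ => ((t * k j : ℝ) : ℂ) * Complex.I) (k j * Complex.I) 0 := by
    have := (((hasDerivAt_id (0 : ℝ)).mul_const (k j : ℝ)).ofReal_comp).mul_const Complex.I
    simpa using this
  have h2 := (h1.cexp).mul_const c
  rw [← h'] at h2
  exact h2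

/-- The derivative of `opCoeff_alpha` at `s = 0`. Through it the seminorms of `𝒜_θ` become
polynomial weights on `ℤⁿ`. -/
theorem coeff_delta (j : Fin n) (u : SmoothTorus θ) (k : Fin n → ℤ) :
    coeff (delta j u) k = k j * coeff u k := by
  have h1 := (((opCoeff θ k).restrictScalars ℝ).hasFDerivAt.comp (0 : EuclideanSpace ℝ (Fin n))
    (hasFDerivAt_alpha u 0)).hasLineDerivAt (EuclideanSpace.single j 1)
  have h2 : HasLineDerivAt ℝ (fun s : EuclideanSpace ℝ (Fin n) => opCoeff θ k (alpha s (toOp u)))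
      (k j * Complex.I * opCoeff θ k (toOp u)) 0 (EuclideanSpace.single j 1) := by
    simp only [opCoeff_alpha]
    exact hasFDerivAt_exp_pair k _ j
  have h3 : opCoeff θ k (fderiv ℝ (fun t => alpha t (toOp u)) 0 (EuclideanSpace.single j 1))
      = k j * Complex.I * opCoeff θ k (toOp u) := h1.lineDeriv.symm.trans h2.lineDeriv
  have h4 : coeff (delta j u) k = (1 / Complex.I) *
      opCoeff θ k (fderiv ℝ (fun t => alpha t (toOp u)) 0 (EuclideanSpace.single j 1)) := by
    rw [coeff_eq_opCoeff, ← smul_eq_mul, ← map_smul]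
    rfl
  rw [h4, h3, coeff_eq_opCoeff]
  have := Complex.I_ne_zero
  field_simp

/-- Reversing the sign of the shift turns left multiplication by `U^k` into right multiplication, up
to a phase. On a generator the two exchange phases agree because `θ` is antisymmetric; the adjoint
relation and closedness do the rest. -/
theorem commute_weyl (hθ : θ.transpose = -θ) (k : Fin n → ℤ) {T : OpL2T n} (hT : T ∈ ncTorus θ) :
    T * weyl k (-halfShift θ k) = weyl k (-halfShift θ k) * T := by
  set W := weyl k (-halfShift θ k) with hW
  have hcl : IsClosed {T : OpL2T n | T * W = W * T} :=
    isClosed_eq (by fun_prop) (by fun_prop)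
  refine closure_minimal (fun T hT => ?_) hcl hT
  have hle : StarAlgebra.adjoin ℂ (Set.range fun j => (U θ j : OpL2T n))
      ≤ StarSubalgebra.centralizer ℂ {W} := by
    rw [StarAlgebra.adjoin_le_iff]
    rintro _ ⟨j, rfl⟩
    have hc : W * (U θ j : OpL2T n) = (U θ j : OpL2T n) * W := by
      rw [U_eq_weyl, hW, weyl_mul, weyl_mul, add_comm k, add_comm (-halfShift θ k)]
      congr 4
      simp only [halfShift_single]
      have hs (l : Fin n) : θ l j = -θ j l := by
        have := congrFun (congrFun hθ j) l
        simpa using this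
      simp only [pair, Pi.neg_apply]
      rw [Finset.sum_eq_single j]
      · simp only [halfShift, Pi.single_eq_same, hs, Int.cast_one, one_mul, Finset.sum_div]
        rw [← Finset.sum_neg_distrib]
        exact Finset.sum_congr rfl fun i _ => by ring
      · intro i _ hi
        simp [Pi.single_eq_of_ne hi]
      · simp
    have hWW : star W * W = 1 := star_weyl_mul _ _
    have hWW' : W * star W = 1 := weyl_mul_star _ _
    change _ ∈ StarSubalgebra.centralizer ℂ {W}
    rw [StarSubalgebra.mem_centralizer_iff]
    rintro g rfl
    refine ⟨hc, ?_⟩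
    calc star W * (U θ j : OpL2T n) = star W * ((U θ j : OpL2T n) * W) * star W := by
          rw [mul_assoc, mul_assoc, hWW', mul_one]
      _ = (U θ j : OpL2T n) * star W := by
          rw [← hc, ← mul_assoc, hWW, one_mul]
  have := hle hT
  rw [StarSubalgebra.mem_centralizer_iff] at this
  exact (this W rfl).1.symm

/-- The vacuum is cyclic for the commutant, hence separating for `A_θ`. Commuting `T` with the
operators of `commute_weyl` first identifies its coefficients with those of `T vac`, and then
carries `T vac = 0` to every basis vector. -/
theorem toOp_eq_zero_of_opCoeff (hθ : θ.transpose = -θ) {T : OpL2T n} (hT : T ∈ ncTorus θ)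
    (h : ∀ k, opCoeff θ k T = 0) : T = 0 := by
  have h1 : T vac = 0 := by
    refine fb.repr.injective ?_
    rw [map_zero]
    ext k
    rw [HilbertBasis.repr_apply_apply]
    obtain ⟨c, hc⟩ := (isWeyl_monomial (θ := θ) k).star.vac
    have h2 := h k
    rw [opCoeff_apply, toOp_star, hc, map_smul, inner_smul_right] at h2
    have h3 : inner ℂ vac (T (fb (-k))) = 0 := by
      rcases mul_eq_zero.1 h2 with h | h
      · exact absurd h (Circle.coe_ne_zero c)
      · exact h
    rw [← weyl_vac (-k) (-halfShift θ (-k))] at h3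
    have h4 := congrArg (fun S : OpL2T n => S vac) (commute_weyl hθ (-k) hT)
    simp only [mul_apply_eq_comp] at h4
    rw [h4, ← ContinuousLinearMap.adjoint_inner_left] at h3
    change inner ℂ ((star (weyl (-k) (-halfShift θ (-k)))) vac) _ = 0 at h3
    rw [star_weyl, smul_apply, weyl_vac, inner_smul_left, neg_neg] at h3
    rcases mul_eq_zero.1 h3 with h | h
    · rw [map_eq_zero] at h
      exact absurd h (Circle.coe_ne_zero _)
    · exact h
  have h2 (k : Fin n → ℤ) : T (fb k) = 0 := by
    have h4 := congrArg (fun S : OpL2T n => S vac) (commute_weyl hθ k hT)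
    simp only [mul_apply_eq_comp] at h4
    rw [← weyl_vac k (-halfShift θ k), h4, h1, map_zero]
  refine ContinuousLinearMap.ext_on (s := Set.range (fb : (Fin n → ℤ) → L2T n)) ?_ ?_
  · have := fb (n := n).dense_span
    rw [Submodule.dense_iff_topologicalClosure_eq_top]
    exact this
  · rintro _ ⟨k, rfl⟩
    rw [h2]; rfl

/-- From here on identities in `𝒜_θ`, and between operators on it, are checked coefficient by
coefficient. -/
theorem coeff_injective (hθ : θ.transpose = -θ) {u v : SmoothTorus θ}
    (h : ∀ k, coeff u k = coeff v k) : u = v := by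
  rw [← sub_eq_zero]
  refine toOp_injective ?_
  rw [map_zero]
  refine toOp_eq_zero_of_opCoeff hθ (u - v).2.1 fun k => ?_
  rw [← coeff_eq_opCoeff, coeff_sub, h, sub_self]

end SmoothTorus
end NCTorus
end

/-! ### `𝒜_θ` as the space of rapidly decaying Fourier coefficients -/

noncomputable section
namespace NCTorus
open MeasureTheory Topology Filter
open scoped ContDiff ENNReal
variable {n : ℕ}

/-- The weight `1 + |k|²` on `ℤⁿ`. -/
def wt (k : Fin n → ℤ) : ℝ := 1 + ∑ j, (k j : ℝ) ^ 2

theorem one_le_wt (k : Fin n → ℤ) : 1 ≤ wt k :=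
  le_add_of_nonneg_right (Finset.sum_nonneg fun _ _ => sq_nonneg _)

theorem wt_pos (k : Fin n → ℤ) : 0 < wt k := zero_lt_one.trans_le (one_le_wt k)

theorem abs_le_wt (k : Fin n → ℤ) (j : Fin n) : |(k j : ℝ)| ≤ wt k := by
  have h1 : (k j : ℝ) ^ 2 ≤ ∑ j, (k j : ℝ) ^ 2 :=
    Finset.single_le_sum (f := fun j => (k j : ℝ) ^ 2) (fun j _ => sq_nonneg _) (Finset.mem_univ j)
  have h2 : |(k j : ℝ)| ≤ 1 + (k j : ℝ) ^ 2 := by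
    rw [← sq_abs]; nlinarith [sq_nonneg (|(k j : ℝ)| - 1)]
  rw [wt]; linarith

theorem intEquivNat_bounds (z : ℤ) :
    Equiv.intEquivNat z ≤ 2 * z.natAbs ∧ z.natAbs ≤ Equiv.intEquivNat z := by
  cases z with
  | ofNat a =>
    change Nat.bit false a ≤ 2 * a ∧ a ≤ Nat.bit false a
    simp only [Nat.bit_val, Bool.toNat_false]
    omega
  | negSucc a =>
    change Nat.bit true a ≤ 2 * (a + 1) ∧ a + 1 ≤ Nat.bit true a
    simp only [Nat.bit_val, Bool.toNat_true]
    omega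

/-- Induction on the dimension with the Cantor-type pairing `Nat.pair`, which is bounded above by a
square and below by each argument. The first bound squares at every step, the second stays linear.
-/
theorem exists_equiv_nat_natAbs (m : ℕ) : ∃ (e : (Fin (m + 1) → ℤ) ≃ ℕ) (p q : ℕ), ∀ k,
    e k + 1 ≤ (2 + ∑ j, (k j).natAbs) ^ p ∧ ∑ j, (k j).natAbs ≤ q * (e k + 1) := by
  induction m with
  | zero =>
    refine ⟨(Equiv.funUnique (Fin 1) ℤ).trans Equiv.intEquivNat, 2, 1, fun k => ?_⟩
    have h := intEquivNat_bounds (k 0)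
    have h3 : ((Equiv.funUnique (Fin 1) ℤ).trans Equiv.intEquivNat) k = Equiv.intEquivNat (k 0) := rfl
    rw [h3, Fin.sum_univ_one]
    constructor
    · nlinarith
    · omega
  | succ m ih =>
    obtain ⟨e, p, q, he⟩ := ih
    refine ⟨(Fin.consEquiv fun _ => ℤ).symm.trans
      ((Equiv.intEquivNat.prodCongr e).trans Nat.pairEquiv), 2 * (p + 2), q + 2, fun k => ?_⟩
    set a := Equiv.intEquivNat (k 0) with ha
    set b := e (Fin.tail k) with hb
    have h3 : ((Fin.consEquiv fun _ => ℤ).symm.trans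
      ((Equiv.intEquivNat.prodCongr e).trans Nat.pairEquiv)) k = Nat.pair a b := rfl
    have h := intEquivNat_bounds (k 0)
    have h' := he (Fin.tail k)
    rw [← ha] at h
    rw [← hb] at h'
    rw [h3, Fin.sum_univ_succ]
    have ht : ∑ j : Fin (m + 1), (k j.succ).natAbs = ∑ j, (Fin.tail k j).natAbs := rfl
    rw [ht]
    set S := ∑ j, (Fin.tail k j).natAbs
    set z := (k 0).natAbs
    constructor
    · have h4 := Nat.pair_lt_max_add_one_sq a b
      have h5 : max a b + 1 ≤ (2 + (z + S)) ^ (p + 2) := by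
        have h6 : 2 * z + 1 ≤ (2 + (z + S)) ^ 2 := by nlinarith
        have h7 : (2 + S) ^ p ≤ (2 + (z + S)) ^ p := Nat.pow_le_pow_left (by omega) p
        have h8 : (2 + (z + S)) ^ p ≤ (2 + (z + S)) ^ (p + 2) :=
          Nat.pow_le_pow_right (by omega) (by omega)
        have h9 : (2 + (z + S)) ^ 2 ≤ (2 + (z + S)) ^ (p + 2) :=
          Nat.pow_le_pow_right (by omega) (by omega)
        omega
      calc Nat.pair a b + 1 ≤ (max a b + 1) ^ 2 := h4
        _ ≤ ((2 + (z + S)) ^ (p + 2)) ^ 2 := Nat.pow_le_pow_left h5 2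
        _ = _ := by rw [← pow_mul, mul_comm]
    · have h4 := Nat.left_le_pair a b
      have h5 := Nat.right_le_pair a b
      have h6 : q * (b + 1) ≤ q * (Nat.pair a b + 1) := Nat.mul_le_mul_left _ (by omega)
      have h7 : (q + 2) * (Nat.pair a b + 1) = q * (Nat.pair a b + 1) + 2 * (Nat.pair a b + 1) := by
        ring
      omega

/-- Polynomial comparison in both directions is all that is needed to carry rapid decay between `ℕ`
and `ℤⁿ`, so no ordering by norm is required. -/
theorem exists_equiv_nat (hn : 0 < n) : ∃ (e : ℕ ≃ (Fin n → ℤ)) (p : ℕ) (C : ℝ), 0 < C ∧ ∀ i : ℕ,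
    (i + 1 : ℝ) ≤ C * wt (e i) ^ p ∧ wt (e i) ≤ C * (i + 1 : ℝ) ^ p := by
  obtain ⟨m, rfl⟩ : ∃ m, n = m + 1 := ⟨n - 1, by omega⟩
  obtain ⟨e, p, q, he⟩ := exists_equiv_nat_natAbs m
  refine ⟨e.symm, p + 2, 2 ^ p + (q + 1) ^ 2, by positivity, fun i => ?_⟩
  obtain ⟨h1, h2⟩ := he (e.symm i)
  rw [Equiv.apply_symm_apply] at h1 h2
  set k := e.symm i
  set S := ∑ j, (k j).natAbs with hS
  have hS1 : (S : ℝ) = ∑ j, |(k j : ℝ)| := by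
    rw [hS, Nat.cast_sum]
    exact Finset.sum_congr rfl fun j _ => by rw [Nat.cast_natAbs, Int.cast_abs]
  have hw1 : (S : ℝ) + 1 ≤ wt k := by
    rw [hS, Nat.cast_sum, add_comm, wt]
    gcongr with j
    rw [Nat.cast_natAbs, ← Int.cast_pow, Int.cast_le]
    exact (Int.le_self_sq |k j|).trans (sq_abs (k j)).le
  have hw2 : wt k ≤ 1 + (S : ℝ) ^ 2 := by
    rw [wt, hS1]
    gcongr
    simp only [← sq_abs (k _ : ℝ)]
    exact Finset.sum_sq_le_sq_sum_of_nonneg fun j _ => abs_nonneg _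
  have h1' : (i + 1 : ℝ) ≤ (2 + S) ^ p := by exact_mod_cast h1
  have h2' : (S : ℝ) ≤ q * (i + 1) := by exact_mod_cast h2
  have hw := one_le_wt k
  constructor
  · calc (i + 1 : ℝ) ≤ (2 + S) ^ p := h1'
      _ ≤ (2 * wt k) ^ p := by gcongr; linarith
      _ = 2 ^ p * wt k ^ p := mul_pow _ _ _
      _ ≤ (2 ^ p + (q + 1) ^ 2) * wt k ^ (p + 2) := by
        gcongr
        · exact le_add_of_nonneg_right (by positivity)
        · omega
  · have hi : (1 : ℝ) ≤ i + 1 := by simp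
    calc wt k ≤ 1 + (S : ℝ) ^ 2 := hw2
      _ ≤ 1 + (q * (i + 1)) ^ 2 := by gcongr
      _ ≤ (q + 1) ^ 2 * (i + 1) ^ 2 := by
        nlinarith [mul_nonneg (Nat.cast_nonneg (α := ℝ) q) (sq_nonneg (i + 1 : ℝ)),
          one_le_pow₀ hi (n := 2)]
      _ ≤ (2 ^ p + (q + 1) ^ 2) * (i + 1) ^ (p + 2) := by
        gcongr
        · exact le_add_of_nonneg_left (by positivity)
        · omega

theorem exists_summable_wt (n : ℕ) : ∃ s : ℕ, Summable fun k : Fin n → ℤ => (wt k ^ s)⁻¹ := by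
  rcases Nat.eq_zero_or_pos n with rfl | hn
  · exact ⟨0, Summable.of_finite⟩
  obtain ⟨e, p, C, hC, he⟩ := exists_equiv_nat hn
  -- Since `i + 1 ≤ C * wt ^ p`, twice the exponent `p` dominates the summable `(i + 1)⁻²`.
  refine ⟨p * 2, ?_⟩
  rw [← e.summable_iff]
  have h1 : Summable fun i : ℕ => C ^ 2 * (1 / ((i + 1 : ℕ) : ℝ) ^ 2) :=
    (((summable_nat_add_iff 1).2 (Real.summable_one_div_nat_pow.2 one_lt_two))).mul_left _
  refine h1.of_nonneg_of_le (fun i => inv_nonneg.2 (pow_nonneg (wt_pos _).le _)) fun i => ?_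
  have h2 := (he i).1
  have h3 := wt_pos (e i)
  rw [Function.comp, inv_le_iff_one_le_mul₀ (by positivity), pow_mul]
  have h4 : (i + 1 : ℝ) ^ 2 ≤ (C * wt (e i) ^ p) ^ 2 := by gcongr
  push_cast
  rw [mul_one_div, div_mul_eq_mul_div, one_le_div (by positivity)]
  linarith [mul_pow C (wt (e i) ^ p) 2]

/-- Rapid decay of a function on `ℤⁿ`. -/
def RapidDecay (a : (Fin n → ℤ) → ℂ) : Prop := ∀ M : ℕ, ∃ C : ℝ, ∀ k, wt k ^ M * ‖a k‖ ≤ C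

theorem summable_wt_mul {a : (Fin n → ℤ) → ℝ} (h0 : ∀ k, 0 ≤ a k)
    (ha : ∀ M : ℕ, ∃ C : ℝ, ∀ k, wt k ^ M * a k ≤ C) (M : ℕ) :
    Summable fun k => wt k ^ M * a k := by
  obtain ⟨s, hs⟩ := exists_summable_wt n
  obtain ⟨C, hC⟩ := ha (M + s)
  refine (hs.mul_left C).of_nonneg_of_le (fun k => mul_nonneg (pow_nonneg (wt_pos k).le _) (h0 k))
    fun k => ?_
  have h := hC k
  have hp : 0 < wt k ^ s := pow_pos (wt_pos k) s
  rw [← div_eq_mul_inv, le_div_iff₀ hp]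
  calc _ = wt k ^ (M + s) * a k := by ring
    _ ≤ C := h

namespace SmoothTorus

variable {θ : Matrix (Fin n) (Fin n) ℝ}

/-- The linear form `s ↦ k · s`. -/
def pairL (k : Fin n → ℤ) : EuclideanSpace ℝ (Fin n) →L[ℝ] ℝ :=
  ∑ j, (k j : ℝ) • EuclideanSpace.proj j

theorem pairL_apply (k : Fin n → ℤ) (s : EuclideanSpace ℝ (Fin n)) : pairL k s = pair k s := by
  simp [pairL, pair]

theorem norm_pairL_le (k : Fin n → ℤ) : ‖pairL k‖ ≤ n * wt k := by
  refine (norm_sum_le _ _).trans ?_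
  have : ∀ j ∈ Finset.univ, ‖(k j : ℝ) • (EuclideanSpace.proj j : EuclideanSpace ℝ (Fin n) →L[ℝ] ℝ)‖
      ≤ wt k := fun j _ => by
    rw [norm_smul]
    have h1 : ‖(EuclideanSpace.proj j : EuclideanSpace ℝ (Fin n) →L[ℝ] ℝ)‖ ≤ 1 :=
      ContinuousLinearMap.opNorm_le_bound _ zero_le_one fun x => by
        rw [one_mul]; exact PiLp.norm_apply_le x j
    calc _ ≤ ‖(k j : ℝ)‖ * 1 := by gcongr
      _ ≤ wt k := by rw [mul_one]; exact abs_le_wt k j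
  refine (Finset.sum_le_card_nsmul _ _ _ this).trans ?_
  simp

theorem iteratedDeriv_expI_smul {F : Type*} [NormedAddCommGroup F] [NormedSpace ℂ F] (x : F) (m : ℕ) :
    iteratedDeriv m (fun t : ℝ => Complex.exp ((t : ℂ) * Complex.I) • x)
      = fun t : ℝ => (Complex.I ^ m * Complex.exp ((t : ℂ) * Complex.I)) • x := by
  induction m with
  | zero => simp
  | succ m ih =>
    rw [iteratedDeriv_succ, ih]
    funext t
    have h1 : HasDerivAt (fun t : ℝ => (t : ℂ) * Complex.I) Complex.I t := by
      simpa using ((hasDerivAt_id t).ofReal_comp).mul_const Complex.I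
    rw [((h1.cexp.const_mul (Complex.I ^ m)).smul_const x).deriv]
    congr 1
    ring

/-- The map is a one-variable exponential composed with the linear form `k · s`, so each derivative
costs one factor `‖pairL k‖`. -/
theorem norm_iteratedFDeriv_exp_smul {F : Type*} [NormedAddCommGroup F] [NormedSpace ℂ F]
    (k : Fin n → ℤ) (x : F) (m : ℕ) (s : EuclideanSpace ℝ (Fin n)) :
    ‖iteratedFDeriv ℝ m (fun s : EuclideanSpace ℝ (Fin n) =>
      Complex.exp ((pair k s : ℂ) * Complex.I) • x) s‖ ≤ (n * wt k) ^ m * ‖x‖ := by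
  set f : ℝ → F := fun t => Complex.exp ((t : ℂ) * Complex.I) • x with hf
  have hfc : ContDiff ℝ ∞ f :=
    ((Complex.ofRealCLM.contDiff.mul contDiff_const).cexp).smul contDiff_const
  have h1 : (fun s : EuclideanSpace ℝ (Fin n) => Complex.exp ((pair k s : ℂ) * Complex.I) • x)
      = f ∘ pairL k := funext fun s => by simp [hf, pairL_apply]
  rw [h1, (pairL k).iteratedFDeriv_comp_right hfc s (i := m) (by exact_mod_cast le_top)]
  refine (ContinuousMultilinearMap.norm_compContinuousLinearMap_le _ _).trans ?_
  rw [norm_iteratedFDeriv_eq_norm_iteratedDeriv, hf, iteratedDeriv_expI_smul, norm_smul, norm_mul,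
    norm_pow, Complex.norm_I, one_pow, one_mul, Complex.norm_exp_ofReal_mul_I, one_mul,
    Finset.prod_const, Finset.card_univ, Fintype.card_fin, mul_comm]
  gcongr
  exact norm_pairL_le k

theorem norm_smul_monomial_le (c : ℂ) (k : Fin n → ℤ) :
    ‖c • toOp (monomial θ k : SmoothTorus θ)‖ ≤ ‖c‖ := by
  rw [norm_smul]
  exact mul_le_of_le_one_right (norm_nonneg _) (norm_monomial_le k)

/-- The series stays in `A_θ` because `A_θ` is closed. Under `α_s` its terms acquire phases
`e^{is·k}`, and rapid decay beats the polynomial growth of their derivatives, so termwise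
differentiation is allowed. -/
theorem exists_of_rapidDecay {a : (Fin n → ℤ) → ℂ} (ha : RapidDecay a) :
    ∃ u : SmoothTorus θ, toOp u = ∑' k, a k • toOp (monomial θ k : SmoothTorus θ) := by
  have hs0 : Summable fun k => ‖a k‖ := by
    simpa using summable_wt_mul (fun k => norm_nonneg (a k)) ha 0
  have hs : Summable fun k => a k • toOp (monomial θ k : SmoothTorus θ) :=
    Summable.of_norm_bounded hs0 fun k => norm_smul_monomial_le _ k
  refine ⟨(⟨_, ?_, ?_⟩ : smoothSubalgebra θ), rfl⟩
  · refine (isClosed_ncTorus θ).mem_of_tendsto hs.hasSum (Eventually.of_forall fun s => ?_)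
    exact sum_mem fun k _ => (ncTorus θ).smul_mem (monomial θ k : SmoothTorus θ).2.1 _
  · have h1 : (fun s : EuclideanSpace ℝ (Fin n) =>
        alpha s (∑' k, a k • toOp (monomial θ k : SmoothTorus θ)))
        = fun s : EuclideanSpace ℝ (Fin n) => ∑' k, Complex.exp ((pair k s : ℂ) * Complex.I) •
          (a k • toOp (monomial θ k : SmoothTorus θ)) := by
      funext s
      change alphaL s _ = _
      rw [(alphaL s).map_tsum hs]
      refine tsum_congr fun k => ?_
      change alpha s _ = _
      rw [map_smul, alpha_isWeyl s (isWeyl_monomial k), smul_comm]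
    change ContDiff ℝ ∞ (fun s : EuclideanSpace ℝ (Fin n) =>
        alpha s (∑' k, a k • toOp (monomial θ k : SmoothTorus θ)))
    rw [h1]
    refine contDiff_tsum (E := EuclideanSpace ℝ (Fin n)) (v := fun m k => (n * wt k) ^ m * ‖a k‖) (N := ⊤) (fun k => ?_)
      (fun m _ => ?_) (fun m k s _ => ?_)
    · refine ContDiff.smul (ContDiff.cexp (ContDiff.mul ?_ contDiff_const)) contDiff_const
      simp only [← pairL_apply]
      exact Complex.ofRealCLM.contDiff.comp (pairL k).contDiff
    · have := (summable_wt_mul (fun k => norm_nonneg (a k)) ha m).mul_left ((n : ℝ) ^ m)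
      refine this.congr fun k => ?_
      rw [mul_pow, mul_assoc]
    · refine (norm_iteratedFDeriv_exp_smul k _ m s).trans ?_
      have := wt_pos k
      gcongr
      exact norm_smul_monomial_le _ k

theorem exists_coeff_eq {a : (Fin n → ℤ) → ℂ} (ha : RapidDecay a) :
    ∃ u : SmoothTorus θ, ∀ k, coeff u k = a k := by
  obtain ⟨u, hu⟩ := exists_of_rapidDecay (θ := θ) ha
  refine ⟨u, fun k => ?_⟩
  have hs0 : Summable fun k => ‖a k‖ := by
    simpa using summable_wt_mul (fun k => norm_nonneg (a k)) ha 0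
  have hs : Summable fun k => a k • toOp (monomial θ k : SmoothTorus θ) :=
    Summable.of_norm_bounded hs0 fun k => norm_smul_monomial_le _ k
  rw [coeff_eq_opCoeff, hu, (opCoeff θ k).map_tsum hs, tsum_eq_single k]
  · rw [map_smul, coeff_opCoeff_monomial, if_pos rfl, smul_eq_mul, mul_one]
  · intro l hl
    rw [map_smul, coeff_opCoeff_monomial, if_neg hl, smul_zero]

/-- The element of `𝒜_θ` with prescribed Fourier coefficients, zero if they do not decay rapidly. -/
def ofCoeff (θ : Matrix (Fin n) (Fin n) ℝ) (a : (Fin n → ℤ) → ℂ) : SmoothTorus θ :=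
  open Classical in if h : RapidDecay a then (exists_coeff_eq (θ := θ) h).choose else 0

theorem coeff_ofCoeff {a : (Fin n → ℤ) → ℂ} (ha : RapidDecay a) (k : Fin n → ℤ) :
    coeff (ofCoeff θ a) k = a k := by
  rw [ofCoeff, dif_pos ha]
  exact (exists_coeff_eq (θ := θ) ha).choose_spec k

/-- The operator `1 + ∑ δ_j²`. -/
def lam (θ : Matrix (Fin n) (Fin n) ℝ) : Module.End ℂ (SmoothTorus θ) := 1 + ∑ j, delta j * delta j

theorem coeff_lam (u : SmoothTorus θ) (k : Fin n → ℤ) : coeff (lam θ u) k = wt k * coeff u k := by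
  have : lam θ u = u + ∑ j, delta j (delta j u) := by simp [lam]
  rw [this, coeff_add, coeff_sum]
  simp only [coeff_delta]
  rw [wt]
  push_cast
  rw [add_mul, one_mul, Finset.sum_mul]
  congr 1
  exact Finset.sum_congr rfl fun j _ => by ring

theorem coeff_lam_pow (M : ℕ) (u : SmoothTorus θ) (k : Fin n → ℤ) :
    coeff ((lam θ ^ M) u) k = wt k ^ M * coeff u k := by
  induction M with
  | zero => simp
  | succ M ih => rw [pow_succ', Module.End.mul_apply, coeff_lam, ih]; ring

/-- The seminorms `u ↦ ‖(1 + ∑ δ_j²)^M u‖`. -/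
def lamSeminorm (θ : Matrix (Fin n) (Fin n) ℝ) : SeminormFamily ℂ (SmoothTorus θ) ℕ :=
  fun M => (normSeminorm ℂ (OpL2T n)).comp (toOp ∘ₗ (lam θ ^ M))

theorem lamSeminorm_apply (M : ℕ) (u : SmoothTorus θ) :
    lamSeminorm θ M u = ‖toOp ((lam θ ^ M) u)‖ := rfl

/-- `lam θ ^ M` acts on coefficients as `wt ^ M`, and a coefficient never exceeds the operator norm.
-/
theorem wt_mul_coeff_le (M : ℕ) (u : SmoothTorus θ) (k : Fin n → ℤ) :
    wt k ^ M * ‖coeff u k‖ ≤ lamSeminorm θ M u := by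
  have h := norm_coeff_le ((lam θ ^ M) u) k
  rw [coeff_lam_pow, norm_mul, norm_pow, Complex.norm_real, Real.norm_of_nonneg (wt_pos k).le] at h
  exact h

theorem rapidDecay_coeff (u : SmoothTorus θ) : RapidDecay (coeff u) :=
  fun M => ⟨_, wt_mul_coeff_le M u⟩

/-- The Fourier series converges in operator norm by rapid decay, and its sum is `u` since the
coefficients agree. -/
theorem norm_toOp_le_tsum (hθ : θ.transpose = -θ) (u : SmoothTorus θ) :
    ‖toOp u‖ ≤ ∑' k, ‖coeff u k‖ := by
  have ha := rapidDecay_coeff u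
  have hs0 : Summable fun k => ‖coeff u k‖ := by
    simpa using summable_wt_mul (fun k => norm_nonneg (coeff u k)) ha 0
  obtain ⟨v, hv⟩ := exists_of_rapidDecay (θ := θ) ha
  have hs : Summable fun k => coeff u k • toOp (monomial θ k : SmoothTorus θ) :=
    Summable.of_norm_bounded hs0 fun k => norm_smul_monomial_le _ k
  have huv : u = v := coeff_injective hθ fun k => by
    rw [coeff_eq_opCoeff v, hv, (opCoeff θ k).map_tsum hs, tsum_eq_single k]
    · rw [map_smul, coeff_opCoeff_monomial, if_pos rfl, smul_eq_mul, mul_one]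
    · intro l hl
      rw [map_smul, coeff_opCoeff_monomial, if_neg hl, smul_zero]
  conv_lhs => rw [huv, hv]
  exact tsum_of_norm_bounded hs0.hasSum fun k => norm_smul_monomial_le _ k

/-- The converse of `wt_mul_coeff_le`, with a loss of the summability exponent `s`. The bound `B` is
left free so that the estimate applies to any control of the coefficients, not only to a seminorm of
`u`. -/
theorem exists_norm_toOp_le (hθ : θ.transpose = -θ) : ∃ (s : ℕ) (C : ℝ), 0 ≤ C ∧
    ∀ (u : SmoothTorus θ) (B : ℝ), (∀ k, wt k ^ s * ‖coeff u k‖ ≤ B) → ‖toOp u‖ ≤ C * B := by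
  obtain ⟨s, hs⟩ := exists_summable_wt n
  refine ⟨s, ∑' k : Fin n → ℤ, (wt k ^ s)⁻¹,
    tsum_nonneg fun k => inv_nonneg.2 (pow_nonneg (wt_pos k).le _), fun u B hB => ?_⟩
  refine (norm_toOp_le_tsum hθ u).trans ?_
  rw [← tsum_mul_right]
  have h (k : Fin n → ℤ) : ‖coeff u k‖ ≤ (wt k ^ s)⁻¹ * B := by
    rw [le_inv_mul_iff₀ (pow_pos (wt_pos k) s)]
    exact hB k
  exact Summable.tsum_le_tsum h (Summable.of_nonneg_of_le (fun _ => norm_nonneg _) h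
    (hs.mul_right B)) (hs.mul_right B)

theorem coeff_deltas (a : List (Fin n)) (u : SmoothTorus θ) (k : Fin n → ℤ) :
    coeff (deltas a u) k = (a.map fun j => (k j : ℂ)).prod * coeff u k := by
  induction a with
  | nil => simp [deltas]
  | cons j a ih =>
    have : deltas (j :: a) u = delta j (deltas a u) := by simp [deltas]
    rw [this, coeff_delta, ih, List.map_cons, List.prod_cons, mul_assoc]

theorem norm_coeff_deltas_le (a : List (Fin n)) (u : SmoothTorus θ) (k : Fin n → ℤ) :
    ‖coeff (deltas a u) k‖ ≤ wt k ^ a.length * ‖coeff u k‖ := by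
  rw [coeff_deltas, norm_mul]
  gcongr
  induction a with
  | nil => simp
  | cons j a ih =>
    rw [List.map_cons, List.prod_cons, norm_mul, List.length_cons, pow_succ']
    refine mul_le_mul ?_ ih (norm_nonneg _) (wt_pos k).le
    rw [Complex.norm_intCast]
    exact abs_le_wt k j

theorem exists_deltas_le (hθ : θ.transpose = -θ) (a : List (Fin n)) : ∃ (s : ℕ) (C : ℝ), 0 ≤ C ∧
    ∀ (u : SmoothTorus θ) (B : ℝ), (∀ k, wt k ^ s * ‖coeff u k‖ ≤ B) →
      ‖toOp (deltas a u)‖ ≤ C * B := by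
  obtain ⟨s, C, hC, h⟩ := exists_norm_toOp_le hθ
  refine ⟨s + a.length, C, hC, fun u B hB => h _ B fun k => ?_⟩
  have := wt_pos k
  calc _ ≤ wt k ^ s * (wt k ^ a.length * ‖coeff u k‖) := by
        gcongr; exact norm_coeff_deltas_le a u k
    _ = wt k ^ (s + a.length) * ‖coeff u k‖ := by ring
    _ ≤ B := hB k

theorem exists_lamSeminorm_le (hθ : θ.transpose = -θ) (M : ℕ) : ∃ (s : ℕ) (C : ℝ), 0 ≤ C ∧
    ∀ (u : SmoothTorus θ) (B : ℝ), (∀ k, wt k ^ s * ‖coeff u k‖ ≤ B) →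
      lamSeminorm θ M u ≤ C * B := by
  obtain ⟨s, C, hC, h⟩ := exists_norm_toOp_le hθ
  refine ⟨s + M, C, hC, fun u B hB => h _ B fun k => ?_⟩
  rw [coeff_lam_pow, norm_mul, norm_pow, Complex.norm_real, Real.norm_of_nonneg (wt_pos k).le]
  calc _ = wt k ^ (s + M) * ‖coeff u k‖ := by ring
    _ ≤ B := hB k

theorem continuous_delta (j : Fin n) : Continuous (delta (θ := θ) j) := by
  refine withSeminorms_seminorms.continuous_of_continuous_comp _ fun a => ?_
  have : (seminorms θ a).comp (delta j) = seminorms θ (a ++ [j]) := by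
    ext u
    simp [seminorms, deltas]
  rw [this]
  exact withSeminorms_seminorms.continuous_seminorm _

theorem continuous_lam_pow (M : ℕ) : Continuous (lam θ ^ M) := by
  have h : Continuous (lam θ) := by
    have h2 : (lam θ : SmoothTorus θ → SmoothTorus θ) = fun u => u + ∑ j, delta j (delta j u) := by
      funext u
      simp [lam]
    rw [h2]
    exact continuous_id.add (continuous_finsetSum _ fun j _ =>
      (continuous_delta j).comp (continuous_delta j))
  induction M with
  | zero => exact continuous_id
  | succ M ih => rw [pow_succ]; exact ih.comp h

theorem continuous_lamSeminorm (M : ℕ) : Continuous (lamSeminorm θ M) :=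
  continuous_norm.comp (continuous_toOp.comp (continuous_lam_pow M))

/-- Each `‖δ^α u‖` is controlled by weighted suprema of coefficients, and these by a single
`lamSeminorm`. The new family is indexed by one integer and is diagonal in the basis `U^k`. -/
theorem withSeminorms_lamSeminorm (hθ : θ.transpose = -θ) : WithSeminorms (lamSeminorm θ) := by
  refine withSeminorms_seminorms.congr (fun M => ?_) fun a => ?_
  · obtain ⟨s, C, -, h⟩ := Seminorm.bound_of_continuous withSeminorms_seminorms _
      (continuous_lamSeminorm (θ := θ) M)
    exact ⟨s, C, h⟩
  · obtain ⟨s, C, hC, h⟩ := exists_deltas_le hθ a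
    refine ⟨{s}, ⟨C, hC⟩, fun u => ?_⟩
    rw [Finset.sup_singleton]
    exact h u _ (wt_mul_coeff_le s u)

theorem lamSeminorm_mono_of_coeff (hθ : θ.transpose = -θ) (a : List (Fin n)) : ∃ (M : ℕ) (C : ℝ),
    0 ≤ C ∧ ∀ u : SmoothTorus θ, ‖toOp (deltas a u)‖ ≤ C * lamSeminorm θ M u := by
  obtain ⟨s, C, hC, h⟩ := exists_deltas_le hθ a
  exact ⟨s, C, hC, fun u => h u _ (wt_mul_coeff_le s u)⟩

instance : T2Space (SmoothTorus θ) := T2Space.of_injective_continuous toOp_injective continuous_toOp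

theorem continuous_coeff (k : Fin n → ℤ) : Continuous fun u : SmoothTorus θ => coeff u k :=
  (opCoeff θ k).continuous.comp continuous_toOp

/-- Absolute summability in every seminorm identifies the sum from its coefficients alone: those of
the remainder are tails, bounded uniformly in `k` by the tail of a higher seminorm. -/
theorem hasSum_of_coeff (hθ : θ.transpose = -θ) {ι : Type*} {x : ι → SmoothTorus θ}
    (hx : ∀ M, Summable fun i => lamSeminorm θ M (x i)) {u : SmoothTorus θ}
    (hu : ∀ k, HasSum (fun i => coeff (x i) k) (coeff u k)) : HasSum x u := by
  refine ((withSeminorms_lamSeminorm hθ).tendsto_nhds _ _).2 fun M ε hε => ?_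
  obtain ⟨s, C, hC, h⟩ := exists_lamSeminorm_le hθ M
  have hlim := tendsto_tsum_compl_atTop_zero fun i => lamSeminorm θ s (x i)
  have hev := hlim.eventually (gt_mem_nhds (show 0 < ε / (C + 1) by positivity))
  filter_upwards [hev] with F hF
  have hsF : Summable fun i : { i // i ∉ F } => lamSeminorm θ s (x i) :=
    (hx s).subtype _
  have h1 : lamSeminorm θ M (∑ i ∈ F, x i - u) ≤ C * ∑' i : { i // i ∉ F }, lamSeminorm θ s (x i) := by
    refine h _ _ fun k => ?_
    have h2 : HasSum (fun i : { i // i ∉ F } => coeff (x i) k) (coeff u k - ∑ i ∈ F, coeff (x i) k) := by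
      have := (Finset.hasSum_compl_iff (f := fun i => coeff (x i) k)
        (a := coeff u k - ∑ i ∈ F, coeff (x i) k) F).2 (by simpa using hu k)
      exact this
    have hp : 0 < wt k ^ s := pow_pos (wt_pos k) s
    rw [coeff_sub, coeff_sum, norm_sub_rev, ← h2.tsum_eq, ← le_div_iff₀' hp, ← tsum_div_const]
    refine tsum_of_norm_bounded (hsF.div_const _).hasSum fun i => ?_
    rw [le_div_iff₀' hp]
    exact wt_mul_coeff_le s _ k
  refine h1.trans_lt ?_
  calc _ ≤ (C + 1) * ∑' i : { i // i ∉ F }, lamSeminorm θ s (x i) := by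
        have : 0 ≤ ∑' i : { i // i ∉ F }, lamSeminorm θ s (x i) :=
          tsum_nonneg fun i => apply_nonneg _ _
        gcongr; linarith
    _ < (C + 1) * (ε / (C + 1)) := by gcongr
    _ = ε := by field_simp

/-- This plays the role of completeness: the limit is built from the summed coefficients, which
again decay rapidly. -/
theorem exists_hasSum (hθ : θ.transpose = -θ) {ι : Type*} {x : ι → SmoothTorus θ}
    (hx : ∀ M, Summable fun i => lamSeminorm θ M (x i)) : ∃ u, HasSum x u := by
  have hs (k : Fin n → ℤ) : Summable fun i => coeff (x i) k :=
    Summable.of_norm_bounded (hx 0) fun i => by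
      simpa using wt_mul_coeff_le 0 (x i) k
  have ha : RapidDecay fun k => ∑' i, coeff (x i) k := fun M => by
    refine ⟨∑' i, lamSeminorm θ M (x i), fun k => ?_⟩
    have hp : 0 < wt k ^ M := pow_pos (wt_pos k) M
    rw [← le_div_iff₀' hp, ← tsum_div_const]
    refine tsum_of_norm_bounded ((hx M).div_const _).hasSum fun i => ?_
    rw [le_div_iff₀' hp]
    exact wt_mul_coeff_le M _ k
  refine ⟨ofCoeff θ fun k => ∑' i, coeff (x i) k, hasSum_of_coeff hθ hx fun k => ?_⟩
  rw [coeff_ofCoeff ha]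
  exact (hs k).hasSum

theorem hasSum_coeff_of_hasSum {ι : Type*} {x : ι → SmoothTorus θ} {u : SmoothTorus θ}
    (h : HasSum x u) (k : Fin n → ℤ) : HasSum (fun i => coeff (x i) k) (coeff u k) := by
  have h2 := h.map (g := AddMonoidHom.mk' (fun u : SmoothTorus θ => coeff u k)
    fun u v => coeff_add u v k) (continuous_coeff k)
  exact h2

theorem lam_monomial (k : Fin n → ℤ) (hθ : θ.transpose = -θ) (M : ℕ) :
    (lam θ ^ M) (monomial θ k : SmoothTorus θ) = ((wt k ^ M : ℝ) : ℂ) • (monomial θ k : SmoothTorus θ) :=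
  coeff_injective hθ fun l => by
    rw [coeff_lam_pow, coeff_smul, coeff_monomial]
    split_ifs with h
    · rw [h]; push_cast; rfl
    · simp

theorem lamSeminorm_monomial_le (hθ : θ.transpose = -θ) (k : Fin n → ℤ) (M : ℕ) :
    lamSeminorm θ M (monomial θ k : SmoothTorus θ) ≤ wt k ^ M := by
  rw [lamSeminorm_apply, lam_monomial k hθ, map_smul]
  refine (norm_smul_monomial_le _ k).trans ?_
  rw [Complex.norm_real, Real.norm_of_nonneg (pow_nonneg (wt_pos k).le _)]

theorem hasSum_fourier (hθ : θ.transpose = -θ) (u : SmoothTorus θ) :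
    HasSum (fun k => coeff u k • (monomial θ k : SmoothTorus θ)) u := by
  refine hasSum_of_coeff hθ (fun M => ?_) fun k => ?_
  · refine (summable_wt_mul (fun k => norm_nonneg (coeff u k)) (rapidDecay_coeff u) M).of_nonneg_of_le
      (fun k => apply_nonneg _ _) fun k => ?_
    rw [map_smul_eq_mul, mul_comm]
    gcongr
    exact lamSeminorm_monomial_le hθ k M
  · have := hasSum_ite_eq k (coeff u k)
    refine this.congr_fun fun l => ?_
    rw [coeff_smul, coeff_monomial]
    split_ifs with h
    · rw [h, mul_one]
    · rw [mul_zero]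

theorem delta_mul (j : Fin n) (u v : SmoothTorus θ) :
    delta j (u * v) = delta j u * v + u * delta j v := by
  apply Subtype.ext
  have h0 (w : SmoothTorus θ) : alpha (0 : EuclideanSpace ℝ (Fin n)) (toOp w) = toOp w := by
    have h1 : (V (0 : EuclideanSpace ℝ (Fin n)) : OpL2T n) = 1 := by
      rw [V_eq_weyl, ← weyl_zero]
      congr 1
      funext i
      simp
    rw [alpha, Unitary.conjStarAlgAut_apply, h1]
    simp
  change (1 / Complex.I) • fderiv ℝ (fun s => alpha s (toOp u * toOp v)) 0 _
    = ((1 / Complex.I) • _) * toOp v + toOp u * ((1 / Complex.I) • _)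
  rw [smul_mul_assoc, mul_smul_comm, ← smul_add]
  congr 1
  have hl (w : SmoothTorus θ) := (hasFDerivAt_alpha w 0).hasLineDerivAt (EuclideanSpace.single j (1 : ℝ))
  have hm := (hl u).mul (hl v)
  have huv := (hl (u * v))
  simp only [toOp_mul, map_mul] at huv
  have := huv.unique hm
  simp only [zero_smul, add_zero, h0] at this
  simp only [map_mul]
  exact this

/-- Induction on the word of derivations, peeling off its last letter, which acts on the product
first. The Leibniz rule replaces `v` by `delta j v`, so the claim is proved for all `v` at once. -/
theorem continuous_mulLeft (v : SmoothTorus θ) : Continuous fun u => v * u := by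
  have h (a : List (Fin n)) : ∀ v : SmoothTorus θ, Continuous fun u => toOp (deltas a (v * u)) := by
    induction a using List.reverseRecOn with
    | nil =>
      intro v
      have := continuous_toOp (θ := θ)
      simp only [deltas, List.map_nil, List.prod_nil, Module.End.one_apply, toOp_mul]
      fun_prop
    | append_singleton a j ih =>
      intro v
      have h1 (u : SmoothTorus θ) : toOp (deltas (a ++ [j]) (v * u))
          = toOp (deltas a (delta j v * u)) + toOp (deltas a (v * delta j u)) := by
        have : deltas (a ++ [j]) (v * u) = deltas a (delta j (v * u)) := by simp [deltas]
        rw [this, delta_mul, map_add, map_add]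
      simp only [h1]
      exact (ih _).add ((ih v).comp (continuous_delta j))
  exact withSeminorms_seminorms.continuous_of_continuous_comp (LinearMap.mulLeft ℂ v) fun a =>
    continuous_norm.comp (h a v)

end SmoothTorus
end NCTorus
end

/-! ### Smoothing operators as rapidly decaying families -/

noncomputable section
namespace NCTorus
open MeasureTheory Topology Filter
open scoped ContDiff ENNReal
variable {n : ℕ} {θ : Matrix (Fin n) (Fin n) ℝ}
open SmoothTorus

/-- A family in `𝒜_θ` indexed by `ℤⁿ` that decays rapidly in every seminorm. -/
def RapidFamily (r : (Fin n → ℤ) → SmoothTorus θ) : Prop :=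
  ∀ M N : ℕ, ∃ C : ℝ, ∀ l, wt l ^ N * lamSeminorm θ M (r l) ≤ C

theorem wt_neg (k : Fin n → ℤ) : wt (-k) = wt k := by simp [wt]

theorem norm_coeff_le_lamSeminorm_zero (u : SmoothTorus θ) (k : Fin n → ℤ) :
    ‖coeff u k‖ ≤ lamSeminorm θ 0 u := by simpa using wt_mul_coeff_le 0 u k

theorem norm_tau_le (u : SmoothTorus θ) : ‖tau u‖ ≤ ‖toOp u‖ := by
  change ‖inner ℂ vac (toOp u vac)‖ ≤ _
  refine (norm_inner_le_norm _ _).trans ?_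
  rw [norm_vac, one_mul]
  refine ((toOp u).le_opNorm _).trans ?_
  rw [norm_vac, mul_one]

/-- Only the term `k = -l` of the Fourier series of `u` survives the trace. -/
theorem norm_tau_monomial_mul_le (hθ : θ.transpose = -θ) (l : Fin n → ℤ) (u : SmoothTorus θ) :
    ‖tau ((monomial θ l : SmoothTorus θ) * u)‖ ≤ ‖coeff u (-l)‖ := by
  have h1 : HasSum (fun k => toDual (monomial θ l : SmoothTorus θ)
      (coeff u k • (monomial θ k : SmoothTorus θ))) (toDual (monomial θ l : SmoothTorus θ) u) :=
    (toDual (monomial θ l : SmoothTorus θ)).hasSum (hasSum_fourier hθ u)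
  have h2 : ∀ k, k ≠ -l → toDual (monomial θ l : SmoothTorus θ)
      (coeff u k • (monomial θ k : SmoothTorus θ)) = 0 := fun k hk => by
    rw [map_smul]
    change _ • tau ((monomial θ l : SmoothTorus θ) * (monomial θ k : SmoothTorus θ)) = 0
    rw [tau_of_isWeyl (k := l + k) _ ((isWeyl_monomial l).mul (isWeyl_monomial k)), smul_zero]
    exact fun h => hk (eq_neg_of_add_eq_zero_right h)
  have h3 := h1.unique (hasSum_single (-l) h2)
  change ‖toDual (monomial θ l : SmoothTorus θ) u‖ ≤ _
  rw [h3, map_smul, norm_smul]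
  refine mul_le_of_le_one_right (norm_nonneg _) ((norm_tau_le _).trans ?_)
  exact norm_toOp_le_one_of_isWeyl ((isWeyl_monomial l).mul (isWeyl_monomial (-l)))

/-- A strong neighbourhood of zero is uniform smallness on a bounded set `B`; scaling `φ` turns
continuity at zero into an inequality. -/
theorem exists_isVonNBounded_le (S : StrongDual ℂ (SmoothTorus θ) →L[ℂ] SmoothTorus θ) (M : ℕ) :
    ∃ (B : Set (SmoothTorus θ)) (C : ℝ), Bornology.IsVonNBounded ℂ B ∧ 0 ≤ C ∧
      ∀ (φ : StrongDual ℂ (SmoothTorus θ)) (η : ℝ), 0 ≤ η → (∀ b ∈ B, ‖φ b‖ ≤ η) →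
        lamSeminorm θ M (S φ) ≤ C * η := by
  have h1 : {φ | lamSeminorm θ M (S φ) < 1} ∈ 𝓝 (0 : StrongDual ℂ (SmoothTorus θ)) := by
    have hc : Continuous fun φ => lamSeminorm θ M (S φ) :=
      (continuous_lamSeminorm M).comp S.continuous
    exact hc.continuousAt.preimage_mem_nhds (gt_mem_nhds (by simp))
  obtain ⟨⟨B, W⟩, ⟨hB, hW⟩, hBW⟩ := ContinuousLinearMap.hasBasis_nhds_zero.mem_iff.1 h1
  obtain ⟨ε, hε, hεW⟩ := Metric.mem_nhds_iff.1 hW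
  have key (φ : StrongDual ℂ (SmoothTorus θ)) (η : ℝ) (hη : 0 < η) (h : ∀ b ∈ B, ‖φ b‖ ≤ η) :
      lamSeminorm θ M (S φ) ≤ 2 / ε * η := by
    have h2 : (((ε / (2 * η) : ℝ) : ℂ) • φ) ∈ {φ | lamSeminorm θ M (S φ) < 1} := by
      refine hBW fun b hb => hεW ?_
      rw [mem_ball_zero_iff, smul_apply, norm_smul, Complex.norm_real,
        Real.norm_of_nonneg (by positivity)]
      calc _ ≤ ε / (2 * η) * η := by gcongr; exact h b hb
        _ = ε / 2 := by field_simp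
        _ < ε := by linarith
    rw [Set.mem_ofPred_eq, map_smul, map_smul_eq_mul, Complex.norm_real,
      Real.norm_of_nonneg (by positivity), div_mul_eq_mul_div, div_lt_one (by positivity)] at h2
    rw [div_mul_eq_mul_div, le_div_iff₀ hε]
    linarith
  -- The scaling needs `η > 0`; the case `η = 0` is recovered by enlarging `η` by a multiple of an
  -- arbitrary `δ`.
  refine ⟨B, 2 / ε, hB, by positivity, fun φ η hη h => ?_⟩
  refine le_of_forall_pos_le_add fun δ hδ => ?_
  refine (key φ (η + δ * ε / 2) (by positivity) fun b hb => (h b hb).trans ?_).trans (le_of_eq ?_)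
  · have : 0 ≤ δ * ε / 2 := by positivity
    linarith
  · field_simp

/-- On a bounded set Fourier coefficients decay uniformly faster than any power, so the functionals
given by `U^l` tend rapidly to zero in the strong dual. -/
theorem rapidFamily_of_smoothing (hθ : θ.transpose = -θ) {R : Module.End ℂ (SmoothTorus θ)}
    (hR : R ∈ Smoothing θ) : RapidFamily (fun l => R (monomial θ l : SmoothTorus θ)) := by
  obtain ⟨S, hS⟩ := hR
  intro M N
  obtain ⟨B, C, hB, hC, h⟩ := exists_isVonNBounded_le S M
  obtain ⟨r, hr, hBr⟩ := (withSeminorms_lamSeminorm hθ).isVonNBounded_iff_seminorm_bounded.1 hB N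
  refine ⟨C * r, fun l => ?_⟩
  have hp : 0 < wt l ^ N := pow_pos (wt_pos l) N
  have h2 := h (toDual (monomial θ l : SmoothTorus θ)) (r / wt l ^ N) (by positivity) fun b hb => by
    refine (norm_tau_monomial_mul_le hθ l b).trans ?_
    rw [le_div_iff₀' hp]
    have := wt_mul_coeff_le N b (-l)
    rw [wt_neg] at this
    exact this.trans (hBr b hb).le
  rw [hS] at h2
  calc _ ≤ wt l ^ N * (C * (r / wt l ^ N)) := by gcongr
    _ = C * r := by field_simp

/-- The embedding into the strong dual is already bounded by the operator norm, through `|τ(u b)| ≤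
‖u‖ ‖b‖`. -/
theorem continuous_of_smoothing (hθ : θ.transpose = -θ) {R : Module.End ℂ (SmoothTorus θ)}
    (hR : R ∈ Smoothing θ) : Continuous R := by
  obtain ⟨S, hS⟩ := hR
  refine (withSeminorms_lamSeminorm hθ).continuous_of_continuous_comp _ fun M => ?_
  obtain ⟨B, C, hB, hC, h⟩ := exists_isVonNBounded_le S M
  obtain ⟨r, hr, hBr⟩ := (withSeminorms_lamSeminorm hθ).isVonNBounded_iff_seminorm_bounded.1 hB 0
  have hb (u : SmoothTorus θ) : lamSeminorm θ M (R u) ≤ C * r * lamSeminorm θ 0 u := by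
    rw [← hS]
    refine (h (toDual u) (r * lamSeminorm θ 0 u) (mul_nonneg hr.le (apply_nonneg _ _)) fun b hb =>
      ?_).trans (le_of_eq (mul_assoc _ _ _).symm)
    refine (norm_tau_le _).trans ?_
    rw [toOp_mul, mul_comm]
    refine (norm_mul_le _ _).trans ?_
    exact mul_le_mul_of_nonneg_left (hBr b hb).le (norm_nonneg _)
  refine Seminorm.continuous_of_continuousAt_zero ?_
  rw [ContinuousAt, map_zero]
  refine squeeze_zero (fun u => apply_nonneg _ _) hb ?_
  have := ((continuous_lamSeminorm (θ := θ) 0).const_mul (C * r)).tendsto 0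
  simpa using this

theorem hasSum_of_smoothing (hθ : θ.transpose = -θ) {R : Module.End ℂ (SmoothTorus θ)}
    (hR : R ∈ Smoothing θ) (u : SmoothTorus θ) :
    HasSum (fun l => coeff u l • R (monomial θ l : SmoothTorus θ)) (R u) := by
  have := (hasSum_fourier hθ u).map R (continuous_of_smoothing hθ hR)
  refine this.congr_fun fun l => ?_
  simp

theorem RapidFamily.summable {r : (Fin n → ℤ) → SmoothTorus θ} (hr : RapidFamily r)
    {c : (Fin n → ℤ) → ℂ} {N : ℕ} {C : ℝ} (hc : ∀ l, ‖c l‖ ≤ C * wt l ^ N) (M : ℕ) :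
    Summable fun l => lamSeminorm θ M (c l • r l) := by
  have h1 := summable_wt_mul (a := fun l => lamSeminorm θ M (r l)) (fun l => apply_nonneg _ _)
    (fun N => hr M N) N
  refine (h1.mul_left C).of_nonneg_of_le (fun l => apply_nonneg _ _) fun l => ?_
  rw [map_smul_eq_mul, ← mul_assoc]
  exact mul_le_mul_of_nonneg_right (hc l) (apply_nonneg _ _)

theorem exists_star_monomial (k : Fin n → ℤ) :
    ∃ c : Circle, star (monomial θ k : SmoothTorus θ) = (c : ℂ) • (monomial θ (-k) : SmoothTorus θ) :=
  exists_smul_monomial (isWeyl_monomial k).star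

theorem lamSeminorm_star_monomial_le (hθ : θ.transpose = -θ) (k : Fin n → ℤ) (M : ℕ) :
    lamSeminorm θ M (star (monomial θ k : SmoothTorus θ)) ≤ wt k ^ M := by
  obtain ⟨c, hc⟩ := exists_star_monomial (θ := θ) k
  rw [hc, map_smul_eq_mul, Circle.norm_coe, one_mul, ← wt_neg]
  exact lamSeminorm_monomial_le hθ _ M

theorem exists_dual_monomial_le (hθ : θ.transpose = -θ) (φ : StrongDual ℂ (SmoothTorus θ)) :
    ∃ (N : ℕ) (C : ℝ), ∀ l, ‖φ (star (monomial θ l : SmoothTorus θ))‖ ≤ C * wt l ^ N := by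
  have hφ : Continuous ((normSeminorm ℂ ℂ).comp (φ : SmoothTorus θ →ₗ[ℂ] ℂ)) :=
    continuous_norm.comp φ.continuous
  obtain ⟨s, C, -, h⟩ := Seminorm.bound_of_continuous (withSeminorms_lamSeminorm hθ) _ hφ
  refine ⟨s.sup id, C, fun l => ?_⟩
  refine (h (star (monomial θ l : SmoothTorus θ))).trans ?_
  change (C : ℝ) * _ ≤ _
  refine mul_le_mul_of_nonneg_left ?_ C.2
  refine Seminorm.finset_sup_apply_le (pow_nonneg (wt_pos l).le _) fun i hi => ?_
  refine (lamSeminorm_star_monomial_le hθ l i).trans ?_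
  exact pow_le_pow_right₀ (one_le_wt l) (Finset.le_sup (f := id) hi)

/-- The extension is `φ ↦ ∑ φ((U^l)^*) r l`: a functional grows at most polynomially on the adjoint
monomials, so the series converges. -/
theorem smoothing_of_rapidFamily (hθ : θ.transpose = -θ) {r : (Fin n → ℤ) → SmoothTorus θ}
    (hr : RapidFamily r) {R : Module.End ℂ (SmoothTorus θ)}
    (hR : ∀ u, HasSum (fun l => coeff u l • r l) (R u)) : R ∈ Smoothing θ := by
  have hs (φ : StrongDual ℂ (SmoothTorus θ)) (M : ℕ) : Summable fun l =>
      lamSeminorm θ M (φ (star (monomial θ l : SmoothTorus θ)) • r l) := by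
    obtain ⟨N, C, h⟩ := exists_dual_monomial_le hθ φ
    exact hr.summable h M
  have hs' (φ : StrongDual ℂ (SmoothTorus θ)) :
      Summable fun l => φ (star (monomial θ l : SmoothTorus θ)) • r l := by
    obtain ⟨u, hu⟩ := exists_hasSum hθ (hs φ)
    exact ⟨u, hu⟩
  let S : StrongDual ℂ (SmoothTorus θ) →ₗ[ℂ] SmoothTorus θ :=
    { toFun := fun φ => ∑' l, φ (star (monomial θ l : SmoothTorus θ)) • r l
      map_add' := fun φ ψ => by
        rw [← (hs' φ).tsum_add (hs' ψ)]
        simp [add_smul]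
      map_smul' := fun c φ => by
        rw [RingHom.id_apply, ← (hs' φ).tsum_const_smul c]
        simp [mul_smul] }
  have hSle (φ : StrongDual ℂ (SmoothTorus θ)) (M : ℕ) : lamSeminorm θ M (S φ)
      ≤ ∑' l, lamSeminorm θ M (φ (star (monomial θ l : SmoothTorus θ)) • r l) := by
    have h1 := ((continuous_lamSeminorm (θ := θ) M).tendsto _).comp (hs' φ).hasSum
    refine le_of_tendsto h1 (Eventually.of_forall fun F => ?_)
    refine (Finset.le_sum_of_subadditive (lamSeminorm θ M) (map_zero _).le
      (fun x y => map_add_le_add _ x y) F _).trans ((hs φ M).sum_le_tsum _ fun l _ => apply_nonneg _ _)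
  obtain ⟨s, hws⟩ := exists_summable_wt n
  have hcont : Continuous S := by
    refine (withSeminorms_lamSeminorm hθ).continuous_of_continuous_comp _ fun M => ?_
    refine Seminorm.continuous_of_continuousAt_zero ?_
    rw [ContinuousAt, map_zero, Metric.tendsto_nhds]
    intro ε hε
    -- The adjoint monomials rescaled by the size of `r l` form a bounded set. A functional small on
    -- it makes the `l`-th term at most `ε / (T + 1)` times the summable weight `(wt l ^ s)⁻¹`.
    let B : Set (SmoothTorus θ) := Set.range fun l =>
      ((wt l ^ s * lamSeminorm θ M (r l) : ℝ) : ℂ) • star (monomial θ l : SmoothTorus θ)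
    have hB : Bornology.IsVonNBounded ℂ B := by
      refine (withSeminorms_lamSeminorm hθ).isVonNBounded_iff_seminorm_bounded.2 fun N => ?_
      obtain ⟨C, hC⟩ := hr M (s + N)
      refine ⟨|C| + 1, by positivity, ?_⟩
      rintro _ ⟨l, rfl⟩
      have hw := wt_pos l
      have h0 : 0 ≤ lamSeminorm θ M (r l) := apply_nonneg _ _
      rw [map_smul_eq_mul, Complex.norm_real, Real.norm_of_nonneg (by positivity)]
      calc _ ≤ wt l ^ s * lamSeminorm θ M (r l) * wt l ^ N := by
            gcongr; exact lamSeminorm_star_monomial_le hθ l N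
        _ = wt l ^ (s + N) * lamSeminorm θ M (r l) := by ring
        _ ≤ C := hC l
        _ < |C| + 1 := by linarith [le_abs_self C]
    set T := ∑' l : Fin n → ℤ, (wt l ^ s)⁻¹ with hT
    have hT0 : 0 ≤ T := tsum_nonneg fun l => inv_nonneg.2 (pow_nonneg (wt_pos l).le _)
    have hnb : {φ : StrongDual ℂ (SmoothTorus θ) | ∀ b ∈ B, φ b ∈ Metric.ball (0 : ℂ) (ε / (T + 1))}
        ∈ 𝓝 0 := ContinuousLinearMap.hasBasis_nhds_zero.mem_of_mem
      (i := (B, Metric.ball (0 : ℂ) (ε / (T + 1)))) ⟨hB, Metric.ball_mem_nhds _ (by positivity)⟩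
    filter_upwards [hnb] with φ hφ
    rw [Real.dist_eq, sub_zero, abs_of_nonneg (apply_nonneg _ _)]
    have hterm (l : Fin n → ℤ) : lamSeminorm θ M (φ (star (monomial θ l : SmoothTorus θ)) • r l)
        ≤ (wt l ^ s)⁻¹ * (ε / (T + 1)) := by
      have h1 := hφ _ ⟨l, rfl⟩
      have hw := wt_pos l
      have h0 : 0 ≤ lamSeminorm θ M (r l) := apply_nonneg _ _
      rw [mem_ball_zero_iff, map_smul, norm_smul, Complex.norm_real,
        Real.norm_of_nonneg (by positivity)] at h1
      rw [map_smul_eq_mul, le_inv_mul_iff₀ (by positivity)]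
      refine le_trans (le_of_eq ?_) h1.le
      ring
    calc lamSeminorm θ M (S φ) ≤ _ := hSle φ M
      _ ≤ ∑' l : Fin n → ℤ, (wt l ^ s)⁻¹ * (ε / (T + 1)) :=
        Summable.tsum_le_tsum hterm (hs φ M) (hws.mul_right _)
      _ = T * (ε / (T + 1)) := by rw [tsum_mul_right]
      _ < ε := by
        rw [mul_div_assoc', div_lt_iff₀ (by positivity)]
        linarith
  -- Evaluating `toDual u` at `(U^l)^*` is `coeff u l` by definition, so `S` extends `R`.
  exact ⟨⟨S, hcont⟩, fun u => (hR u).tsum_eq⟩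

end NCTorus
end

/-! ### Traceless smoothing operators are sums of two commutators -/

noncomputable section
namespace NCTorus
open MeasureTheory Topology Filter
open scoped ContDiff ENNReal
variable {n : ℕ} {θ : Matrix (Fin n) (Fin n) ℝ}
open SmoothTorus

/-- Rapid decay of a real sequence. -/
def NatRapid (f : ℕ → ℝ) : Prop := ∀ N : ℕ, ∃ C : ℝ, ∀ i : ℕ, (i + 1 : ℝ) ^ N * f i ≤ C

/-- Rapid decay of a matrix indexed by the natural numbers. -/
def NatMatRapid (A : ℕ → ℕ → ℂ) : Prop :=
  ∀ N : ℕ, ∃ C : ℝ, ∀ i j : ℕ, ((i + 1 : ℝ) * (j + 1)) ^ N * ‖A i j‖ ≤ C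

theorem summable_inv_succ_sq : Summable fun i : ℕ => ((i + 1 : ℝ) ^ 2)⁻¹ := by
  have := (summable_nat_add_iff 1).2 (Real.summable_one_div_nat_pow.2 one_lt_two)
  refine this.congr fun i => ?_
  push_cast
  rw [one_div]

theorem NatRapid.summable {f : ℕ → ℝ} (h0 : ∀ i, 0 ≤ f i) (hf : NatRapid f) (N : ℕ) :
    Summable fun i : ℕ => (i + 1 : ℝ) ^ N * f i := by
  obtain ⟨C, hC⟩ := hf (N + 2)
  refine (summable_inv_succ_sq.mul_left C).of_nonneg_of_le
    (fun i => mul_nonneg (by positivity) (h0 i)) fun i => ?_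
  rw [← div_eq_mul_inv, le_div_iff₀ (by positivity)]
  refine le_trans (le_of_eq ?_) (hC i)
  ring

theorem NatRapid.sqrt {f : ℕ → ℝ} (h0 : ∀ i, 0 ≤ f i) (hf : NatRapid f) : NatRapid fun i => √(f i) := by
  intro N
  obtain ⟨C, hC⟩ := hf (2 * N)
  refine ⟨√C, fun i => ?_⟩
  refine Real.le_sqrt_of_sq_le ?_
  beta_reduce
  rw [mul_pow, Real.sq_sqrt (h0 i), ← pow_mul, mul_comm N 2]
  exact hC i

theorem NatRapid.tail {f : ℕ → ℝ} (h0 : ∀ i, 0 ≤ f i) (hf : NatRapid f) :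
    NatRapid fun k => ∑' j, f (j + (k + 1)) := by
  intro N
  have hs := hf.summable h0 N
  refine ⟨∑' i : ℕ, (i + 1 : ℝ) ^ N * f i, fun k => ?_⟩
  have hs0 : Summable f := by simpa using hf.summable h0 0
  have h1 := (summable_nat_add_iff (k + 1)).2 hs
  rw [← tsum_mul_left]
  refine (Summable.tsum_le_tsum (fun j => ?_) (((summable_nat_add_iff (k + 1)).2 hs0).mul_left _)
    h1).trans ?_
  · gcongr
    · exact h0 _
    · omega
  · rw [← hs.sum_add_tsum_nat_add (k + 1)]
    exact le_add_of_nonneg_left (Finset.sum_nonneg fun i _ => mul_nonneg (by positivity) (h0 i))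

/-- Take for `t i` the `ℓ¹` norm of the `i`-th row plus that of the `i`-th column. -/
theorem NatMatRapid.exists_majorant {A : ℕ → ℕ → ℂ} (hA : NatMatRapid A) :
    ∃ t : ℕ → ℝ, (∀ i, 0 ≤ t i) ∧ NatRapid t ∧ ∀ i j, ‖A i j‖ ≤ t i ∧ ‖A i j‖ ≤ t j := by
  have hb (N : ℕ) : ∃ C : ℝ, ∀ i j : ℕ, (i + 1 : ℝ) ^ N * ‖A i j‖ ≤ C * ((j + 1 : ℝ) ^ 2)⁻¹ ∧
      (j + 1 : ℝ) ^ N * ‖A i j‖ ≤ C * ((i + 1 : ℝ) ^ 2)⁻¹ := by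
    obtain ⟨C, hC⟩ := hA (N + 2)
    refine ⟨C, fun i j => ?_⟩
    have hi : (1 : ℝ) ≤ i + 1 := by simp
    have hj : (1 : ℝ) ≤ j + 1 := by simp
    rw [← div_eq_mul_inv, ← div_eq_mul_inv, le_div_iff₀ (by positivity), le_div_iff₀ (by positivity)]
    have h := hC i j
    rw [mul_pow] at h
    constructor
    · refine le_trans ?_ h
      calc (i + 1 : ℝ) ^ N * ‖A i j‖ * (j + 1) ^ 2 = ((i + 1 : ℝ) ^ N * (j + 1) ^ 2) * ‖A i j‖ := by ring
        _ ≤ _ := by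
          gcongr <;> first | assumption | omega
    · refine le_trans ?_ h
      calc (j + 1 : ℝ) ^ N * ‖A i j‖ * (i + 1) ^ 2 = ((i + 1 : ℝ) ^ 2 * (j + 1) ^ N) * ‖A i j‖ := by ring
        _ ≤ _ := by
          gcongr <;> first | assumption | omega
  obtain ⟨C0, hC0⟩ := hb 0
  have hs1 (i : ℕ) : Summable fun j => ‖A i j‖ :=
    (summable_inv_succ_sq.mul_left C0).of_nonneg_of_le (fun j => norm_nonneg _) fun j => by
      simpa using (hC0 i j).1
  have hs2 (i : ℕ) : Summable fun j => ‖A j i‖ :=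
    (summable_inv_succ_sq.mul_left C0).of_nonneg_of_le (fun j => norm_nonneg _) fun j => by
      simpa using (hC0 j i).2
  have hn1 (i : ℕ) : 0 ≤ ∑' j, ‖A i j‖ := tsum_nonneg fun j => norm_nonneg _
  have hn2 (i : ℕ) : 0 ≤ ∑' j, ‖A j i‖ := tsum_nonneg fun j => norm_nonneg _
  refine ⟨fun i => ∑' j, ‖A i j‖ + ∑' j, ‖A j i‖, fun i => add_nonneg (hn1 i) (hn2 i), ?_,
    fun i j => ⟨?_, ?_⟩⟩
  · intro N
    obtain ⟨C, hC⟩ := hb N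
    refine ⟨∑' j : ℕ, C * ((j + 1 : ℝ) ^ 2)⁻¹ + ∑' j : ℕ, C * ((j + 1 : ℝ) ^ 2)⁻¹, fun i => ?_⟩
    rw [mul_add, ← tsum_mul_left, ← tsum_mul_left]
    exact add_le_add
      (Summable.tsum_le_tsum (fun j => (hC i j).1) ((hs1 i).mul_left _) (summable_inv_succ_sq.mul_left C))
      (Summable.tsum_le_tsum (fun j => (hC j i).2) ((hs2 i).mul_left _) (summable_inv_succ_sq.mul_left C))
  · exact ((hs1 i).le_tsum j fun _ _ => norm_nonneg _).trans (le_add_of_nonneg_right (hn2 i))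
  · exact ((hs2 j).le_tsum i fun _ _ => norm_nonneg _).trans (le_add_of_nonneg_left (hn1 j))

/-- With `d` the tail sums of `√t`, the gap `|d i - d j|` is at least `√(t (max i j))`, whereas `‖A
i j‖ ≤ t (max i j)`. The quotient is therefore at most `√(t (max i j))`, which still decays rapidly
in both indices. -/
theorem NatMatRapid.exists_commutator_diag {A : ℕ → ℕ → ℂ} (hA : NatMatRapid A) :
    ∃ (d : ℕ → ℂ) (X : ℕ → ℕ → ℂ), NatRapid (fun i => ‖d i‖) ∧ NatMatRapid X ∧
      ∀ i j, i ≠ j → (d i - d j) * X i j = A i j := by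
  obtain ⟨t, ht0, ht, hAt⟩ := hA.exists_majorant
  have hs0 (i : ℕ) : 0 ≤ √(t i) := Real.sqrt_nonneg _
  have hs := ht.sqrt ht0
  have hsum : Summable fun i => √(t i) := by simpa using hs.summable hs0 0
  set d : ℕ → ℝ := fun k => ∑' j, √(t (j + (k + 1))) with hd
  have hd0 (k : ℕ) : 0 ≤ d k := tsum_nonneg fun j => hs0 _
  have hdd (k l : ℕ) (h : k < l) : √(t l) ≤ d k - d l := by
    have h1 := hsum.sum_add_tsum_nat_add (k + 1)
    have h2 := hsum.sum_add_tsum_nat_add (l + 1)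
    have h3 : ∑ i ∈ Finset.range (k + 1), √(t i) + √(t l) ≤ ∑ i ∈ Finset.range (l + 1), √(t i) := by
      rw [Finset.sum_range_succ _ l]
      exact add_le_add_left (Finset.sum_le_sum_of_subset_of_nonneg (Finset.range_mono h)
        fun i _ _ => hs0 i) _
    simp only [hd]
    linarith
  have habs (i j : ℕ) (h : i ≠ j) : √(t (max i j)) ≤ |d i - d j| := by
    rcases lt_or_gt_of_ne h with h | h
    · rw [max_eq_right h.le]
      exact (hdd i j h).trans (le_abs_self _)
    · rw [max_eq_left h.le, abs_sub_comm]
      exact (hdd j i h).trans (le_abs_self _)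
  have hAm (i j : ℕ) : ‖A i j‖ ≤ t (max i j) := by
    rcases max_choice i j with h | h <;> rw [h]
    exacts [(hAt i j).1, (hAt i j).2]
  have hnorm (i j : ℕ) : ‖((d i : ℂ) - d j)‖ = |d i - d j| := by
    rw [← Complex.ofReal_sub, Complex.norm_real, Real.norm_eq_abs]
  refine ⟨fun i => d i, fun i j => A i j / (d i - d j), ?_, ?_, ?_⟩
  · have := hs.tail hs0
    intro N
    obtain ⟨C, hC⟩ := this N
    refine ⟨C, fun i => ?_⟩
    beta_reduce
    rw [Complex.norm_real, Real.norm_of_nonneg (hd0 i)]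
    exact hC i
  · intro N
    obtain ⟨C, hC⟩ := hs (2 * N)
    have hC0 : 0 ≤ C := le_trans (by positivity) (hC 0)
    refine ⟨C, fun i j => ?_⟩
    have hX : ‖A i j / ((d i : ℂ) - d j)‖ ≤ √(t (max i j)) := by
      rcases eq_or_ne i j with rfl | hij
      · simp
      rw [norm_div, hnorm]
      refine div_le_of_le_mul₀ (abs_nonneg _) (hs0 _) ?_
      calc ‖A i j‖ ≤ t (max i j) := hAm i j
        _ = √(t (max i j)) * √(t (max i j)) := (Real.mul_self_sqrt (ht0 _)).symm
        _ ≤ _ := by gcongr; exact habs i j hij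
    have h1 : ((i + 1 : ℝ) * (j + 1)) ^ N ≤ ((max i j : ℕ) + 1 : ℝ) ^ (2 * N) := by
      rw [pow_mul, sq]
      gcongr
      · exact le_max_left _ _
      · exact le_max_right _ _
    calc _ ≤ ((max i j : ℕ) + 1 : ℝ) ^ (2 * N) * √(t (max i j)) := by gcongr
      _ ≤ C := hC _
  · intro i j hij
    -- The sequence `d` need not be injective, but a vanishing gap forces the entry of `A` to vanish
    -- too.
    by_cases h : (d i : ℂ) - d j = 0
    · rw [h, zero_mul]
      have h1 := habs i j hij
      rw [← hnorm, h, norm_zero] at h1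
      have h2 := hAm i j
      have h3 : t (max i j) = 0 := (Real.sqrt_eq_zero (ht0 _)).1 (le_antisymm h1 (hs0 _))
      rw [h3] at h2
      exact (norm_le_zero_iff.1 h2).symm
    · field_simp

/-- Since the total is zero, each partial sum is minus a tail and so decays rapidly. Splitting it
into two factors of modulus `√‖s i‖` keeps both weighted shifts smoothing. -/
theorem exists_shift_factors {c : ℕ → ℂ} (hc : NatRapid fun i => ‖c i‖) (hsum : HasSum c 0) :
    ∃ a b : ℕ → ℂ, NatRapid (fun i => ‖a i‖) ∧ NatRapid (fun i => ‖b i‖) ∧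
      a 0 * b 0 = c 0 ∧ ∀ i, a (i + 1) * b (i + 1) - a i * b i = c (i + 1) := by
  set s : ℕ → ℂ := fun k => ∑ i ∈ Finset.range (k + 1), c i with hs
  have hsn : Summable fun i => ‖c i‖ := by simpa using hc.summable (fun i => norm_nonneg _) 0
  have hsr : NatRapid fun i => ‖s i‖ := by
    intro N
    obtain ⟨C, hC⟩ := hc.tail (fun i => norm_nonneg _) N
    refine ⟨C, fun k => le_trans ?_ (hC k)⟩
    gcongr
    have h1 := hsum.summable.sum_add_tsum_nat_add (k + 1)
    rw [hsum.tsum_eq] at h1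
    have h2 : s k = -∑' i, c (i + (k + 1)) := eq_neg_of_add_eq_zero_left h1
    beta_reduce
    rw [h2, norm_neg]
    exact norm_tsum_le_tsum_norm ((summable_nat_add_iff (k + 1)).2 hsn)
  have hsq := hsr.sqrt fun i => norm_nonneg _
  have hab (i : ℕ) : (√‖s i‖ : ℂ) * (s i / (√‖s i‖ : ℂ)) = s i := by
    by_cases h : s i = 0
    · simp [h]
    · have : (√‖s i‖ : ℂ) ≠ 0 := by
        rw [Complex.ofReal_ne_zero, Real.sqrt_ne_zero (norm_nonneg _)]
        exact norm_ne_zero_iff.2 h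
      field_simp
  refine ⟨fun i => (√‖s i‖ : ℂ), fun i => s i / (√‖s i‖ : ℂ), ?_, ?_, ?_, fun i => ?_⟩
  · intro N
    obtain ⟨C, hC⟩ := hsq N
    refine ⟨C, fun i => ?_⟩
    beta_reduce
    rw [Complex.norm_real, Real.norm_of_nonneg (Real.sqrt_nonneg _)]
    exact hC i
  · intro N
    obtain ⟨C, hC⟩ := hsq N
    refine ⟨C, fun i => ?_⟩
    beta_reduce
    rw [norm_div, Complex.norm_real, Real.norm_of_nonneg (Real.sqrt_nonneg _), Real.div_sqrt]
    exact hC i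
  · rw [hab]; simp [hs]
  · rw [hab, hab]; simp only [hs]; rw [Finset.sum_range_succ _ (i + 1)]; ring

/-- The columns are the coefficient sequences of the images of the `U^l`; joint decay of the entries
makes these images a rapid family. -/
theorem smoothing_of_matrix (hθ : θ.transpose = -θ) {A : (Fin n → ℤ) → (Fin n → ℤ) → ℂ}
    (hA : ∀ N : ℕ, ∃ C : ℝ, ∀ k l, (wt k * wt l) ^ N * ‖A k l‖ ≤ C) :
    ∃ R ∈ Smoothing θ, ∀ u k, HasSum (fun l => A k l * coeff u l) (coeff (R u) k) := by
  have hA2 (M N : ℕ) : ∃ C : ℝ, ∀ k l, wt k ^ M * (wt l ^ N * ‖A k l‖) ≤ C := by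
    obtain ⟨C, hC⟩ := hA (max M N)
    refine ⟨C, fun k l => le_trans ?_ (hC k l)⟩
    have hk := one_le_wt k
    have hl := one_le_wt l
    rw [← mul_assoc, mul_pow]
    gcongr <;> first | assumption | exact le_max_left _ _ | exact le_max_right _ _
  have hRD (l : Fin n → ℤ) : RapidDecay fun k => A k l := fun M => by
    obtain ⟨C, hC⟩ := hA2 M 0
    exact ⟨C, fun k => by simpa using hC k l⟩
  set r : (Fin n → ℤ) → SmoothTorus θ := fun l => ofCoeff θ fun k => A k l with hr
  have hcr (k l : Fin n → ℤ) : coeff (r l) k = A k l := coeff_ofCoeff (hRD l) k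
  have hrap : RapidFamily r := fun M N => by
    obtain ⟨s, C, hC, h⟩ := exists_lamSeminorm_le hθ M
    obtain ⟨C', hC'⟩ := hA2 s N
    refine ⟨C * C', fun l => ?_⟩
    have hp : 0 < wt l ^ N := pow_pos (wt_pos l) N
    have := h (r l) (C' / wt l ^ N) fun k => by
      rw [hcr, le_div_iff₀' hp]
      exact le_trans (le_of_eq (by ring)) (hC' k l)
    calc _ ≤ wt l ^ N * (C * (C' / wt l ^ N)) := by gcongr
      _ = C * C' := by field_simp
  have hsum (u : SmoothTorus θ) : ∃ v, HasSum (fun l => coeff u l • r l) v :=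
    exists_hasSum hθ (hrap.summable (N := 0) (C := lamSeminorm θ 0 u) fun l => by
      simpa using norm_coeff_le_lamSeminorm_zero u l)
  have hs (u : SmoothTorus θ) : HasSum (fun l => coeff u l • r l) (∑' l, coeff u l • r l) := by
    obtain ⟨v, hv⟩ := hsum u
    exact hv.summable.hasSum
  let R : Module.End ℂ (SmoothTorus θ) :=
    { toFun := fun u => ∑' l, coeff u l • r l
      map_add' := fun u v => by
        refine HasSum.tsum_eq (((hs u).add (hs v)).congr_fun fun l => ?_)
        rw [coeff_add, add_smul]
      map_smul' := fun c u => by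
        refine HasSum.tsum_eq (((hs u).const_smul c).congr_fun fun l => ?_)
        rw [coeff_smul, mul_smul] }
  refine ⟨R, smoothing_of_rapidFamily hθ hrap hs, fun u k => ?_⟩
  refine (hasSum_coeff_of_hasSum (hs u) k).congr_fun fun l => ?_
  rw [coeff_smul, hcr, mul_comm]

theorem smoothing_of_natMatRapid (hθ : θ.transpose = -θ) {e : ℕ ≃ (Fin n → ℤ)} {p : ℕ} {C : ℝ}
    (hC : 0 < C) (he : ∀ i, wt (e i) ≤ C * (i + 1 : ℝ) ^ p) {A : ℕ → ℕ → ℂ} (hA : NatMatRapid A) :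
    ∃ R ∈ Smoothing θ, ∀ u i, HasSum (fun j => A i j * coeff u (e j)) (coeff (R u) (e i)) := by
  obtain ⟨R, hR, h⟩ := smoothing_of_matrix hθ (A := fun k l => A (e.symm k) (e.symm l)) fun N => by
    obtain ⟨D, hD⟩ := hA (p * N)
    refine ⟨(C * C) ^ N * D, fun k l => ?_⟩
    have h1 := he (e.symm k)
    have h2 := he (e.symm l)
    rw [Equiv.apply_symm_apply] at h1 h2
    have hk := wt_pos k
    have hl := wt_pos l
    calc _ ≤ ((C * ((e.symm k : ℕ) + 1 : ℝ) ^ p) * (C * ((e.symm l : ℕ) + 1 : ℝ) ^ p)) ^ N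
          * ‖A (e.symm k) (e.symm l)‖ := by gcongr
      _ = (C * C) ^ N * ((((e.symm k : ℕ) + 1 : ℝ) * ((e.symm l : ℕ) + 1 : ℝ)) ^ (p * N)
          * ‖A (e.symm k) (e.symm l)‖) := by
        rw [pow_mul, mul_pow _ _ p, mul_mul_mul_comm, mul_pow (C * C), mul_assoc]
      _ ≤ _ := by gcongr; exact hD _ _
  refine ⟨R, hR, fun u i => ?_⟩
  have := h u (e i)
  rw [← e.hasSum_iff] at this
  refine this.congr_fun fun j => ?_
  simp

/-- One statement for diagonal matrices and for both weighted shifts: the support is a curve `m ↦ (σ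
m, τ m)` on which both indices are comparable with `m`. -/
theorem NatRapid.diag {a : ℕ → ℂ} (ha : NatRapid fun i => ‖a i‖) {σ τ : ℕ → ℕ}
    (hσ : ∀ i, σ i ≤ i + 1) (hτ : ∀ i, τ i ≤ i + 1) {A : ℕ → ℕ → ℂ}
    (hA : ∀ i j, A i j = 0 ∨ ∃ m, i = σ m ∧ j = τ m ∧ A i j = a m) : NatMatRapid A := by
  intro N
  obtain ⟨C, hC⟩ := ha (2 * N)
  have hC0 : 0 ≤ C := le_trans (by positivity) (hC 0)
  refine ⟨4 ^ N * C, fun i j => ?_⟩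
  rcases hA i j with h | ⟨m, rfl, rfl, h⟩
  · rw [h, norm_zero, mul_zero]; positivity
  · rw [h]
    have h1 : ((σ m : ℝ) + 1) ≤ 2 * (m + 1) := by
      have : (σ m : ℝ) ≤ m + 1 := by exact_mod_cast hσ m
      linarith [(Nat.cast_nonneg m : (0 : ℝ) ≤ m)]
    have h2 : ((τ m : ℝ) + 1) ≤ 2 * (m + 1) := by
      have : (τ m : ℝ) ≤ m + 1 := by exact_mod_cast hτ m
      linarith [(Nat.cast_nonneg m : (0 : ℝ) ≤ m)]
    calc _ ≤ ((2 * (m + 1 : ℝ)) * (2 * (m + 1))) ^ N * ‖a m‖ := by gcongr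
      _ = 4 ^ N * ((m + 1 : ℝ) ^ (2 * N) * ‖a m‖) := by
        rw [mul_mul_mul_comm, mul_pow (2 * 2 : ℝ), pow_mul, sq, mul_assoc]; norm_num
      _ ≤ _ := by gcongr; exact hC m

/-- The matrix entry `⟨R U^l | U^k⟩`. -/
def entry (R : Module.End ℂ (SmoothTorus θ)) (k l : Fin n → ℤ) : ℂ :=
  coeff (R (monomial θ l : SmoothTorus θ)) k

theorem natMatRapid_entry (hθ : θ.transpose = -θ) {R : Module.End ℂ (SmoothTorus θ)}
    (hR : R ∈ Smoothing θ) {e : ℕ ≃ (Fin n → ℤ)} {p : ℕ} {C : ℝ}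
    (hC : 0 < C) (he : ∀ i : ℕ, (i + 1 : ℝ) ≤ C * wt (e i) ^ p) :
    NatMatRapid fun i j => entry R (e i) (e j) := by
  intro N
  obtain ⟨D, hD⟩ := rapidFamily_of_smoothing hθ hR (p * N) (p * N)
  refine ⟨(C * C) ^ N * D, fun i j => ?_⟩
  have h1 := he i
  have h2 := he j
  have hk := wt_pos (e i)
  have hl := wt_pos (e j)
  calc _ ≤ ((C * wt (e i) ^ p) * (C * wt (e j) ^ p)) ^ N * ‖entry R (e i) (e j)‖ := by gcongr
    _ = (C * C) ^ N * (wt (e j) ^ (p * N) * (wt (e i) ^ (p * N) * ‖entry R (e i) (e j)‖)) := by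
      rw [pow_mul, pow_mul]; ring
    _ ≤ (C * C) ^ N * D := by
      gcongr
      refine le_trans ?_ (hD (e j))
      gcongr
      exact wt_mul_coeff_le _ _ _

theorem coeff_lie (P Q : Module.End ℂ (SmoothTorus θ)) (u : SmoothTorus θ) (k : Fin n → ℤ) :
    coeff (⁅P, Q⁆ u) k = coeff (P (Q u)) k - coeff (Q (P u)) k :=
  coeff_sub (P (Q u)) (Q (P u)) k

-- `R₁` is diagonal and `R₂` is the matrix of quotients; their commutator has zero diagonal and the
-- off-diagonal entries of `R`. `R₃` and `R₄` are the backward and forward shifts with weights `a`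
-- and `b`; their commutator is diagonal with entries `a i * b i - a (i - 1) * b (i - 1)`, the
-- second term being absent at `i = 0`.
set_option maxHeartbeats 1000000 in
theorem exists_smoothing_commutators (hn : 0 < n) (hθ : θ.transpose = -θ)
    {R : Module.End ℂ (SmoothTorus θ)} (hR : R ∈ Smoothing θ)
    (htr : HasSum (fun k => entry R k k) 0) :
    ∃ R₁ ∈ Smoothing θ, ∃ R₂ ∈ Smoothing θ, ∃ R₃ ∈ Smoothing θ, ∃ R₄ ∈ Smoothing θ,
      R = ⁅R₁, R₂⁆ + ⁅R₃, R₄⁆ := by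
  obtain ⟨e, p, C, hC, he⟩ := exists_equiv_nat hn
  have he2 := fun i => (he i).2
  have hA := natMatRapid_entry hθ hR hC fun i => (he i).1
  obtain ⟨d, X, hd, hX, hdX⟩ := hA.exists_commutator_diag
  have hdiag : NatRapid fun i => ‖entry R (e i) (e i)‖ := by
    intro N
    obtain ⟨D, hD⟩ := hA N
    refine ⟨D, fun i => le_trans ?_ (hD i i)⟩
    have hi : (1 : ℝ) ≤ i + 1 := by simp
    gcongr
    nlinarith
  obtain ⟨a, b, ha, hb, hab0, hab⟩ := exists_shift_factors hdiag (e.hasSum_iff.2 htr)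
  obtain ⟨R₁, hR₁, h₁⟩ := smoothing_of_natMatRapid hθ hC he2
    (hd.diag (σ := id) (τ := id) (A := fun i j => if i = j then d i else 0) (fun i => Nat.le_succ i)
      (fun i => Nat.le_succ i) fun i j => by
        by_cases h : i = j
        · exact Or.inr ⟨i, rfl, h.symm, if_pos h⟩
        · exact Or.inl (if_neg h))
  obtain ⟨R₂, hR₂, h₂⟩ := smoothing_of_natMatRapid hθ hC he2 hX
  obtain ⟨R₃, hR₃, h₃⟩ := smoothing_of_natMatRapid hθ hC he2
    (ha.diag (σ := id) (τ := fun i => i + 1) (A := fun i j => if j = i + 1 then a i else 0)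
      (fun i => Nat.le_succ i) (fun i => le_rfl) fun i j => by
        by_cases h : j = i + 1
        · exact Or.inr ⟨i, rfl, h, if_pos h⟩
        · exact Or.inl (if_neg h))
  obtain ⟨R₄, hR₄, h₄⟩ := smoothing_of_natMatRapid hθ hC he2
    (hb.diag (σ := fun i => i + 1) (τ := id) (A := fun i j => if i = j + 1 then b j else 0)
      (fun i => le_rfl) (fun i => Nat.le_succ i) fun i j => by
        by_cases h : i = j + 1
        · exact Or.inr ⟨j, h, rfl, if_pos h⟩
        · exact Or.inl (if_neg h))
  have h₁' (u : SmoothTorus θ) (i : ℕ) : coeff (R₁ u) (e i) = d i * coeff u (e i) := by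
    refine (h₁ u i).unique ?_
    convert hasSum_single i fun j hj => ?_ using 1
    · rw [if_pos rfl]
    · rw [if_neg (Ne.symm hj), zero_mul]
  have h₃' (u : SmoothTorus θ) (i : ℕ) : coeff (R₃ u) (e i) = a i * coeff u (e (i + 1)) := by
    refine (h₃ u i).unique ?_
    convert hasSum_single (i + 1) fun j hj => ?_ using 1
    · rw [if_pos rfl]
    · rw [if_neg hj, zero_mul]
  have h₄' (u : SmoothTorus θ) (i : ℕ) : coeff (R₄ u) (e (i + 1)) = b i * coeff u (e i) := by
    refine (h₄ u (i + 1)).unique ?_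
    convert hasSum_single i fun j hj => ?_ using 1
    · rw [if_pos rfl]
    · rw [if_neg fun h => hj (by omega), zero_mul]
  -- Nothing is shifted into position `0`; this is why `a 0 * b 0` alone must equal the first
  -- diagonal entry.
  have h₄0 (u : SmoothTorus θ) : coeff (R₄ u) (e 0) = 0 := by
    refine (h₄ u 0).unique ?_
    convert hasSum_zero using 2 with j
    simp
  refine ⟨R₁, hR₁, R₂, hR₂, R₃, hR₃, R₄, hR₄, LinearMap.ext fun u => coeff_injective hθ fun k => ?_⟩
  obtain ⟨i, rfl⟩ := e.surjective k
  have hRu : HasSum (fun j => entry R (e i) (e j) * coeff u (e j)) (coeff (R u) (e i)) := by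
    have := e.hasSum_iff.2 (hasSum_coeff_of_hasSum (hasSum_of_smoothing hθ hR u) (e i))
    refine this.congr_fun fun j => ?_
    rw [Function.comp, coeff_smul, mul_comm]
    rfl
  have h12 : HasSum (fun j => (d i - d j) * X i j * coeff u (e j))
      (d i * coeff (R₂ u) (e i) - coeff (R₂ (R₁ u)) (e i)) := by
    refine (((h₂ u i).mul_left (d i)).sub (h₂ (R₁ u) i)).congr_fun fun j => ?_
    rw [h₁']; ring
  have h34 : coeff (R₃ (R₄ u)) (e i) - coeff (R₄ (R₃ u)) (e i)
      = entry R (e i) (e i) * coeff u (e i) := by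
    cases i with
    | zero => rw [h₃', h₄', h₄0, ← hab0]; ring
    | succ i => rw [h₃', h₄', h₄', h₃', ← hab i]; ring
  have hsum := h12.add (hasSum_ite_eq i (entry R (e i) (e i) * coeff u (e i)))
  have hu := hRu.unique (hsum.congr_fun fun j => by
    split_ifs with h
    · rw [h]; ring
    · rw [hdX i j (Ne.symm h), add_zero])
  rw [hu, LinearMap.add_apply, coeff_add, coeff_lie, coeff_lie, h34, h₁']

end NCTorus
end

/-! ### Symbols and pseudodifferential operators -/

noncomputable section
namespace NCTorus
open MeasureTheory Topology Filter
open scoped ContDiff ENNReal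
variable {n : ℕ} {θ : Matrix (Fin n) (Fin n) ℝ}
open SmoothTorus

section Pderiv

variable {F : Type*} [AddCommGroup F] [Module ℝ F]

theorem diffQuot_congr {f g : EuclideanSpace ℝ (Fin n) → F} {j : Fin n}
    {ξ : EuclideanSpace ℝ (Fin n)} (h : f =ᶠ[𝓝 ξ] g) :
    diffQuot f j ξ =ᶠ[𝓝[≠] 0] diffQuot g j ξ := by
  have hc : Tendsto (fun t : ℝ => ξ + t • EuclideanSpace.single j (1 : ℝ)) (𝓝[≠] 0) (𝓝 ξ) := by
    have : Continuous fun t : ℝ => ξ + t • EuclideanSpace.single j (1 : ℝ) := by fun_prop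
    have h2 := this.tendsto 0
    rw [zero_smul, add_zero] at h2
    exact h2.mono_left nhdsWithin_le_nhds
  filter_upwards [hc.eventually h] with t ht
  rw [diffQuot, diffQuot, ht, h.eq_of_nhds]

variable [TopologicalSpace F]

theorem pderiv_eq_of_tendsto [T2Space F] {f : EuclideanSpace ℝ (Fin n) → F} {j : Fin n}
    {ξ : EuclideanSpace ℝ (Fin n)} {v : F} (h : Tendsto (diffQuot f j ξ) (𝓝[≠] 0) (𝓝 v)) :
    pderiv j f ξ = v := h.limUnder_eq

theorem pderiv_congr {f g : EuclideanSpace ℝ (Fin n) → F} {j : Fin n}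
    {ξ : EuclideanSpace ℝ (Fin n)} (h : f =ᶠ[𝓝 ξ] g) : pderiv j f ξ = pderiv j g ξ := by
  rw [pderiv, pderiv, limUnder, limUnder, Filter.map_congr (diffQuot_congr h)]

theorem pderivs_congr {f g : EuclideanSpace ℝ (Fin n) → F} {Ω : Set (EuclideanSpace ℝ (Fin n))}
    (hΩ : IsOpen Ω) (h : Set.EqOn f g Ω) (b : List (Fin n)) :
    Set.EqOn (pderivs b f) (pderivs b g) Ω := by
  induction b with
  | nil => exact h
  | cons j b ih => exact fun ξ hξ => pderiv_congr (ih.eventuallyEq_of_mem (hΩ.mem_nhds hξ))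

theorem pderivs_comp_sub (f : EuclideanSpace ℝ (Fin n) → F) (c : EuclideanSpace ℝ (Fin n))
    (b : List (Fin n)) : pderivs b (fun ξ => f (ξ - c)) = fun ξ => pderivs b f (ξ - c) := by
  induction b with
  | nil => rfl
  | cons j b ih =>
    funext ξ
    change pderiv j (pderivs b fun ξ => f (ξ - c)) ξ = pderiv j (pderivs b f) (ξ - c)
    rw [ih, pderiv, pderiv]
    congr 1
    funext t
    simp only [diffQuot]
    rw [add_sub_right_comm]

end Pderiv

section Scalar

variable {F : Type*} [NormedAddCommGroup F] [NormedSpace ℝ F]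
  {Ω : Set (EuclideanSpace ℝ (Fin n))} {φ : EuclideanSpace ℝ (Fin n) → F}

theorem tendsto_diffQuot {ξ : EuclideanSpace ℝ (Fin n)} (h : DifferentiableAt ℝ φ ξ) (j : Fin n) :
    Tendsto (diffQuot φ j ξ) (𝓝[≠] 0) (𝓝 (fderiv ℝ φ ξ (EuclideanSpace.single j 1))) :=
  (h.hasFDerivAt.hasLineDerivAt _).tendsto_slope_zero

theorem pderiv_eq_fderiv {ξ : EuclideanSpace ℝ (Fin n)} (h : DifferentiableAt ℝ φ ξ) (j : Fin n) :
    pderiv j φ ξ = fderiv ℝ φ ξ (EuclideanSpace.single j 1) :=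
  pderiv_eq_of_tendsto (tendsto_diffQuot h j)

theorem contDiffOn_pderiv (hΩ : IsOpen Ω) (h : ContDiffOn ℝ ∞ φ Ω) (j : Fin n) :
    ContDiffOn ℝ ∞ (pderiv j φ) Ω := by
  have h1 : ContDiffOn ℝ ∞ (fun ξ => fderiv ℝ φ ξ (EuclideanSpace.single j 1)) Ω :=
    (h.fderiv_of_isOpen hΩ (by simp)).clm_apply contDiffOn_const
  exact h1.congr fun ξ hξ => pderiv_eq_fderiv
    ((h.differentiableOn (by simp)).differentiableAt (hΩ.mem_nhds hξ)) j

theorem contDiffOn_pderivs (hΩ : IsOpen Ω) (h : ContDiffOn ℝ ∞ φ Ω) (b : List (Fin n)) :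
    ContDiffOn ℝ ∞ (pderivs b φ) Ω := by
  induction b with
  | nil => exact h
  | cons j b ih => exact contDiffOn_pderiv hΩ ih j

theorem pderivs_zero (b : List (Fin n)) :
    pderivs b (fun _ : EuclideanSpace ℝ (Fin n) => (0 : F)) = fun _ => 0 := by
  induction b with
  | nil => rfl
  | cons j b ih =>
    funext ξ
    change pderiv j (pderivs b fun _ => 0) ξ = 0
    rw [ih, pderiv_eq_fderiv (differentiableAt_const _)]
    simp

end Scalar

section SmulConst

variable {Ω : Set (EuclideanSpace ℝ (Fin n))} {φ : EuclideanSpace ℝ (Fin n) → ℂ}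

theorem diffQuot_smul (φ : EuclideanSpace ℝ (Fin n) → ℂ) (v : SmoothTorus θ) (j : Fin n)
    (ξ : EuclideanSpace ℝ (Fin n)) :
    diffQuot (fun ξ => φ ξ • v) j ξ = fun t => diffQuot φ j ξ t • v := by
  funext t
  rw [diffQuot, diffQuot, ← sub_smul, smul_assoc]

theorem tendsto_diffQuot_smul {ξ : EuclideanSpace ℝ (Fin n)} (h : DifferentiableAt ℝ φ ξ)
    (v : SmoothTorus θ) (j : Fin n) :
    Tendsto (diffQuot (fun ξ => φ ξ • v) j ξ) (𝓝[≠] 0) (𝓝 (pderiv j φ ξ • v)) := by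
  rw [diffQuot_smul, pderiv_eq_fderiv h]
  exact (tendsto_diffQuot h j).smul_const v

theorem pderivs_smul (hΩ : IsOpen Ω) (h : ContDiffOn ℝ ∞ φ Ω) (v : SmoothTorus θ)
    (b : List (Fin n)) : Set.EqOn (pderivs b fun ξ => φ ξ • v) (fun ξ => pderivs b φ ξ • v) Ω := by
  induction b with
  | nil => exact fun ξ _ => rfl
  | cons j b ih =>
    intro ξ hξ
    change pderiv j (pderivs b fun ξ => φ ξ • v) ξ = pderiv j (pderivs b φ) ξ • v
    rw [pderiv_congr (ih.eventuallyEq_of_mem (hΩ.mem_nhds hξ))]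
    exact pderiv_eq_of_tendsto (tendsto_diffQuot_smul (((contDiffOn_pderivs hΩ h b).differentiableOn
      (by simp)).differentiableAt (hΩ.mem_nhds hξ)) v j)

/-- Every symbol used here is locally a scalar function times a fixed vector, so `𝒜_θ`-valued
calculus reduces to scalar calculus. -/
theorem isSmoothOn_of_local {Ω : Set (EuclideanSpace ℝ (Fin n))}
    {f : EuclideanSpace ℝ (Fin n) → SmoothTorus θ}
    (h : ∀ ξ ∈ Ω, ∃ (O : Set (EuclideanSpace ℝ (Fin n))) (φ : EuclideanSpace ℝ (Fin n) → ℂ)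
      (v : SmoothTorus θ), IsOpen O ∧ ξ ∈ O ∧ ContDiffOn ℝ ∞ φ O ∧
        Set.EqOn f (fun ξ => φ ξ • v) O) : IsSmoothOn Ω f := by
  have key (b : List (Fin n)) : ∀ ξ ∈ Ω, ∃ (φ : EuclideanSpace ℝ (Fin n) → ℂ) (v : SmoothTorus θ),
      DifferentiableAt ℝ φ ξ ∧ pderivs b f =ᶠ[𝓝 ξ] fun ξ => φ ξ • v := by
    intro ξ hξ
    obtain ⟨O, φ, v, hO, hξO, hφ, hf⟩ := h ξ hξ
    refine ⟨pderivs b φ, v, ((contDiffOn_pderivs hO hφ b).differentiableOn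
      (by simp)).differentiableAt (hO.mem_nhds hξO), ?_⟩
    exact ((pderivs_congr hO hf b).trans (pderivs_smul hO hφ v b)).eventuallyEq_of_mem
      (hO.mem_nhds hξO)
  intro b
  refine ⟨fun ξ hξ => ?_, fun j ξ hξ => ?_⟩
  · obtain ⟨φ, v, hφ, hf⟩ := key b ξ hξ
    exact ((hφ.continuousAt.smul continuousAt_const).congr hf.symm).continuousWithinAt
  · obtain ⟨φ, v, hφ, hf⟩ := key b ξ hξ
    exact ⟨_, (tendsto_diffQuot_smul hφ v j).congr' (diffQuot_congr hf).symm⟩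

end SmulConst

/-- Classical scalar symbols of order `q`. -/
structure IsScalarSymbol (q : ℂ) (f : EuclideanSpace ℝ (Fin n) → ℂ) : Prop where
  smooth : ContDiff ℝ ∞ f
  expansion : ∃ h : ℕ → EuclideanSpace ℝ (Fin n) → ℂ,
    (∀ j : ℕ, ContDiffOn ℝ ∞ (h j) {0}ᶜ ∧
      ∀ ξ, ξ ≠ 0 → ∀ t : ℝ, 0 < t → h j (t • ξ) = (t : ℂ) ^ (q - j) * h j ξ) ∧
    ∀ (N : ℕ) (b : List (Fin n)), ∃ C : ℝ, ∀ ξ, 1 ≤ ‖ξ‖ →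
      ‖pderivs b (f - ∑ j ∈ Finset.range N, h j) ξ‖ ≤ C * ‖ξ‖ ^ (q.re - N - b.length)

theorem IsScalarSymbol.smul {q : ℂ} {f : EuclideanSpace ℝ (Fin n) → ℂ} (hf : IsScalarSymbol q f)
    (v : SmoothTorus θ) : IsClassicalSymbol q fun ξ => f ξ • v := by
  obtain ⟨hs, h, hh, he⟩ := hf
  refine ⟨isSmoothOn_of_local fun ξ _ => ⟨Set.univ, f, v, isOpen_univ, trivial, hs.contDiffOn,
    fun _ _ => rfl⟩, fun j ξ => h j ξ • v, fun j => ⟨isSmoothOn_of_local fun ξ hξ =>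
      ⟨{0}ᶜ, h j, v, isOpen_compl_singleton, hξ, (hh j).1, fun _ _ => rfl⟩, fun ξ hξ t ht => ?_⟩,
    fun N a b => ?_⟩
  · beta_reduce
    rw [(hh j).2 ξ hξ t ht, mul_smul]
  · obtain ⟨C, hC⟩ := he N b
    refine ⟨C * ‖toOp (deltas a v)‖, fun ξ hξ => ?_⟩
    have hξ0 : ξ ∈ ({0}ᶜ : Set (EuclideanSpace ℝ (Fin n))) := by
      rintro rfl
      rw [norm_zero] at hξ
      linarith
    have h1 : ((fun ξ => f ξ • v) - ∑ j ∈ Finset.range N, fun ξ => h j ξ • v)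
        = fun ξ => (f - ∑ j ∈ Finset.range N, h j) ξ • v := by
      funext ξ
      simp only [Pi.sub_apply, Finset.sum_apply, sub_smul, Finset.sum_smul]
    have h2 : ContDiffOn ℝ ∞ (f - ∑ j ∈ Finset.range N, h j) {0}ᶜ := by
      have : f - ∑ j ∈ Finset.range N, h j = fun ξ => f ξ - ∑ j ∈ Finset.range N, h j ξ := by
        funext ξ
        simp
      rw [this]
      exact hs.contDiffOn.sub (ContDiffOn.sum fun j _ => (hh j).1)
    rw [h1, pderivs_smul isOpen_compl_singleton h2 v b hξ0, map_smul, map_smul, norm_smul]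
    calc _ ≤ C * ‖ξ‖ ^ (q.re - N - b.length) * ‖toOp (deltas a v)‖ := by gcongr; exact hC ξ hξ
      _ = _ := by ring

theorem isScalarSymbol_one : IsScalarSymbol 0 (fun _ : EuclideanSpace ℝ (Fin n) => (1 : ℂ)) := by
  -- The expansion stops after its leading term `1`: the remainder is the symbol itself for `N = 0`
  -- and zero for `N > 0`.
  refine ⟨contDiff_const, fun j _ => if j = 0 then 1 else 0, fun j => ⟨contDiffOn_const,
    fun ξ _ t _ => ?_⟩, fun N b => ?_⟩
  · beta_reduce
    split_ifs with h
    · simp [h]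
    · simp
  · have hz : ∀ b : List (Fin n), b ≠ [] →
        pderivs b (fun _ : EuclideanSpace ℝ (Fin n) => (1 : ℂ)) = fun _ => 0 := by
      intro b hb
      induction b with
      | nil => exact absurd rfl hb
      | cons j b ih =>
        rcases eq_or_ne b [] with rfl | hb
        · funext ξ
          change pderiv j (fun _ => 1) ξ = 0
          rw [pderiv_eq_fderiv (differentiableAt_const _)]
          simp
        · change pderiv j (pderivs b _) = _
          rw [ih hb]
          exact pderivs_zero [j]
    rcases Nat.eq_zero_or_pos N with rfl | hN
    · refine ⟨1, fun ξ hξ => ?_⟩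
      rw [Finset.range_zero, Finset.sum_empty, sub_zero]
      rcases eq_or_ne b [] with rfl | hb
      · simp [pderivs]
      · rw [hz b hb, norm_zero]; positivity
    · refine ⟨0, fun ξ hξ => ?_⟩
      have : ((fun _ => (1 : ℂ)) - ∑ j ∈ Finset.range N,
          fun _ : EuclideanSpace ℝ (Fin n) => if j = 0 then (1 : ℂ) else 0) = fun _ => 0 := by
        funext ξ
        simp [hN]
      rw [this, pderivs_zero]
      simp

theorem one_le_norm_latticePt {k : Fin n → ℤ} (hk : k ≠ 0) : 1 ≤ ‖latticePt k‖ := by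
  obtain ⟨j, hj⟩ := Function.ne_iff.1 hk
  refine le_trans ?_ (PiLp.norm_apply_le (latticePt k) j)
  change (1 : ℝ) ≤ ‖(k j : ℝ)‖
  rw [Real.norm_eq_abs, ← Int.cast_abs]
  exact_mod_cast Int.one_le_abs hj

theorem norm_le_of_apply_le {ξ : EuclideanSpace ℝ (Fin n)} {B : ℝ} (h : ∀ j, |ξ j| ≤ B) :
    ‖ξ‖ ≤ n * B := by
  have h1 : ξ = ∑ j, ξ j • EuclideanSpace.single j (1 : ℝ) := by
    ext i
    simp [Pi.single_apply]
  rw [h1]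
  refine (norm_sum_le _ _).trans ?_
  refine (Finset.sum_le_card_nsmul _ _ B fun j _ => ?_).trans (by simp)
  rw [norm_smul, PiLp.norm_single, norm_one, mul_one]
  exact h j

theorem norm_latticePt_le (k : Fin n → ℤ) : ‖latticePt k‖ ≤ n * wt k :=
  norm_le_of_apply_le fun j => abs_le_wt k j

theorem IsScalarSymbol.exists_le {q : ℂ} {f : EuclideanSpace ℝ (Fin n) → ℂ}
    (hf : IsScalarSymbol q f) : ∃ (C : ℝ) (N : ℕ), ∀ k, ‖f (latticePt k)‖ ≤ C * wt k ^ N := by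
  obtain ⟨-, h, -, he⟩ := hf
  obtain ⟨C, hC⟩ := he 0 []
  obtain ⟨N, hN⟩ := exists_nat_ge q.re
  -- Symbol estimates hold for `1 ≤ ‖ξ‖`, that is at every lattice point but the origin, whose value
  -- enters the constant.
  refine ⟨max (|C| * n ^ N) ‖f (latticePt (0 : Fin n → ℤ))‖, N, fun k => ?_⟩
  have hw := one_le_wt k
  rcases eq_or_ne k 0 with rfl | hk
  · calc _ ≤ max (|C| * n ^ N) ‖f (latticePt (0 : Fin n → ℤ))‖ * 1 := by
          rw [mul_one]; exact le_max_right _ _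
      _ ≤ _ := by gcongr; exact one_le_pow₀ hw
  · have h1 := one_le_norm_latticePt hk
    have h2 := hC _ h1
    simp only [Finset.range_zero, Finset.sum_empty, sub_zero, pderivs, List.foldr_nil,
      Nat.cast_zero, List.length_nil] at h2
    calc _ ≤ C * ‖latticePt k‖ ^ q.re := h2
      _ ≤ |C| * ‖latticePt k‖ ^ (N : ℝ) := by
        gcongr
        · exact le_abs_self C
      _ = |C| * ‖latticePt k‖ ^ N := by rw [Real.rpow_natCast]
      _ ≤ |C| * (n * wt k) ^ N := by gcongr; exact norm_latticePt_le k
      _ = |C| * n ^ N * wt k ^ N := by rw [mul_pow, mul_assoc]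
      _ ≤ _ := by gcongr; exact le_max_left _ _

theorem exists_multiplier (hθ : θ.transpose = -θ) {a : (Fin n → ℤ) → ℂ} {C : ℝ} {N : ℕ}
    (ha : ∀ k, ‖a k‖ ≤ C * wt k ^ N) :
    ∃ P : Module.End ℂ (SmoothTorus θ), ∀ u k, coeff (P u) k = a k * coeff u k := by
  have hr (u : SmoothTorus θ) : RapidDecay fun k => a k * coeff u k := fun M => by
    obtain ⟨D, hD⟩ := rapidDecay_coeff u (M + N)
    have hC : 0 ≤ C := by
      have := (norm_nonneg _).trans (ha 0)
      exact nonneg_of_mul_nonneg_left this (pow_pos (wt_pos _) N)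
    refine ⟨C * D, fun k => ?_⟩
    have := wt_pos k
    rw [norm_mul]
    calc _ ≤ wt k ^ M * (C * wt k ^ N * ‖coeff u k‖) := by gcongr; exact ha k
      _ = C * (wt k ^ (M + N) * ‖coeff u k‖) := by ring
      _ ≤ C * D := by gcongr; exact hD k
  refine ⟨{ toFun := fun u => ofCoeff θ fun k => a k * coeff u k
            map_add' := fun u v => coeff_injective hθ fun k => ?_
            map_smul' := fun c u => coeff_injective hθ fun k => ?_ }, fun u k => coeff_ofCoeff (hr u) k⟩
  · rw [coeff_add, coeff_ofCoeff (hr _), coeff_ofCoeff (hr _), coeff_ofCoeff (hr _), coeff_add, mul_add]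
  · rw [RingHom.id_apply, coeff_smul, coeff_ofCoeff (hr _), coeff_ofCoeff (hr _), coeff_smul,
      mul_left_comm]

/-- Left multiplication by `v` after the multiplier `T` sends `U^k` to `f(k) v U^k`, so its symbol
is `f` times the constant `v`. -/
theorem IsScalarSymbol.exists_psiDO (hθ : θ.transpose = -θ) {q : ℂ}
    {f : EuclideanSpace ℝ (Fin n) → ℂ} (hf : IsScalarSymbol q f) :
    ∃ T : Module.End ℂ (SmoothTorus θ), (∀ u k, coeff (T u) k = f (latticePt k) * coeff u k) ∧
      ∀ v : SmoothTorus θ, LinearMap.mulLeft ℂ v * T ∈ PsiDO θ q := by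
  obtain ⟨C, N, hC⟩ := hf.exists_le
  obtain ⟨T, hT⟩ := exists_multiplier hθ (a := fun k => f (latticePt k)) hC
  refine ⟨T, hT, fun v => ⟨_, hf.smul v, fun u => ?_⟩⟩
  have h1 := (hasSum_fourier hθ (T u)).map (LinearMap.mulLeft ℂ v) (continuous_mulLeft v)
  refine h1.congr_fun fun k => ?_
  simp only [Function.comp, LinearMap.mulLeft_apply, hT]
  rw [smul_mul_assoc, mul_smul_comm, smul_smul, mul_comm]

theorem mulLeft_mem_psiDO (hθ : θ.transpose = -θ) (v : SmoothTorus θ) :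
    LinearMap.mulLeft ℂ v ∈ PsiDO θ 0 := by
  obtain ⟨T, hT, h⟩ := (isScalarSymbol_one (n := n)).exists_psiDO hθ
  have : T = 1 := LinearMap.ext fun u => coeff_injective hθ fun k => by
    rw [hT, one_mul, Module.End.one_apply]
  have h2 := h v
  rwa [this, mul_one] at h2

end NCTorus
end

/-! ### Smoothing operators have symbols of every order -/

noncomputable section
namespace NCTorus
open MeasureTheory Topology Filter
open scoped ContDiff ENNReal
variable {n : ℕ} {θ : Matrix (Fin n) (Fin n) ℝ}
open SmoothTorus

/-- A bump function on `ℝⁿ` equal to `1` at the origin, with support in the ball of radius `1/4`. -/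
def latticeBump (n : ℕ) : ContDiffBump (0 : EuclideanSpace ℝ (Fin n)) where
  rIn := 1 / 8
  rOut := 1 / 4
  rIn_pos := by norm_num
  rIn_lt_rOut := by norm_num

/-- The bump function `latticeBump` with complex values. -/
def cBump (ξ : EuclideanSpace ℝ (Fin n)) : ℂ := latticeBump n ξ

theorem contDiff_cBump : ContDiff ℝ ∞ (cBump (n := n)) :=
  Complex.ofRealCLM.contDiff.comp (latticeBump n).contDiff

theorem cBump_zero : cBump (0 : EuclideanSpace ℝ (Fin n)) = 1 := by
  rw [cBump, (latticeBump n).one_of_mem_closedBall (Metric.mem_closedBall_self (latticeBump n).rIn_pos.le)]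
  simp

theorem cBump_eq_zero {ξ : EuclideanSpace ℝ (Fin n)} (h : 1 / 4 ≤ ‖ξ‖) : cBump ξ = 0 := by
  rw [cBump, (latticeBump n).zero_of_le_dist (by rw [dist_zero_right]; exact h)]
  simp

theorem cBump_eq_zero_of_apply {ξ : EuclideanSpace ℝ (Fin n)} {j : Fin n} (h : 1 / 4 ≤ |ξ j|) :
    cBump ξ = 0 := cBump_eq_zero (h.trans (PiLp.norm_apply_le ξ j))

theorem exists_pderivs_cBump_le (b : List (Fin n)) :
    ∃ C : ℝ, 0 ≤ C ∧ ∀ ξ, ‖pderivs b (cBump (n := n)) ξ‖ ≤ C := by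
  have hc : Continuous (pderivs b (cBump (n := n))) :=
    continuousOn_univ.1 (contDiffOn_pderivs isOpen_univ contDiff_cBump.contDiffOn b).continuousOn
  obtain ⟨C, hC⟩ := (isCompact_closedBall (0 : EuclideanSpace ℝ (Fin n)) (1 / 4)).exists_bound_of_continuousOn
    hc.continuousOn
  have hO : IsOpen {ξ : EuclideanSpace ℝ (Fin n) | 1 / 4 < ‖ξ‖} :=
    isOpen_lt continuous_const continuous_norm
  have h0 : Set.EqOn (cBump (n := n)) (fun _ => 0) {ξ | 1 / 4 < ‖ξ‖} :=
    fun ξ hξ => cBump_eq_zero (le_of_lt hξ)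
  refine ⟨max C 0, le_max_right _ _, fun ξ => ?_⟩
  rcases le_or_gt ‖ξ‖ (1 / 4) with h | h
  · exact (hC ξ (by rwa [mem_closedBall_zero_iff])).trans (le_max_left _ _)
  · rw [pderivs_congr hO h0 b h, pderivs_zero, norm_zero]
    exact le_max_right _ _

/-- The nearest lattice point. -/
def nearest (ξ : EuclideanSpace ℝ (Fin n)) : Fin n → ℤ := fun j => round (ξ j)

theorem nearest_latticePt (k : Fin n → ℤ) : nearest (latticePt k) = k := by
  funext j
  simp [nearest, latticePt]

/-- Interpolation of a family indexed by the lattice by a smooth function. -/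
def interp (r : (Fin n → ℤ) → SmoothTorus θ) (ξ : EuclideanSpace ℝ (Fin n)) : SmoothTorus θ :=
  cBump (ξ - latticePt (nearest ξ)) • r (nearest ξ)

theorem interp_latticePt (r : (Fin n → ℤ) → SmoothTorus θ) (k : Fin n → ℤ) :
    interp r (latticePt k) = r k := by
  rw [interp, nearest_latticePt, sub_self, cBump_zero, one_smul]

/-- The open cube around a lattice point. -/
def cell (k : Fin n → ℤ) : Set (EuclideanSpace ℝ (Fin n)) := {ξ | ∀ j, |ξ j - k j| < 3 / 4}

theorem isOpen_cell (k : Fin n → ℤ) : IsOpen (cell k) := by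
  have : cell k = ⋂ j, {ξ : EuclideanSpace ℝ (Fin n) | |ξ j - k j| < 3 / 4} := by
    ext ξ
    simp [cell]
  rw [this]
  exact isOpen_iInter_of_finite fun j => isOpen_lt (by fun_prop) continuous_const

theorem mem_cell_nearest (ξ : EuclideanSpace ℝ (Fin n)) : ξ ∈ cell (nearest ξ) := fun j => by
  have := abs_sub_round (ξ j)
  simp only [nearest]
  linarith

/-- Rounding jumps, but `interp` is smooth because the cells overlap. If in the cell of `k` another
lattice point is nearest, some coordinate of `ξ` is at least `1 - 1/2` from that of `k` and at least
`1 - 3/4 = 1/4` from that of the nearest point, so both bumps vanish. -/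
theorem interp_eqOn_cell (r : (Fin n → ℤ) → SmoothTorus θ) (k : Fin n → ℤ) :
    Set.EqOn (interp r) (fun ξ => cBump (ξ - latticePt k) • r k) (cell k) := by
  intro ξ hξ
  by_cases h : nearest ξ = k
  · rw [interp, h]
  · obtain ⟨j, hj⟩ := Function.ne_iff.1 h
    have h1 : (1 : ℝ) ≤ |(nearest ξ j : ℝ) - k j| := by
      rw [← Int.cast_sub, ← Int.cast_abs]
      exact_mod_cast Int.one_le_abs (sub_ne_zero.2 hj)
    have h2 := abs_sub_round (ξ j)
    have h3 := hξ j
    have h4 : |(nearest ξ j : ℝ) - k j| ≤ |ξ j - k j| + |ξ j - nearest ξ j| := by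
      have := abs_sub (ξ j - k j) (ξ j - nearest ξ j)
      rwa [sub_sub_sub_cancel_left] at this
    have h2' : |ξ j - nearest ξ j| ≤ 1 / 2 := h2
    have e1 : cBump (ξ - latticePt k) = 0 := cBump_eq_zero_of_apply (j := j) (by
      change 1 / 4 ≤ |ξ j - k j|
      linarith)
    have e2 : cBump (ξ - latticePt (nearest ξ)) = 0 := cBump_eq_zero_of_apply (j := j) (by
      change 1 / 4 ≤ |ξ j - nearest ξ j|
      linarith)
    rw [interp, e2]
    simp only [e1, zero_smul]

theorem RapidFamily.deltas_le (hθ : θ.transpose = -θ) {r : (Fin n → ℤ) → SmoothTorus θ}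
    (hr : RapidFamily r) (a : List (Fin n)) (N : ℕ) :
    ∃ C : ℝ, ∀ l, wt l ^ N * ‖toOp (deltas a (r l))‖ ≤ C := by
  obtain ⟨M, C, hC, h⟩ := lamSeminorm_mono_of_coeff hθ a
  obtain ⟨D, hD⟩ := hr M N
  refine ⟨C * D, fun l => ?_⟩
  have := wt_pos l
  calc _ ≤ wt l ^ N * (C * lamSeminorm θ M (r l)) := by gcongr; exact h _
    _ = C * (wt l ^ N * lamSeminorm θ M (r l)) := by ring
    _ ≤ C * D := by gcongr; exact hD l

theorem norm_le_wt_of_mem_cell {k : Fin n → ℤ} {ξ : EuclideanSpace ℝ (Fin n)} (h : ξ ∈ cell k) :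
    ‖ξ‖ ≤ 2 * n * wt k := by
  refine (norm_le_of_apply_le (B := 2 * wt k) fun j => ?_).trans (le_of_eq (by ring))
  have h1 := h j
  have h2 := abs_le_wt k j
  have h3 := one_le_wt k
  have h4 : |ξ j| ≤ |ξ j - k j| + |(k j : ℝ)| := by
    have := abs_add_le (ξ j - k j) (k j : ℝ)
    rwa [sub_add_cancel] at this
  linarith

/-- All homogeneous terms are zero, whatever `q` is: on the cell of `k` the norm of `ξ` is at most
`2 * n * wt k`, so decay of `r` faster than any power of `wt` beats any power of `‖ξ‖`. -/
theorem RapidFamily.isClassicalSymbol_interp (hθ : θ.transpose = -θ)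
    {r : (Fin n → ℤ) → SmoothTorus θ} (hr : RapidFamily r) (q : ℂ) :
    IsClassicalSymbol q (interp r) := by
  have hcd (k : Fin n → ℤ) : ContDiffOn ℝ ∞ (fun ξ => cBump (ξ - latticePt k)) (cell k) :=
    (contDiff_cBump.comp (contDiff_id.sub contDiff_const)).contDiffOn
  refine ⟨isSmoothOn_of_local fun ξ _ => ⟨cell (nearest ξ), _, _, isOpen_cell _,
    mem_cell_nearest ξ, hcd _, interp_eqOn_cell r _⟩, fun _ _ => 0, fun j => ⟨?_, fun _ _ _ _ => ?_⟩,
    fun N a b => ?_⟩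
  · exact isSmoothOn_of_local fun ξ _ => ⟨Set.univ, fun _ => 0, 0, isOpen_univ, trivial,
      contDiffOn_const, fun _ _ => by simp⟩
  · rw [smul_zero]
  · set p : ℝ := q.re - N - b.length
    obtain ⟨m, hm⟩ := exists_nat_ge (-p)
    obtain ⟨C, hC0, hC⟩ := exists_pderivs_cBump_le b
    obtain ⟨D, hD⟩ := hr.deltas_le hθ a m
    refine ⟨C * D * (2 * n) ^ m, fun ξ hξ => ?_⟩
    set k := nearest ξ
    have hk : ξ ∈ cell k := mem_cell_nearest ξ
    have h0 : interp r - ∑ j ∈ Finset.range N, (fun _ : EuclideanSpace ℝ (Fin n) => (0 : SmoothTorus θ))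
        = interp r := by
      funext ξ
      simp
    rw [h0, pderivs_congr (isOpen_cell k) (interp_eqOn_cell r k) b hk,
      pderivs_smul (isOpen_cell k) (hcd k) _ b hk, pderivs_comp_sub, map_smul, map_smul, norm_smul]
    have hw := wt_pos k
    have hD' : ‖toOp (deltas a (r k))‖ ≤ D / wt k ^ m := by
      rw [le_div_iff₀' (by positivity)]
      exact hD k
    have hD0 : 0 ≤ D := le_trans (mul_nonneg (by positivity) (norm_nonneg _)) (hD k)
    have hξ0 : 0 < ‖ξ‖ := by linarith
    have h1 : ‖ξ‖ ^ (-(m : ℝ)) ≤ ‖ξ‖ ^ p := Real.rpow_le_rpow_of_exponent_le hξ (by linarith)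
    have h2 : (wt k ^ m)⁻¹ ≤ (2 * n) ^ m * ‖ξ‖ ^ (-(m : ℝ)) := by
      rw [Real.rpow_neg hξ0.le, Real.rpow_natCast, ← div_eq_mul_inv, inv_eq_one_div,
        div_le_div_iff₀ (by positivity) (by positivity), one_mul, ← mul_pow]
      gcongr
      exact norm_le_wt_of_mem_cell hk
    calc _ ≤ C * (D / wt k ^ m) := by gcongr; exact hC _
      _ = C * D * (wt k ^ m)⁻¹ := by ring
      _ ≤ C * D * ((2 * n) ^ m * ‖ξ‖ ^ p) := by
        gcongr
        exact h2.trans (by gcongr)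
      _ = _ := by ring

/-- Peetre's inequality. -/
theorem wt_le_mul (k l : Fin n → ℤ) : wt l ≤ 2 * wt k * wt (l + k) := by
  have h1 : ∑ j, (l j : ℝ) ^ 2 ≤ 2 * ∑ j, (k j : ℝ) ^ 2 + 2 * ∑ j, ((l + k) j : ℝ) ^ 2 := by
    rw [Finset.mul_sum, Finset.mul_sum, ← Finset.sum_add_distrib]
    refine Finset.sum_le_sum fun j _ => ?_
    have : (((l + k) j : ℤ) : ℝ) = l j + k j := by simp
    rw [this]
    nlinarith [sq_nonneg ((l j : ℝ) + 2 * k j)]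
  have h2 : 0 ≤ ∑ j, (k j : ℝ) ^ 2 := Finset.sum_nonneg fun j _ => sq_nonneg _
  have h3 : 0 ≤ ∑ j, ((l + k) j : ℝ) ^ 2 := Finset.sum_nonneg fun j _ => sq_nonneg _
  simp only [wt]
  nlinarith [mul_nonneg h2 h3]

theorem norm_coeff_mul_star_monomial (u : SmoothTorus θ) (k l : Fin n → ℤ) :
    ‖coeff (u * star (monomial θ k : SmoothTorus θ)) l‖ = ‖coeff u (l + k)‖ := by
  have hW : IsWeyl θ (-(l + k)) (toOp (star (monomial θ k : SmoothTorus θ)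
      * star (monomial θ l : SmoothTorus θ))) := by
    rw [neg_add_rev]
    exact (isWeyl_monomial k).star.mul (isWeyl_monomial l).star
  obtain ⟨c, hc⟩ := hW.eq_smul (isWeyl_monomial (l + k)).star
  have h : star (monomial θ k : SmoothTorus θ) * star (monomial θ l : SmoothTorus θ)
      = (c : ℂ) • star (monomial θ (l + k) : SmoothTorus θ) :=
    toOp_injective (by rw [hc, map_smul]; rfl)
  have h2 (v : SmoothTorus θ) : tau ((c : ℂ) • v) = c * tau v := by simp [tau, inner_smul_right]
  rw [coeff, coeff, mul_assoc, h, mul_smul_comm, h2, norm_mul, Circle.norm_coe, one_mul]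

/-- Multiplication by `(U^k)^*` shifts coefficients by `k`; by Peetre's inequality this costs a
power of `wt k`, which the rapid decay in `k` absorbs. -/
theorem RapidFamily.mul_star_monomial (hθ : θ.transpose = -θ) {r : (Fin n → ℤ) → SmoothTorus θ}
    (hr : RapidFamily r) : RapidFamily fun k => r k * star (monomial θ k : SmoothTorus θ) := by
  intro M N
  obtain ⟨s, C, hC, h⟩ := exists_lamSeminorm_le hθ M
  obtain ⟨D, hD⟩ := hr s (N + s)
  refine ⟨C * 2 ^ s * D, fun k => ?_⟩
  have hw := wt_pos k
  have h1 := h (r k * star (monomial θ k : SmoothTorus θ)) (2 ^ s * wt k ^ s * lamSeminorm θ s (r k))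
    fun l => by
      have hl := wt_pos l
      rw [norm_coeff_mul_star_monomial]
      calc _ ≤ (2 * wt k * wt (l + k)) ^ s * ‖coeff (r k) (l + k)‖ := by
            gcongr; exact wt_le_mul k l
        _ = 2 ^ s * wt k ^ s * (wt (l + k) ^ s * ‖coeff (r k) (l + k)‖) := by ring
        _ ≤ _ := by gcongr; exact wt_mul_coeff_le _ _ _
  calc _ ≤ wt k ^ N * (C * (2 ^ s * wt k ^ s * lamSeminorm θ s (r k))) := by gcongr
    _ = C * 2 ^ s * (wt k ^ (N + s) * lamSeminorm θ s (r k)) := by ring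
    _ ≤ _ := by gcongr; exact hD k

/-- An operator sees its symbol only at lattice points, where it must equal `R(U^k) (U^k)^*`; any
interpolating symbol will do. -/
theorem smoothing_subset_psiDO (hθ : θ.transpose = -θ) (q : ℂ) : Smoothing θ ⊆ PsiDO θ q := by
  intro R hR
  refine ⟨_, ((rapidFamily_of_smoothing hθ hR).mul_star_monomial hθ).isClassicalSymbol_interp hθ q,
    fun u => ?_⟩
  refine (hasSum_of_smoothing hθ hR u).congr_fun fun k => ?_
  rw [interp_latticePt, mul_assoc, monomial_star_mul, mul_one]

end NCTorus
end

/-! ### Parametric integrals and expansions of homogeneous functions -/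

noncomputable section
namespace NCTorus
open MeasureTheory Topology Filter
open scoped ContDiff ENNReal

section ParametricIntegral

variable {X T Z : Type} [NormedAddCommGroup X] [NormedSpace ℝ X] [FiniteDimensional ℝ X]
  [NormedAddCommGroup T] [NormedSpace ℝ T] [FiniteDimensional ℝ T] [MeasurableSpace T] [BorelSpace T]
  {ν : Measure T} [IsFiniteMeasureOnCompacts ν] {K : Set T} {Ω : Set X} {S : Set (X × T)}

theorem hasFDerivAt_setIntegral [NormedAddCommGroup Z] [NormedSpace ℝ Z] (hK : IsCompact K)
    (hΩ : IsOpen Ω) (hS : IsOpen S) (hsub : Ω ×ˢ K ⊆ S) {G : X × T → Z} (hG : ContDiffOn ℝ ∞ G S)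
    {x₀ : X} (hx₀ : x₀ ∈ Ω) :
    HasFDerivAt (fun x => ∫ t in K, G (x, t) ∂ν)
      (∫ t in K, (fderiv ℝ G (x₀, t)).comp (ContinuousLinearMap.inl ℝ X T) ∂ν) x₀ := by
  have := FiniteDimensional.proper ℝ X
  have := FiniteDimensional.proper ℝ T
  obtain ⟨ε, hε, hεΩ⟩ := Metric.isOpen_iff.1 hΩ x₀ hx₀
  have hcl : Metric.closedBall x₀ (ε / 2) ⊆ Ω :=
    (Metric.closedBall_subset_ball (by linarith)).trans hεΩ
  have hfd : ContinuousOn (fun p => (fderiv ℝ G p).comp (ContinuousLinearMap.inl ℝ X T)) S :=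
    (hG.continuousOn_fderiv_of_isOpen hS (by simp)).clm_comp continuousOn_const
  obtain ⟨C, hC⟩ := ((isCompact_closedBall x₀ (ε / 2)).prod hK).exists_bound_of_continuousOn
    (hfd.mono ((Set.prod_mono hcl subset_rfl).trans hsub))
  have hslice (x : X) (hx : x ∈ Ω) : Set.MapsTo (fun t : T => (x, t)) K S :=
    fun t ht => hsub ⟨hx, ht⟩
  have hcont (x : X) (hx : x ∈ Ω) : ContinuousOn (fun t => G (x, t)) K :=
    hG.continuousOn.comp (by fun_prop) (hslice x hx)
  have hcont' (x : X) (hx : x ∈ Ω) :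
      ContinuousOn (fun t => (fderiv ℝ G (x, t)).comp (ContinuousLinearMap.inl ℝ X T)) K :=
    hfd.comp (f := fun t => (x, t)) (by fun_prop) (hslice x hx)
  have hKm := hK.isClosed.measurableSet
  refine hasFDerivAt_integral_of_dominated_of_fderiv_le (bound := fun _ => C)
    (F' := fun x t => (fderiv ℝ G (x, t)).comp (ContinuousLinearMap.inl ℝ X T))
    (Metric.ball_mem_nhds x₀ (half_pos hε)) ?_ ?_ ?_ ?_ ?_ ?_
  · filter_upwards [hΩ.mem_nhds hx₀] with x hx
    exact (hcont x hx).aestronglyMeasurable hKm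
  · exact (hcont x₀ hx₀).integrableOn_compact hK
  · exact (hcont' x₀ hx₀).aestronglyMeasurable hKm
  · filter_upwards [ae_restrict_mem hKm] with t ht x hx
    exact hC (x, t) ⟨Metric.ball_subset_closedBall hx, ht⟩
  · have : IsFiniteMeasure (ν.restrict K) := ⟨by simpa using hK.measure_lt_top⟩
    exact integrable_const C
  · filter_upwards [ae_restrict_mem hKm] with t ht x hx
    have hxt : (x, t) ∈ S := hsub ⟨hcl (Metric.ball_subset_closedBall hx), ht⟩
    have h1 := ((hG.differentiableOn (by simp)).differentiableAt (hS.mem_nhds hxt)).hasFDerivAt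
    exact h1.comp x (hasFDerivAt_prodMk_left x t)

/-- The derivative is an integral of the same kind with values in a space of linear maps, so the
induction on the order generalises the target `Z`. -/
theorem contDiffOn_setIntegral [NormedAddCommGroup Z] [NormedSpace ℝ Z] (hK : IsCompact K)
    (hΩ : IsOpen Ω) (hS : IsOpen S) (hsub : Ω ×ˢ K ⊆ S) {G : X × T → Z} (hG : ContDiffOn ℝ ∞ G S) :
    ContDiffOn ℝ ∞ (fun x => ∫ t in K, G (x, t) ∂ν) Ω := by
  rw [contDiffOn_infty]
  intro N
  induction N generalizing Z with
  | zero =>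
    refine contDiffOn_zero.2 fun x hx => ?_
    exact (hasFDerivAt_setIntegral hK hΩ hS hsub hG hx).continuousAt.continuousWithinAt
  | succ N ih =>
    push_cast
    rw [contDiffOn_succ_iff_fderiv_of_isOpen hΩ]
    refine ⟨fun x hx => (hasFDerivAt_setIntegral hK hΩ hS hsub hG
      hx).differentiableAt.differentiableWithinAt, by simp, ?_⟩
    have h1 := ih (G := fun p => (fderiv ℝ G p).comp (ContinuousLinearMap.inl ℝ X T))
      ((hG.fderiv_of_isOpen hS (by simp)).clm_comp contDiffOn_const)
    exact h1.congr fun x hx => (hasFDerivAt_setIntegral hK hΩ hS hsub hG hx).fderiv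

end ParametricIntegral

section Homogeneous

variable {E F : Type} [NormedAddCommGroup E] [NormedAddCommGroup F]

/-- The cone `B |ε| < |ω|` in `ℝ × E`. -/
def cone (E : Type) [NormedAddCommGroup E] (B : ℝ) : Set (ℝ × E) := {p | B * |p.1| < ‖p.2‖}

variable {B : ℝ}

theorem isOpen_cone : IsOpen (cone E B) :=
  isOpen_lt (by fun_prop) (by fun_prop)

theorem zero_mem_cone {w : E} (h : w ≠ 0) : ((0 : ℝ), w) ∈ cone E B := by
  change B * |(0 : ℝ)| < ‖w‖
  simpa using h

theorem mul_mem_cone (hB : 0 ≤ B) {p : ℝ × E} (hp : p ∈ cone E B) {s : ℝ} (hs : |s| ≤ 1) :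
    (s * p.1, p.2) ∈ cone E B := by
  change B * |s * p.1| < ‖p.2‖
  refine lt_of_le_of_lt ?_ hp
  rw [abs_mul]
  exact mul_le_mul_of_nonneg_left (mul_le_of_le_one_left (abs_nonneg _) hs) hB

variable [NormedSpace ℝ E] [NormedSpace ℝ F]

theorem smul_mem_cone {p : ℝ × E} (hp : p ∈ cone E B) {t : ℝ} (ht : 0 < t) : t • p ∈ cone E B := by
  change B * |t * p.1| < ‖t • p.2‖
  rw [norm_smul, abs_mul, Real.norm_of_nonneg ht.le, abs_of_pos ht, mul_left_comm]
  exact mul_lt_mul_of_pos_left hp ht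

/-- Smooth functions on the cone `B |ε| < |ω|` that are jointly homogeneous of degree `r`. -/
structure IsHomogeneousOn (B r : ℝ) (K : ℝ × E → F) : Prop where
  smooth : ContDiffOn ℝ ∞ K (cone E B)
  homogeneous : ∀ p ∈ cone E B, ∀ t : ℝ, 0 < t → K (t • p) = t ^ r • K p

variable {r : ℝ} {K : ℝ × E → F}

theorem IsHomogeneousOn.differentiableAt (hK : IsHomogeneousOn B r K) {p : ℝ × E}
    (hp : p ∈ cone E B) : DifferentiableAt ℝ K p :=
  (hK.smooth.differentiableOn (by simp)).differentiableAt (isOpen_cone.mem_nhds hp)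

/-- Differentiate both sides of the homogeneity relation in `p`. -/
theorem IsHomogeneousOn.fderiv_apply (hK : IsHomogeneousOn B r K) (v : ℝ × E) :
    IsHomogeneousOn B (r - 1) fun p => fderiv ℝ K p v := by
  refine ⟨(hK.smooth.fderiv_of_isOpen isOpen_cone (by simp)).clm_apply contDiffOn_const,
    fun p hp t ht => ?_⟩
  have h1 : HasFDerivAt (fun p => K (t • p)) ((fderiv ℝ K (t • p)).comp
      (t • ContinuousLinearMap.id ℝ (ℝ × E))) p :=
    (hK.differentiableAt (smul_mem_cone hp ht)).hasFDerivAt.comp p ((hasFDerivAt_id p).const_smul t)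
  have h2 : HasFDerivAt (fun p => K (t • p)) (t ^ r • fderiv ℝ K p) p := by
    refine ((hK.differentiableAt hp).hasFDerivAt.const_smul (t ^ r)).congr_of_eventuallyEq ?_
    filter_upwards [isOpen_cone.mem_nhds hp] with p hp
    exact hK.homogeneous p hp t ht
  have h3 := DFunLike.congr_fun (h1.unique h2) v
  simp only [ContinuousLinearMap.comp_apply, smul_apply, ContinuousLinearMap.id_apply, map_smul] at h3
  rw [Real.rpow_sub_one ht.ne', div_eq_inv_mul, mul_smul, ← h3, inv_smul_smul₀ ht.ne']

/-- Homogeneity moves `(1, ξ)` to `(1/‖ξ‖, ξ/‖ξ‖)`. For `2 * B ≤ ‖ξ‖` these points fill part of a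
compact subset of the open cone, where `K` is bounded. -/
theorem IsHomogeneousOn.exists_norm_le [FiniteDimensional ℝ E] (hB : 0 < B) (hK : IsHomogeneousOn B r K) :
    ∃ C : ℝ, ∀ ξ : E, 2 * B ≤ ‖ξ‖ → ‖K (1, ξ)‖ ≤ C * ‖ξ‖ ^ r := by
  have := FiniteDimensional.proper ℝ E
  have hc : IsCompact (Set.Icc (0 : ℝ) (1 / (2 * B)) ×ˢ Metric.sphere (0 : E) 1) :=
    isCompact_Icc.prod (isCompact_sphere 0 1)
  obtain ⟨C, hC⟩ := hc.exists_bound_of_continuousOn (hK.smooth.continuousOn.mono (by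
    rintro ⟨ε, w⟩ ⟨hε, hw⟩
    change B * |ε| < ‖w‖
    rw [mem_sphere_zero_iff_norm] at hw
    rw [abs_of_nonneg hε.1, hw]
    calc B * ε ≤ B * (1 / (2 * B)) := by gcongr; exact hε.2
      _ = 1 / 2 := by field_simp
      _ < 1 := by norm_num))
  refine ⟨C, fun ξ hξ => ?_⟩
  have h0 : 0 < ‖ξ‖ := by linarith
  have hmem : ((‖ξ‖⁻¹, ‖ξ‖⁻¹ • ξ) : ℝ × E) ∈
      Set.Icc (0 : ℝ) (1 / (2 * B)) ×ˢ Metric.sphere (0 : E) 1 := by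
    refine ⟨⟨by positivity, ?_⟩, ?_⟩
    · change ‖ξ‖⁻¹ ≤ _
      rw [one_div]
      exact inv_anti₀ (by positivity) hξ
    · rw [mem_sphere_zero_iff_norm, norm_smul, norm_inv, norm_norm, inv_mul_cancel₀ h0.ne']
  have hcone : ((‖ξ‖⁻¹, ‖ξ‖⁻¹ • ξ) : ℝ × E) ∈ cone E B := by
    have h1 : ((1, ξ) : ℝ × E) ∈ cone E B := by
      change B * |(1 : ℝ)| < ‖ξ‖
      rw [abs_one, mul_one]; linarith
    have := smul_mem_cone h1 (inv_pos.2 h0)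
    simpa using this
  have h1 := hK.homogeneous _ hcone ‖ξ‖ h0
  have h2 : ‖ξ‖ • ((‖ξ‖⁻¹, ‖ξ‖⁻¹ • ξ) : ℝ × E) = (1, ξ) := by
    rw [Prod.smul_mk, smul_eq_mul, mul_inv_cancel₀ h0.ne', smul_inv_smul₀ h0.ne']
  rw [h2] at h1
  rw [h1, norm_smul, Real.norm_of_nonneg (by positivity), mul_comm]
  gcongr
  exact hC _ hmem

/-- The difference quotient `(K(ε, ω) - K(0, ω)) / ε`, extended smoothly to `ε = 0`. -/
def hadamardQuot (K : ℝ × E → F) (p : ℝ × E) : F :=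
  ∫ s in Set.Icc (0 : ℝ) 1, fderiv ℝ K (s * p.1, p.2) (1, 0)

/-- Shrinking `ε` to `s ε` with `s ∈ [0, 1]` stays in the cone, so the quotient inherits smoothness
and the degree of the derivative. -/
theorem IsHomogeneousOn.hadamardQuot [FiniteDimensional ℝ E] (hB : 0 ≤ B) (hK : IsHomogeneousOn B r K) :
    IsHomogeneousOn B (r - 1) (hadamardQuot K) := by
  have hκ := hK.fderiv_apply (1, 0)
  refine ⟨?_, fun p hp t ht => ?_⟩
  · let Φ : (ℝ × E) × ℝ → ℝ × E := fun q => (q.2 * q.1.1, q.1.2)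
    have hΦ : ContDiff ℝ ∞ Φ := by fun_prop
    refine contDiffOn_setIntegral (ν := volume) (S := Φ ⁻¹' cone E B)
      (G := fun q => fderiv ℝ K (Φ q) (1, 0)) isCompact_Icc isOpen_cone
      (isOpen_cone.preimage hΦ.continuous) ?_ (hκ.smooth.comp hΦ.contDiffOn fun _ h => h)
    rintro ⟨p, s⟩ ⟨hp, hs⟩
    exact mul_mem_cone hB hp (abs_le.2 ⟨by linarith [hs.1], hs.2⟩)
  · rw [NCTorus.hadamardQuot, NCTorus.hadamardQuot, ← integral_smul]
    refine setIntegral_congr_fun measurableSet_Icc fun s hs => ?_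
    have := hκ.homogeneous (s * p.1, p.2)
      (mul_mem_cone hB hp (abs_le.2 ⟨by linarith [hs.1], hs.2⟩)) t ht
    simp only [Prod.smul_mk, smul_eq_mul] at this
    rw [mul_left_comm] at this
    exact this

theorem IsHomogeneousOn.eq_add_hadamardQuot [CompleteSpace F] (hB : 0 ≤ B)
    (hK : IsHomogeneousOn B r K) {p : ℝ × E} (hp : p ∈ cone E B) :
    K p = K (0, p.2) + p.1 • NCTorus.hadamardQuot K p := by
  have hmem (s : ℝ) (hs : s ∈ Set.Icc (0 : ℝ) 1) : (s * p.1, p.2) ∈ cone E B :=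
    mul_mem_cone hB hp (abs_le.2 ⟨by linarith [hs.1], hs.2⟩)
  have hd (s : ℝ) (hs : s ∈ Set.uIcc (0 : ℝ) 1) : HasDerivAt (fun s : ℝ => K (s * p.1, p.2))
      (p.1 • fderiv ℝ K (s * p.1, p.2) (1, 0)) s := by
    rw [Set.uIcc_of_le zero_le_one] at hs
    have h1 : HasDerivAt (fun s : ℝ => (s * p.1, p.2)) (p.1, (0 : E)) s := by
      have := ((hasDerivAt_id s).mul_const p.1).prodMk (hasDerivAt_const s p.2)
      simpa using this
    have h2 := (hK.differentiableAt (hmem s hs)).hasFDerivAt.comp_hasDerivAt s h1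
    have h3 : ((p.1, (0 : E)) : ℝ × E) = p.1 • (1, 0) := by simp
    rw [h3, map_smul] at h2
    exact h2
  have hcont : ContinuousOn (fun s : ℝ => p.1 • fderiv ℝ K (s * p.1, p.2) (1, 0))
      (Set.uIcc (0 : ℝ) 1) := by
    rw [Set.uIcc_of_le zero_le_one]
    exact continuousOn_const.smul (((hK.fderiv_apply (1, 0)).smooth.continuousOn).comp
      (f := fun s : ℝ => (s * p.1, p.2)) (by fun_prop) hmem)
  have h := intervalIntegral.integral_eq_sub_of_hasDerivAt hd hcont.intervalIntegrable
  rw [intervalIntegral.integral_smul, intervalIntegral.integral_of_le zero_le_one,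
    ← integral_Icc_eq_integral_Ioc] at h
  rw [NCTorus.hadamardQuot, h]
  simp

theorem IsHomogeneousOn.iterate_hadamardQuot [FiniteDimensional ℝ E] (hB : 0 ≤ B) (hK : IsHomogeneousOn B r K) (N : ℕ) :
    IsHomogeneousOn B (r - N) (NCTorus.hadamardQuot^[N] K) := by
  induction N with
  | zero => simpa using hK
  | succ N ih =>
    rw [Function.iterate_succ_apply']
    have := ih.hadamardQuot hB
    rwa [sub_sub, ← Nat.cast_succ] at this

/-- Taylor's formula in `ε` at `ε = 1`. Its `j`-th term has degree `r - j` in `ξ`, and its remainder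
is jointly homogeneous of degree `r - N`, so it has the right size for large `ξ`. -/
theorem IsHomogeneousOn.expansion [FiniteDimensional ℝ E] [CompleteSpace F] (hB : 0 ≤ B) (hK : IsHomogeneousOn B r K)
    {ξ : E} (hξ : B < ‖ξ‖) (N : ℕ) : K (1, ξ) =
      ∑ j ∈ Finset.range N, NCTorus.hadamardQuot^[j] K (0, ξ) + NCTorus.hadamardQuot^[N] K (1, ξ) := by
  have hmem : ((1, ξ) : ℝ × E) ∈ cone E B := by
    change B * |(1 : ℝ)| < ‖ξ‖
    rwa [abs_one, mul_one]
  induction N with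
  | zero => simp
  | succ N ih =>
    have h := (hK.iterate_hadamardQuot hB N).eq_add_hadamardQuot hB hmem
    rw [one_smul, ← Function.iterate_succ_apply' NCTorus.hadamardQuot] at h
    rw [ih, Finset.sum_range_succ, add_assoc, ← h]

end Homogeneous

section Symbol

variable {n : ℕ} {B r : ℝ} {F : Type} [NormedAddCommGroup F] [NormedSpace ℝ F]

theorem IsHomogeneousOn.exists_pderivs {K : ℝ × EuclideanSpace ℝ (Fin n) → F}
    (hK : IsHomogeneousOn B r K) (b : List (Fin n)) :
    ∃ Kb : ℝ × EuclideanSpace ℝ (Fin n) → F, IsHomogeneousOn B (r - b.length) Kb ∧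
      Set.EqOn (pderivs b fun ξ => K (1, ξ)) (fun ξ => Kb (1, ξ)) {ξ | B < ‖ξ‖} := by
  have hO : IsOpen {ξ : EuclideanSpace ℝ (Fin n) | B < ‖ξ‖} := isOpen_lt continuous_const continuous_norm
  induction b with
  | nil => exact ⟨K, by simpa using hK, fun _ _ => rfl⟩
  | cons j b ih =>
    obtain ⟨Kb, hKb, h⟩ := ih
    refine ⟨fun p => fderiv ℝ Kb p (0, EuclideanSpace.single j 1), ?_, fun ξ hξ => ?_⟩
    · have := hKb.fderiv_apply (0, EuclideanSpace.single j 1)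
      rwa [sub_sub, ← Nat.cast_succ] at this
    · change pderiv j (pderivs b fun ξ => K (1, ξ)) ξ = _
      rw [pderiv_congr (h.eventuallyEq_of_mem (hO.mem_nhds hξ))]
      have hmem : ((1, ξ) : ℝ × EuclideanSpace ℝ (Fin n)) ∈ cone _ B := by
        change B * |(1 : ℝ)| < ‖ξ‖
        rw [abs_one, mul_one]
        exact hξ
      have h1 := (hKb.differentiableAt hmem).hasFDerivAt.comp ξ (hasFDerivAt_prodMk_right (1 : ℝ) ξ)
      have h2 := pderiv_eq_fderiv h1.differentiableAt j
      rw [h1.fderiv] at h2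
      exact h2

/-- The homogeneous terms are the Taylor coefficients of `H` in `ε`. For large `ξ` each derivative
of the remainder is again homogeneous and is bounded by `exists_norm_le`; the shell that is left is
compact. -/
theorem isScalarSymbol_of_isHomogeneousOn (hB : 0 < B) {f : EuclideanSpace ℝ (Fin n) → ℂ}
    (hf : ContDiff ℝ ∞ f) {H : ℝ × EuclideanSpace ℝ (Fin n) → ℂ} (hH : IsHomogeneousOn B r H)
    {A : ℝ} (hfH : ∀ ξ, A < ‖ξ‖ → f ξ = H (1, ξ)) : IsScalarSymbol (r : ℂ) f := by
  set h : ℕ → EuclideanSpace ℝ (Fin n) → ℂ := fun j ξ => hadamardQuot^[j] H (0, ξ) with hh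
  have hsm (j : ℕ) : ContDiffOn ℝ ∞ (h j) {0}ᶜ :=
    (hH.iterate_hadamardQuot hB.le j).smooth.comp (contDiff_prodMk_right (0 : ℝ)).contDiffOn
      fun ξ hξ => zero_mem_cone hξ
  refine ⟨hf, h, fun j => ⟨hsm j, fun ξ hξ t ht => ?_⟩, fun N b => ?_⟩
  · have := (hH.iterate_hadamardQuot hB.le j).homogeneous (0, ξ) (zero_mem_cone hξ) t ht
    rw [Prod.smul_mk, smul_zero] at this
    rw [hh]
    beta_reduce
    rw [this, Complex.real_smul, Complex.ofReal_cpow ht.le]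
    push_cast
    rfl
  · set p : ℝ := (r : ℂ).re - N - b.length with hp
    -- Beyond `D` both the homogeneous bound and the identity `f ξ = H (1, ξ)` near `ξ` are
    -- available.
    set D := max (2 * B) (A + 1) with hD
    have hgs : ContDiffOn ℝ ∞ (f - ∑ j ∈ Finset.range N, h j) {0}ᶜ := by
      have : f - ∑ j ∈ Finset.range N, h j = fun ξ => f ξ - ∑ j ∈ Finset.range N, h j ξ := by
        funext ξ
        simp
      rw [this]
      exact hf.contDiffOn.sub (ContDiffOn.sum fun j _ => hsm j)
    obtain ⟨Kb, hKb, hKbe⟩ := (hH.iterate_hadamardQuot hB.le N).exists_pderivs b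
    obtain ⟨C₁, hC₁⟩ := hKb.exists_norm_le hB
    have hO : IsOpen {ξ : EuclideanSpace ℝ (Fin n) | max B A < ‖ξ‖} :=
      isOpen_lt continuous_const continuous_norm
    have heq : Set.EqOn (f - ∑ j ∈ Finset.range N, h j)
        (fun ξ => hadamardQuot^[N] H (1, ξ)) {ξ | max B A < ‖ξ‖} := fun ξ hξ => by
      rw [Pi.sub_apply, hfH ξ ((le_max_right _ _).trans_lt hξ),
        hH.expansion hB.le ((le_max_left _ _).trans_lt hξ) N, Finset.sum_apply]
      simp [hh]
    have hcpt : IsCompact {ξ : EuclideanSpace ℝ (Fin n) | 1 ≤ ‖ξ‖ ∧ ‖ξ‖ ≤ D} := by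
      refine (isCompact_closedBall (0 : EuclideanSpace ℝ (Fin n)) D).of_isClosed_subset ?_ ?_
      · exact (isClosed_le continuous_const continuous_norm).inter
          (isClosed_le continuous_norm continuous_const)
      · exact fun ξ hξ => mem_closedBall_zero_iff.2 hξ.2
    have hc : ContinuousOn (fun ξ => ‖pderivs b (f - ∑ j ∈ Finset.range N, h j) ξ‖ * ‖ξ‖ ^ (-p))
        {ξ | 1 ≤ ‖ξ‖ ∧ ‖ξ‖ ≤ D} := by
      refine ContinuousOn.mul ?_ ?_
      · refine ((contDiffOn_pderivs isOpen_compl_singleton hgs b).continuousOn.mono ?_).norm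
        rintro ξ ⟨h1, -⟩ rfl
        rw [norm_zero] at h1
        linarith
      · refine continuous_norm.continuousOn.rpow_const fun ξ hξ => Or.inl ?_
        linarith [hξ.1]
    obtain ⟨C₂, hC₂⟩ := hcpt.exists_bound_of_continuousOn hc
    refine ⟨max C₁ C₂, fun ξ hξ => ?_⟩
    have h0 : 0 < ‖ξ‖ := by linarith
    rcases le_or_gt ‖ξ‖ D with hξD | hξD
    · have h1 := (le_abs_self _).trans (hC₂ ξ ⟨hξ, hξD⟩)
      rw [Real.rpow_neg h0.le, ← div_eq_mul_inv, div_le_iff₀ (by positivity)] at h1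
      refine h1.trans ?_
      gcongr
      exact le_max_right _ _
    · have h2B : 2 * B ≤ ‖ξ‖ := (le_max_left _ _).trans hξD.le
      have hA : A + 1 < ‖ξ‖ := (le_max_right _ _).trans_lt hξD
      have hm : max B A < ‖ξ‖ := max_lt (by linarith) (by linarith)
      rw [pderivs_congr hO heq b hm, hKbe ((le_max_left _ _).trans_lt hm)]
      have h1 := hC₁ ξ h2B
      refine h1.trans ?_
      rw [hp, Complex.ofReal_re]
      gcongr
      exact le_max_left _ _

end Symbol
end NCTorus
end

/-! ### The radial field and its flux through lattice faces -/

noncomputable section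
namespace NCTorus
open MeasureTheory Topology Filter
open scoped ContDiff ENNReal

section RadialField

/-- A smooth function on `ℝ`, equal to `s ^ r` for `s ≥ 1` and to `0` for `s ≤ 1 / 2`. -/
def cutoffRpow (r s : ℝ) : ℝ := Real.smoothTransition (2 * s - 1) * s ^ r

variable {r s : ℝ}

theorem cutoffRpow_of_one_le (hs : 1 ≤ s) : cutoffRpow r s = s ^ r := by
  rw [cutoffRpow, Real.smoothTransition.one_of_one_le (by linarith), one_mul]

theorem cutoffRpow_eventuallyEq_zero (hs : s < 1 / 2) : cutoffRpow r =ᶠ[𝓝 s] 0 := by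
  filter_upwards [gt_mem_nhds hs] with t ht
  rw [cutoffRpow, Real.smoothTransition.zero_of_nonpos (by linarith), zero_mul, Pi.zero_apply]

theorem contDiff_cutoffRpow : ContDiff ℝ ∞ (cutoffRpow r) := by
  rw [contDiff_iff_contDiffAt]
  intro s
  rcases lt_or_ge s (1 / 2) with hs | hs
  · exact contDiffAt_const.congr_of_eventuallyEq (cutoffRpow_eventuallyEq_zero hs)
  · refine ContDiffAt.mul ?_ (contDiffAt_id.rpow_const_of_ne (by simp only [id]; linarith))
    exact (Real.smoothTransition.contDiff.comp
      (g := Real.smoothTransition) (by fun_prop : ContDiff ℝ ∞ fun s : ℝ => 2 * s - 1)).contDiffAt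

/-- The divergence of `ξ ↦ φ(|ξ|²) ξ` as a function of `|ξ|²`, for `φ = cutoffRpow r`. -/
def radialDiv (r s : ℝ) : ℝ := 2 * s * deriv (cutoffRpow r) s - 2 * r * cutoffRpow r s

theorem continuous_radialDiv : Continuous (radialDiv r) := by
  have h1 := (contDiff_cutoffRpow (r := r)).continuous_deriv (by simp)
  have h2 := (contDiff_cutoffRpow (r := r)).continuous
  unfold radialDiv
  fun_prop

/-- The derivative of `s ^ r` cancels against the second term of `radialDiv`, which expresses that
`ξ |ξ|^{-n}` is divergence free. Only the derivative of the cutoff remains, and it is nonnegative.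
-/
theorem radialDiv_of_pos (hs : 0 < s) : radialDiv r s =
    2 * s * (deriv (fun s => Real.smoothTransition (2 * s - 1)) s * s ^ r) := by
  have hd : DifferentiableAt ℝ (fun s : ℝ => Real.smoothTransition (2 * s - 1)) s :=
    ((Real.smoothTransition.contDiff (n := 1)).differentiable (by simp)).differentiableAt.comp s
      (by fun_prop)
  have h := (hd.hasDerivAt.mul (Real.hasDerivAt_rpow_const (p := r) (Or.inl hs.ne'))).deriv
  have h2 : deriv (cutoffRpow r) s = _ := h
  rw [radialDiv, h2, cutoffRpow, Real.rpow_sub_one hs.ne']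
  field_simp
  ring

theorem radialDiv_nonneg : 0 ≤ radialDiv r s := by
  rcases lt_or_ge s (1 / 2) with hs | hs
  · have h := cutoffRpow_eventuallyEq_zero (r := r) hs
    rw [radialDiv, h.deriv_eq, h.eq_of_nhds]
    simp
  · have hs0 : 0 < s := by linarith
    rw [radialDiv_of_pos hs0]
    have hm : Monotone fun s : ℝ => Real.smoothTransition (2 * s - 1) :=
      fun a b hab => Real.smoothTransition.monotone (by linarith)
    have := hm.deriv_nonneg (x := s)
    positivity

theorem radialDiv_of_one_lt (hs : 1 < s) : radialDiv r s = 0 := by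
  rw [radialDiv_of_pos (by linarith)]
  have h : (fun s : ℝ => Real.smoothTransition (2 * s - 1)) =ᶠ[𝓝 s] fun _ => 1 := by
    filter_upwards [lt_mem_nhds hs] with t ht
    exact Real.smoothTransition.one_of_one_le (by linarith)
  rw [h.deriv_eq, deriv_const]
  ring

/-- The mean value theorem: the cutoff climbs from `0` to `1` on `[1/2, 1]`. -/
theorem exists_radialDiv_pos : ∃ s, 0 < s ∧ s < 1 ∧ 0 < radialDiv r s := by
  have hc : Differentiable ℝ fun s : ℝ => Real.smoothTransition (2 * s - 1) :=
    ((Real.smoothTransition.contDiff (n := 1)).differentiable (by simp)).comp (by fun_prop)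
  obtain ⟨s, ⟨h0, h1⟩, hs⟩ := exists_deriv_eq_slope (fun s : ℝ => Real.smoothTransition (2 * s - 1))
    (a := 1 / 2) (b := 1) (by norm_num) hc.continuous.continuousOn hc.differentiableOn
  have hs0 : 0 < s := by linarith
  refine ⟨s, hs0, h1, ?_⟩
  rw [radialDiv_of_pos hs0, hs, Real.smoothTransition.one_of_one_le (by norm_num),
    Real.smoothTransition.zero_of_nonpos (by norm_num)]
  positivity

variable {n : ℕ}

theorem contDiff_norm_sq_euclidean :
    ContDiff ℝ ∞ fun ξ : EuclideanSpace ℝ (Fin n) => ‖ξ‖ ^ 2 := contDiff_norm_sq ℝ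

/-- The component `φ(|ξ|²) ξ_j` of the radial vector field, for `φ = cutoffRpow r`. -/
def radialField (r : ℝ) (j : Fin n) (ξ : EuclideanSpace ℝ (Fin n)) : ℝ :=
  cutoffRpow r (‖ξ‖ ^ 2) * ξ j

theorem contDiff_radialField (j : Fin n) : ContDiff ℝ ∞ (radialField r j) :=
  (contDiff_cutoffRpow.comp contDiff_norm_sq_euclidean).mul
    (EuclideanSpace.proj (𝕜 := ℝ) j).contDiff

theorem fderiv_radialField (j : Fin n) (ξ : EuclideanSpace ℝ (Fin n)) :
    fderiv ℝ (radialField r j) ξ (EuclideanSpace.single j 1) =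
      2 * deriv (cutoffRpow r) (‖ξ‖ ^ 2) * ξ j ^ 2 + cutoffRpow r (‖ξ‖ ^ 2) := by
  have h1 : HasDerivAt (cutoffRpow r) (deriv (cutoffRpow r) (‖ξ‖ ^ 2)) (‖ξ‖ ^ 2) :=
    (contDiff_cutoffRpow.differentiable (by simp)).differentiableAt.hasDerivAt
  have h2 := (h1.comp_hasFDerivAt ξ (hasStrictFDerivAt_norm_sq ξ).hasFDerivAt).mul
    (EuclideanSpace.proj (𝕜 := ℝ) j).hasFDerivAt
  have h3 : fderiv ℝ (radialField r j) ξ = _ := h2.fderiv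
  rw [h3]
  simp [EuclideanSpace.inner_single_right]
  ring

theorem sum_fderiv_radialField (hr : 2 * r = -n) (ξ : EuclideanSpace ℝ (Fin n)) :
    ∑ j, fderiv ℝ (radialField r j) ξ (EuclideanSpace.single j 1) = radialDiv r (‖ξ‖ ^ 2) := by
  simp only [fderiv_radialField, Finset.sum_add_distrib, ← Finset.mul_sum, Finset.sum_const,
    Finset.card_univ, Fintype.card_fin, nsmul_eq_mul]
  have : ∑ j, ξ j ^ 2 = ‖ξ‖ ^ 2 := by
    rw [EuclideanSpace.norm_sq_eq]
    simp
  rw [this, radialDiv, hr]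
  ring

variable {m : ℕ}

/-- The inclusion of `ℝᵐ` in `ℝᵐ⁺¹` as the hyperplane `ξ_j = 0`. -/
def faceVec (j : Fin (m + 1)) (t : Fin m → ℝ) : EuclideanSpace ℝ (Fin (m + 1)) :=
  WithLp.toLp 2 (j.insertNth (α := fun _ => ℝ) 0 t)

theorem contDiff_faceVec (j : Fin (m + 1)) : ContDiff ℝ ∞ (faceVec j) := by
  rw [contDiff_euclidean]
  intro i
  induction i using Fin.succAboveCases j with
  | x => simpa [faceVec] using contDiff_const
  | p i => simpa [faceVec] using contDiff_apply ℝ ℝ i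

theorem norm_faceVec_le (j : Fin (m + 1)) {t : Fin m → ℝ} (ht : t ∈ Set.Icc 0 1) :
    ‖faceVec j t‖ ≤ (m + 1 : ℕ) := by
  have := norm_le_of_apply_le (ξ := faceVec j t) (B := 1) fun i => by
    induction i using Fin.succAboveCases j with
    | x => simp [faceVec]
    | p i => simpa [faceVec] using abs_le.2 ⟨neg_one_lt_zero.le.trans (ht.1 i), ht.2 i⟩
  simpa using this

/-- The flux of the radial field through the face of a unit cube with corner `ξ` that is orthogonal to
the `j`-th axis. -/
def faceFlux (j : Fin (m + 1)) (ξ : EuclideanSpace ℝ (Fin (m + 1))) : ℂ :=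
  ∫ t in Set.Icc (0 : Fin m → ℝ) 1, (radialField (-((m : ℝ) + 1) / 2) j (ξ + faceVec j t) : ℂ)

theorem contDiff_faceFlux (j : Fin (m + 1)) : ContDiff ℝ ∞ (faceFlux j) := by
  rw [← contDiffOn_univ]
  have h1 : ContDiff ℝ ∞ fun p : EuclideanSpace ℝ (Fin (m + 1)) × (Fin m → ℝ) =>
      p.1 + faceVec j p.2 := contDiff_fst.add ((contDiff_faceVec j).comp contDiff_snd)
  exact contDiffOn_setIntegral (ν := volume) isCompact_Icc isOpen_univ isOpen_univ
    (Set.subset_univ _)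
    (G := fun p => (radialField (-((m : ℝ) + 1) / 2) j (p.1 + faceVec j p.2) : ℂ))
    (Complex.ofRealCLM.contDiff.comp ((contDiff_radialField j).comp h1)).contDiffOn

/-- Replace the face `ξ + v` by `ξ + ε v` and the cut-off field by the exact one, of degree `2 * r +
1 = -m`. The integral is then jointly homogeneous in `(ε, ξ)`, and smooth on the cone where the face
avoids the origin. -/
theorem isScalarSymbol_faceFlux (j : Fin (m + 1)) :
    IsScalarSymbol (((-m : ℝ) : ℂ)) (faceFlux j) := by
  set r : ℝ := -((m : ℝ) + 1) / 2 with hr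
  set g : EuclideanSpace ℝ (Fin (m + 1)) → ℂ := fun w => (((‖w‖ ^ 2) ^ r * w j : ℝ) : ℂ) with hg
  have hgs : ContDiffOn ℝ ∞ g {0}ᶜ := by
    refine Complex.ofRealCLM.contDiff.comp_contDiffOn (ContDiffOn.mul ?_
      (EuclideanSpace.proj (𝕜 := ℝ) j).contDiff.contDiffOn)
    refine contDiff_norm_sq_euclidean.contDiffOn.rpow_const_of_ne fun w hw => ?_
    have : w ≠ 0 := hw
    positivity
  have hgh (w : EuclideanSpace ℝ (Fin (m + 1))) (t : ℝ) (ht : 0 < t) :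
      g (t • w) = t ^ (-m : ℝ) • g w := by
    rw [hg]
    change (((‖t • w‖ ^ 2) ^ r * (t • w) j : ℝ) : ℂ) = t ^ (-m : ℝ) • (((‖w‖ ^ 2) ^ r * w j : ℝ) : ℂ)
    rw [← Complex.coe_smul, smul_eq_mul, ← Complex.ofReal_mul, norm_smul, Real.norm_of_nonneg ht.le,
      mul_pow, Real.mul_rpow (by positivity) (by positivity), ← Real.rpow_natCast t 2,
      ← Real.rpow_mul ht.le, PiLp.smul_apply, smul_eq_mul]
    have : t ^ (-m : ℝ) = t ^ (((2 : ℕ) : ℝ) * r) * t := by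
      rw [← Real.rpow_add_one ht.ne']
      congr 1
      rw [hr]; push_cast; ring
    rw [this]
    congr 1
    ring
  let Φ : (ℝ × EuclideanSpace ℝ (Fin (m + 1))) × (Fin m → ℝ) → EuclideanSpace ℝ (Fin (m + 1)) :=
    fun q => q.1.2 + q.1.1 • faceVec j q.2
  have hΦ : ContDiff ℝ ∞ Φ := by
    have := (contDiff_faceVec j).comp (contDiff_snd (𝕜 := ℝ) (n := ∞)
      (E := ℝ × EuclideanSpace ℝ (Fin (m + 1))) (F := Fin m → ℝ))
    exact (contDiff_snd.comp contDiff_fst).add ((contDiff_fst.comp contDiff_fst).smul this)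
  have hne (p : ℝ × EuclideanSpace ℝ (Fin (m + 1))) (hp : p ∈ cone _ ((m + 1 : ℕ) : ℝ))
      (t : Fin m → ℝ) (ht : t ∈ Set.Icc 0 1) : p.2 + p.1 • faceVec j t ≠ 0 := by
    intro h
    have h1 : ‖p.2‖ = |p.1| * ‖faceVec j t‖ := by
      rw [eq_neg_of_add_eq_zero_left h, norm_neg, norm_smul, Real.norm_eq_abs]
    have h2 : ((m + 1 : ℕ) : ℝ) * |p.1| < ‖p.2‖ := hp
    rw [h1, mul_comm] at h2
    exact absurd (mul_le_mul_of_nonneg_left (norm_faceVec_le j ht) (abs_nonneg p.1)) (not_le.2 h2)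
  -- Face vectors have norm at most `m + 1`, which is `B`. One more unit in `A` keeps the whole face
  -- outside the unit ball, where the cutoff is inactive.
  refine isScalarSymbol_of_isHomogeneousOn (B := (m + 1 : ℕ)) (A := (m + 1 : ℕ) + 1) (r := -m)
    (H := fun p => ∫ t in Set.Icc (0 : Fin m → ℝ) 1, g (p.2 + p.1 • faceVec j t))
    (by positivity) (contDiff_faceFlux j) ⟨?_, fun p _ t ht => ?_⟩ fun ξ hξ => ?_
  · exact contDiffOn_setIntegral (ν := volume) (S := Φ ⁻¹' {0}ᶜ) (G := fun q => g (Φ q))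
      isCompact_Icc isOpen_cone (isOpen_compl_singleton.preimage hΦ.continuous)
      (fun q hq => hne q.1 hq.1 q.2 hq.2) (hgs.comp hΦ.contDiffOn fun _ h => h)
  · rw [← integral_smul]
    refine setIntegral_congr_fun measurableSet_Icc fun x _ => ?_
    change g (t • p.2 + (t • p.1) • faceVec j x) = _
    rw [smul_assoc, ← smul_add, hgh _ t ht]
  · refine setIntegral_congr_fun measurableSet_Icc fun t ht => ?_
    have h1 : 1 ≤ ‖ξ + faceVec j t‖ := by
      have := norm_sub_le (ξ + faceVec j t) (faceVec j t)
      rw [add_sub_cancel_right] at this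
      linarith [norm_faceVec_le j ht]
    simp only [one_smul, hg]
    rw [radialField, cutoffRpow_of_one_le (one_le_pow₀ h1)]

/-- The divergence theorem on the unit cube with corner `k`: its far face in direction `j` is the
near face of the cube at `k + e_j`. -/
theorem sum_faceFlux_sub (k : Fin (m + 1) → ℤ) :
    ∑ j, (faceFlux j (latticePt (k + Pi.single j 1)) - faceFlux j (latticePt k)) =
      ((∫ x in Set.Icc (0 : Fin (m + 1) → ℝ) 1,
        radialDiv (-((m : ℝ) + 1) / 2) (‖latticePt k + WithLp.toLp 2 x‖ ^ 2) : ℝ) : ℂ) := by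
  set r : ℝ := -((m : ℝ) + 1) / 2 with hr
  let L : (Fin (m + 1) → ℝ) →L[ℝ] EuclideanSpace ℝ (Fin (m + 1)) :=
    ((EuclideanSpace.equiv (Fin (m + 1)) ℝ).symm : _ →L[ℝ] _)
  have hsum (x : Fin (m + 1) → ℝ) : ∑ i, ((fderiv ℝ (radialField r i) (latticePt k + L x)).comp L)
      (Pi.single i 1) = radialDiv r (‖latticePt k + WithLp.toLp 2 x‖ ^ 2) :=
    sum_fderiv_radialField (by rw [hr]; push_cast; ring) (latticePt k + WithLp.toLp 2 x)
  have hcont : Continuous fun x : Fin (m + 1) → ℝ =>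
      radialDiv r (‖latticePt k + WithLp.toLp 2 x‖ ^ 2) :=
    continuous_radialDiv.comp ((continuous_const.add L.continuous).norm.pow 2)
  have h := integral_divergence_of_hasFDerivAt_off_countable' (0 : Fin (m + 1) → ℝ) 1 zero_le_one
    (fun i x => radialField r i (latticePt k + L x))
    (fun i x => (fderiv ℝ (radialField r i) (latticePt k + L x)).comp L) ∅ Set.countable_empty
    (fun i => ((contDiff_radialField i).continuous.comp
      (continuous_const.add L.continuous)).continuousOn)
    (fun x _ i => (((contDiff_radialField i).differentiable
      (by simp)).differentiableAt.hasFDerivAt.comp x (L.hasFDerivAt.const_add (latticePt k))))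
    (by simp only [hsum]; exact hcont.continuousOn.integrableOn_compact isCompact_Icc)
  simp only [hsum] at h
  rw [h, Complex.ofReal_sum]
  refine Finset.sum_congr rfl fun j _ => ?_
  rw [Complex.ofReal_sub, faceFlux, faceFlux, integral_complex_ofReal, integral_complex_ofReal]
  have h1 (t : Fin m → ℝ) : latticePt (k + Pi.single j 1) + faceVec j t =
      latticePt k + L (j.insertNth (α := fun _ => ℝ) ((1 : Fin (m + 1) → ℝ) j) t) := by
    ext i
    change ((k + Pi.single j 1 : Fin (m + 1) → ℤ) i : ℝ) + j.insertNth (α := fun _ => ℝ) 0 t i =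
      (k i : ℝ) + j.insertNth (α := fun _ => ℝ) ((1 : Fin (m + 1) → ℝ) j) t i
    induction i using Fin.succAboveCases j with
    | x => simp
    | p i => simp
  simp only [h1]
  rfl

theorem exists_isScalarSymbol_divergence {n : ℕ} (hn : 0 < n) :
    ∃ f : Fin n → EuclideanSpace ℝ (Fin n) → ℂ, (∀ j, IsScalarSymbol (-(n : ℂ) + 1) (f j)) ∧
      ∃ (s : Finset (Fin n → ℤ)) (c : (Fin n → ℤ) → ℂ),
        (∀ k, ∑ j, (f j (latticePt (k + Pi.single j 1)) - f j (latticePt k)) = c k) ∧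
        (∀ k ∉ s, c k = 0) ∧ ∑ k ∈ s, c k ≠ 0 := by
  obtain ⟨m, rfl⟩ := Nat.exists_eq_add_of_lt hn
  rw [zero_add]
  set r : ℝ := -((m : ℝ) + 1) / 2 with hr
  let d (k : Fin (m + 1) → ℤ) : ℝ := ∫ x in Set.Icc (0 : Fin (m + 1) → ℝ) 1,
    radialDiv r (‖latticePt k + WithLp.toLp 2 x‖ ^ 2)
  have hd (k) : 0 ≤ d k := integral_nonneg fun x => radialDiv_nonneg
  have hcont : Continuous fun x : Fin (m + 1) → ℝ =>
      radialDiv r (‖latticePt 0 + WithLp.toLp 2 x‖ ^ 2) :=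
    continuous_radialDiv.comp ((continuous_const.add (PiLp.continuous_toLp 2 _)).norm.pow 2)
  have hpos : 0 < d 0 := by
    obtain ⟨s, hs0, hs1, hs⟩ := exists_radialDiv_pos (r := r)
    rw [setIntegral_pos_iff_support_of_nonneg_ae (ae_of_all _ fun x => radialDiv_nonneg)
      (hcont.continuousOn.integrableOn_compact isCompact_Icc)]
    have hO : IsOpen ((Function.support fun x : Fin (m + 1) → ℝ =>
        radialDiv r (‖latticePt 0 + WithLp.toLp 2 x‖ ^ 2)) ∩
        Set.univ.pi fun _ => Set.Ioo (0 : ℝ) 1) :=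
      hcont.isOpen_support.inter (isOpen_set_pi Set.finite_univ fun _ _ => isOpen_Ioo)
    -- A point on the diagonal of the open unit cube whose squared norm is `s`, where the divergence
    -- is positive.
    refine (hO.measure_pos volume ⟨fun _ => √(s / (m + 1)), ?_, fun i _ => ⟨by positivity, ?_⟩⟩).trans_le
      (measure_mono (Set.inter_subset_inter_right _ fun x hx =>
        ⟨fun i => (hx i trivial).1.le, fun i => (hx i trivial).2.le⟩))
    · have : ‖latticePt 0 + WithLp.toLp 2 fun _ : Fin (m + 1) => √(s / (m + 1))‖ ^ 2 = s := by
        rw [EuclideanSpace.norm_sq_eq]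
        simp [latticePt, Real.sq_sqrt (show 0 ≤ s / (m + 1) by positivity)]
        field_simp
      rw [Function.mem_support, this]
      exact hs.ne'
    · rw [Real.sqrt_lt' one_pos, one_pow, div_lt_one (by positivity)]
      have : (0 : ℝ) ≤ m := by positivity
      linarith
  -- Outside this generous box some coordinate exceeds `1` in modulus on the whole cube, so the cube
  -- misses the unit ball.
  have hzero (k : Fin (m + 1) → ℤ) (hk : k ∉ Finset.Icc (fun _ => (-2 : ℤ)) fun _ => 2) : d k = 0 := by
    refine setIntegral_eq_zero_of_forall_eq_zero fun x hx => radialDiv_of_one_lt ?_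
    rw [Finset.mem_Icc, not_and_or, Pi.le_def, Pi.le_def, not_forall, not_forall] at hk
    suffices ∃ i, 1 < |(k i : ℝ) + x i| by
      obtain ⟨i, hi⟩ := this
      refine one_lt_pow₀ (hi.trans_le ?_) two_ne_zero
      exact PiLp.norm_apply_le (latticePt k + WithLp.toLp 2 x) i
    rcases hk with ⟨i, hi⟩ | ⟨i, hi⟩
    · refine ⟨i, lt_abs.2 (Or.inr ?_)⟩
      have h1 : (k i : ℝ) ≤ -3 := by exact_mod_cast (show k i ≤ -3 by omega)
      have h2 : x i ≤ 1 := hx.2 i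
      linarith
    · refine ⟨i, lt_abs.2 (Or.inl ?_)⟩
      have h1 : (3 : ℝ) ≤ k i := by exact_mod_cast (show 3 ≤ k i by omega)
      have h2 : 0 ≤ x i := hx.1 i
      linarith
  refine ⟨faceFlux, fun j => ?_, Finset.Icc (fun _ => -2) fun _ => 2, fun k => (d k : ℂ),
    sum_faceFlux_sub, fun k hk => Complex.ofReal_eq_zero.2 (hzero k hk), ?_⟩
  · have := isScalarSymbol_faceFlux j
    convert this using 1
    push_cast
    ring
  · rw [← Complex.ofReal_sum, Complex.ofReal_ne_zero]
    refine (hpos.trans_le (Finset.single_le_sum (fun k _ => hd k) ?_)).ne'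
    rw [Finset.mem_Icc]
    exact ⟨fun _ => by simp, fun _ => by simp⟩

end RadialField
end NCTorus
end

/-! ### Matching the trace and conclusion -/

noncomputable section
namespace NCTorus
open MeasureTheory Topology Filter
open scoped ContDiff ENNReal
variable {n : ℕ} {θ : Matrix (Fin n) (Fin n) ℝ}
open SmoothTorus

theorem exists_gen_mul_monomial (j : Fin n) (k : Fin n → ℤ) : ∃ c : Circle,
    (gen θ j : SmoothTorus θ) * (monomial θ k : SmoothTorus θ) =
      (c : ℂ) • (monomial θ (k + Pi.single j 1) : SmoothTorus θ) :=
  exists_smul_monomial (by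
    rw [add_comm, toOp_mul]
    exact (isWeyl_gen j).mul (isWeyl_monomial k))

theorem coeff_gen_mul (hθ : θ.transpose = -θ) {j : Fin n} {k : Fin n → ℤ} {c : Circle}
    (hc : (gen θ j : SmoothTorus θ) * (monomial θ k : SmoothTorus θ) =
      (c : ℂ) • (monomial θ (k + Pi.single j 1) : SmoothTorus θ)) (u : SmoothTorus θ) :
    coeff ((gen θ j : SmoothTorus θ) * u) (k + Pi.single j 1) = c * coeff u k := by
  have h1 := (hasSum_fourier hθ u).map (AddMonoidHom.mulLeft (gen θ j : SmoothTorus θ))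
    (continuous_mulLeft _)
  refine (hasSum_coeff_of_hasSum h1 (k + Pi.single j 1)).unique ?_
  convert hasSum_single k fun l hl => ?_ using 1
  · simp [hc, coeff_smul, coeff_monomial, mul_comm]
  · obtain ⟨d, hd⟩ := exists_gen_mul_monomial (θ := θ) j l
    simp [hd, coeff_smul, coeff_monomial, hl]

/-- Conjugating a multiplier by `U_j` shifts its values by `e_j`, the phase of `U_j U^k` cancelling
against that of the adjoint. In the other term `U_j U_j^* = 1`. -/
theorem coeff_lie_multiplier_gen (hθ : θ.transpose = -θ) {T : Module.End ℂ (SmoothTorus θ)}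
    {a : (Fin n → ℤ) → ℂ} (hT : ∀ u k, coeff (T u) k = a k * coeff u k) (z : ℂ) (j : Fin n)
    (u : SmoothTorus θ) (k : Fin n → ℤ) :
    coeff (⁅LinearMap.mulLeft ℂ (z • star (gen θ j : SmoothTorus θ)) * T,
      LinearMap.mulLeft ℂ (gen θ j : SmoothTorus θ)⁆ u) k =
      z * (a (k + Pi.single j 1) - a k) * coeff u k := by
  obtain ⟨c, hc⟩ := exists_gen_mul_monomial (θ := θ) j k
  have hgs : (gen θ j : SmoothTorus θ) * star (gen θ j : SmoothTorus θ) = 1 :=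
    Unitary.mul_star_self_of_mem (gen θ j).2
  have h1 : coeff (star (gen θ j : SmoothTorus θ) * T ((gen θ j : SmoothTorus θ) * u)) k =
      a (k + Pi.single j 1) * coeff u k := by
    refine mul_left_cancel₀ c.coe_ne_zero ?_
    rw [← coeff_gen_mul hθ hc, ← mul_assoc, hgs, one_mul, hT, coeff_gen_mul hθ hc, mul_left_comm]
  rw [coeff_lie]
  simp only [Module.End.mul_apply, LinearMap.mulLeft_apply, smul_mul_assoc, mul_smul_comm,
    coeff_smul, h1]
  rw [← mul_assoc (gen θ j : SmoothTorus θ), hgs, one_mul, hT]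
  ring

theorem smoothing_of_diagonal (hθ : θ.transpose = -θ) {Q : Module.End ℂ (SmoothTorus θ)}
    {s : Finset (Fin n → ℤ)} {c : (Fin n → ℤ) → ℂ} (hc : ∀ k ∉ s, c k = 0)
    (hQ : ∀ u k, coeff (Q u) k = c k * coeff u k) : Q ∈ Smoothing θ := by
  obtain ⟨R, hR, h⟩ := smoothing_of_matrix hθ (A := fun k l => if k = l then c k else 0) fun N => by
    refine ⟨∑ k ∈ s, (wt k * wt k) ^ N * ‖c k‖, fun k l => ?_⟩
    have hnn (k) : 0 ≤ (wt k * wt k) ^ N * ‖c k‖ := by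
      have := wt_pos k
      positivity
    split_ifs with hkl
    · subst hkl
      by_cases hk : k ∈ s
      · exact Finset.single_le_sum (f := fun k => (wt k * wt k) ^ N * ‖c k‖) (fun k _ => hnn k) hk
      · rw [hc k hk, norm_zero, mul_zero]
        exact Finset.sum_nonneg fun k _ => hnn k
    · rw [norm_zero, mul_zero]
      exact Finset.sum_nonneg fun k _ => hnn k
  have : Q = R := LinearMap.ext fun u => coeff_injective hθ fun k => by
    rw [hQ]
    refine HasSum.unique ?_ (h u k)
    convert hasSum_single k fun l hl => ?_ using 1
    · simp
    · simp [Ne.symm hl]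
  rwa [this]

theorem smoothing_sub {R S : Module.End ℂ (SmoothTorus θ)} (hR : R ∈ Smoothing θ)
    (hS : S ∈ Smoothing θ) : R - S ∈ Smoothing θ := by
  obtain ⟨R', hR'⟩ := hR
  obtain ⟨S', hS'⟩ := hS
  exact ⟨R' - S', fun u => by rw [sub_apply, hR', hS', LinearMap.sub_apply]⟩

theorem summable_entry_of_smoothing (hθ : θ.transpose = -θ) {R : Module.End ℂ (SmoothTorus θ)}
    (hR : R ∈ Smoothing θ) : Summable fun k => entry R k k := by
  obtain ⟨s, hs⟩ := exists_summable_wt n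
  obtain ⟨C, hC⟩ := rapidFamily_of_smoothing hθ hR 0 s
  refine Summable.of_norm_bounded (hs.mul_left C) fun k => ?_
  have h1 := wt_mul_coeff_le 0 (R (monomial θ k : SmoothTorus θ)) k
  rw [pow_zero, one_mul] at h1
  have hw : 0 < wt k ^ s := pow_pos (wt_pos k) s
  rw [← div_eq_mul_inv, le_div_iff₀ hw, mul_comm]
  exact (mul_le_mul_of_nonneg_left h1 hw.le).trans (hC k)

theorem exists_eq_sum_lie_gen_add (hn : 0 < n) (hθ : θ.transpose = -θ)
    {R : Module.End ℂ (SmoothTorus θ)} (hR : R ∈ Smoothing θ) :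
    ∃ (P : Fin n → Module.End ℂ (SmoothTorus θ)) (R₁ R₂ R₃ R₄ : Module.End ℂ (SmoothTorus θ)),
      (∀ j, P j ∈ PsiDO θ (-(n : ℂ) + 1)) ∧
      R₁ ∈ Smoothing θ ∧ R₂ ∈ Smoothing θ ∧ R₃ ∈ Smoothing θ ∧ R₄ ∈ Smoothing θ ∧
      R = (∑ j, ⁅P j, LinearMap.mulLeft ℂ (gen θ j : SmoothTorus θ)⁆) + ⁅R₁, R₂⁆ + ⁅R₃, R₄⁆ := by
  obtain ⟨f, hf, s, c, hfc, hcs, hc⟩ := exists_isScalarSymbol_divergence hn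
  choose T hT hTP using fun j => (hf j).exists_psiDO hθ
  -- Chosen so that `Q` below has the same trace as `R`.
  set z : ℂ := (∑' k, entry R k k) / ∑ k ∈ s, c k with hz
  set P : Fin n → Module.End ℂ (SmoothTorus θ) := fun j =>
    LinearMap.mulLeft ℂ (z • star (gen θ j : SmoothTorus θ)) * T j with hP
  set Q := ∑ j, ⁅P j, LinearMap.mulLeft ℂ (gen θ j : SmoothTorus θ)⁆ with hQdef
  have hQ (u : SmoothTorus θ) (k : Fin n → ℤ) : coeff (Q u) k = z * c k * coeff u k := by
    rw [hQdef, LinearMap.sum_apply, coeff_sum]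
    simp only [hP, coeff_lie_multiplier_gen hθ (hT _), ← Finset.sum_mul, ← Finset.mul_sum, hfc]
  have hQs : Q ∈ Smoothing θ :=
    smoothing_of_diagonal hθ (fun k hk => by rw [hcs k hk, mul_zero]) hQ
  have htr : HasSum (fun k => entry (R - Q) k k) 0 := by
    have h1 : HasSum (fun k => z * c k) (∑ k ∈ s, z * c k) := hasSum_sum_of_ne_finset_zero
      fun k hk => by rw [hcs k hk, mul_zero]
    have h2 := (summable_entry_of_smoothing hθ hR).hasSum.sub h1
    rw [← Finset.mul_sum, hz, div_mul_cancel₀ _ hc, sub_self] at h2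
    refine h2.congr_fun fun k => ?_
    rw [entry, entry, LinearMap.sub_apply, coeff_sub, hQ, coeff_monomial, if_pos rfl, mul_one]
  obtain ⟨R₁, h₁, R₂, h₂, R₃, h₃, R₄, h₄, h⟩ :=
    exists_smoothing_commutators hn hθ (smoothing_sub hR hQs) htr
  refine ⟨P, R₁, R₂, R₃, R₄, fun j => hTP j _, h₁, h₂, h₃, h₄, ?_⟩
  rw [add_assoc, ← h, add_sub_cancel]

end NCTorus
end

theorem mainTheorem9 (n : ℕ) (hn : 2 ≤ n) (θ : Matrix (Fin n) (Fin n) ℝ)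
    (hθ : θ.transpose = -θ) (R : Module.End ℂ (NCTorus.SmoothTorus θ))
    (hR : R ∈ NCTorus.Smoothing θ) :
    (∃ (P : Fin n → Module.End ℂ (NCTorus.SmoothTorus θ))
        (R₁ R₂ R₃ R₄ : Module.End ℂ (NCTorus.SmoothTorus θ)),
      (∀ j, P j ∈ NCTorus.PsiDO θ (-(n : ℂ) + 1)) ∧
      R₁ ∈ NCTorus.Smoothing θ ∧ R₂ ∈ NCTorus.Smoothing θ ∧
      R₃ ∈ NCTorus.Smoothing θ ∧ R₄ ∈ NCTorus.Smoothing θ ∧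
      R = (∑ j, ⁅P j, LinearMap.mulLeft ℂ (NCTorus.SmoothTorus.gen θ j : NCTorus.SmoothTorus θ)⁆)
            + ⁅R₁, R₂⁆ + ⁅R₃, R₄⁆) ∧
    R ∈ NCTorus.commutatorSpace (NCTorus.PsiDOInt θ) := by
  obtain ⟨P, R₁, R₂, R₃, R₄, hP, h₁, h₂, h₃, h₄, h⟩ :=
    NCTorus.exists_eq_sum_lie_gen_add (by omega) hθ hR
  refine ⟨⟨P, R₁, R₂, R₃, R₄, hP, h₁, h₂, h₃, h₄, h⟩, ?_⟩
  -- A smoothing operator has every order; `0` is an arbitrary integer choice.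
  have hs {S : Module.End ℂ (NCTorus.SmoothTorus θ)} (hS : S ∈ NCTorus.Smoothing θ) :
      S ∈ NCTorus.PsiDOInt θ :=
    Set.mem_iUnion.2 ⟨0, NCTorus.smoothing_subset_psiDO hθ _ hS⟩
  rw [h]
  refine add_mem (add_mem (Submodule.sum_mem _ fun j _ => ?_) ?_) ?_
  · refine Submodule.subset_span ⟨_, Set.mem_iUnion.2 ⟨-(n : ℤ) + 1, ?_⟩, _,
      Set.mem_iUnion.2 ⟨0, ?_⟩, rfl⟩
    · exact_mod_cast hP j
    · exact_mod_cast NCTorus.mulLeft_mem_psiDO hθ _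
  · exact Submodule.subset_span ⟨_, hs h₁, _, hs h₂, rfl⟩
  · exact Submodule.subset_span ⟨_, hs h₃, _, hs h₄, rfl⟩
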